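/- For $1\le r\le\infty$ let $\ell_r$ be the Banach space of complex $r$-summable (for $r=\infty$: bounded) sequences $(z_n)_{n\ge 1}$, let $B_{\ell_r}$ be its open unit ball, and let $H_\infty(B_{\ell_r})$ be the space of bounded holomorphic (i.e. Fréchet differentiable) functions $f:B_{\ell_r}\to\mathbb C$. Each such $f$ has a unique family $(c_\alpha(f))_{\alpha}$ of monomial coefficients, indexed by the finitely supported multi-indices $\alpha\in\mathbb N_0^{(\mathbb N)}$, such that $f(z)=\sum_\alpha c_\alpha(f)z^\alpha$ (absolutely convergent) for every finitely supported $z\in B_{\ell_r}$. Put $$\operatorname{mon} H_\infty(B_{\ell_r})=\Big\{z\in B_{\ell_r}:\ \sum_{\alpha}|c_\alpha(f)z^\alpha|<\infty\ \text{ for all } f\in H_\infty(B_{\ell_r})\Big\}.$$ Products of sequences are taken coordinatewise, and $1/\infty=0$. **Theorem.** Let $1\le r\le\infty$ and $\sigma=1-\frac1{\min(r,2)}$. For $\beta\in\mathbb R$ put $x^{(\beta)}=\left(\frac{1}{n^{\frac1r+\sigma}(\log(n+2))^{\beta}}\right)_{n\ge1}$. (1a) If $1\le r\le 2$, then for every $\theta>\frac12$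 $$\left(\frac1{n^{\sigma}(\log(n+2))^{\theta\sigma}}\right)_n\cdot B_{\ell_r}\subset \operatorname{mon}H_\infty(B_{\ell_r}).$$ In particular, if $\beta>\frac1{2r}+\frac12$, then $c\,x^{(\beta)}\in\operatorname{mon}H_\infty(B_{\ell_r})$ for every constant $c>0$ such that $c\,x^{(\beta)}\in B_{\ell_r}$. (1b) If $2\le r\le\infty$, then for every $\theta>0$ $$\left(\frac1{n^{\sigma}(\log(n+2))^{\theta}}\right)_n\cdot B_{\ell_r}\subset \operatorname{mon}H_\infty(B_{\ell_r}).$$ In particular, if $\beta>\frac1r$, then $c\,x^{(\beta)}\in\operatorname{mon}H_\infty(B_{\ell_r})$ for every constant $c>0$ such that $c\,x^{(\beta)}\in B_{\ell_r}$. (2) Conversely, let $1\le r\le\infty$ and $\beta\in\mathbb R$. If $c\,x^{(\beta)}\in\operatorname{mon}H_\infty(B_{\ell_r})$ for some constant $c>0$ (for instance $c=1$), then $\beta\ge\frac1r$. -/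

import Mathlib

open scoped ENNReal

noncomputable section

/-- The complex sequence space `ℓ_r`, with its usual norm. Sequences `(z_n)_{n ≥ 1}` are indexed
by `k : ℕ`, the entry with index `k` being `z_{k+1}`. -/
abbrev SeqSpace (r : ℝ≥0∞) : Type := lp (fun _ : ℕ => ℂ) r

/-- The open unit ball of `ℓ_r`, as a set of complex sequences. -/
def seqBall (r : ℝ≥0∞) : Set (ℕ → ℂ) :=
  {z | ∃ u : SeqSpace r, ‖u‖ < 1 ∧ (u : ℕ → ℂ) = z}

/-- The monomial `z^α = ∏_i z_i ^ α_i` for a multi-index `α` of finite support. -/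
def seqMonomial (z : ℕ → ℂ) (α : ℕ →₀ ℕ) : ℂ :=
  α.prod fun i k => z i ^ k

/-- The space `H_∞(B_{ℓ_r})`: the functions that are holomorphic (complex Fréchet differentiable)
and bounded on the open unit ball of `ℓ_r`. Values off the ball play no role. -/
def HInfty (r : ℝ≥0∞) [Fact (1 ≤ r)] : Set (SeqSpace r → ℂ) :=
  {f | DifferentiableOn ℂ f (Metric.ball 0 1) ∧ ∃ M : ℝ, ∀ u ∈ Metric.ball 0 1, ‖f u‖ ≤ M}

/-- `c` is the family of monomial coefficients of `f`: on each finite dimensional section of the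
open unit ball, `f u = ∑_α c_α u^α`, with absolute convergence. For a holomorphic `f` on the ball
there is exactly one such family. -/
def IsMonomialExpansion (r : ℝ≥0∞) [Fact (1 ≤ r)] (f : SeqSpace r → ℂ)
    (c : (ℕ →₀ ℕ) → ℂ) : Prop :=
  ∀ u ∈ Metric.ball (0 : SeqSpace r) 1, (Function.support (u : ℕ → ℂ)).Finite →
    HasSum (fun α => c α * seqMonomial u α) (f u)

/-- `mon H_∞(B_{ℓ_r})`: the points of the open unit ball at which the monomial expansion of every
bounded holomorphic function on the ball converges absolutely. -/
def monHInfty (r : ℝ≥0∞) [Fact (1 ≤ r)] : Set (ℕ → ℂ) :=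
  {z | z ∈ seqBall r ∧ ∀ f ∈ HInfty r, ∃ c : (ℕ →₀ ℕ) → ℂ,
    IsMonomialExpansion r f c ∧ Summable fun α => ‖c α * seqMonomial z α‖}

/-- `1 / r` as a real number, equal to `0` for `r = ∞`. -/
def recip (r : ℝ≥0∞) : ℝ := (r⁻¹).toReal

/-- `σ = 1 - 1 / min (r, 2)`. -/
def sigmaExp (r : ℝ≥0∞) : ℝ := 1 - recip (min r 2)

/-- The number `1 / (n ^ a * (log (n + 2)) ^ b)`. -/
def logWeight (a b : ℝ) (n : ℕ) : ℝ :=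
  1 / ((n : ℝ) ^ a * Real.log ((n : ℝ) + 2) ^ b)

/-- The sequence `(1 / (n ^ a * (log (n + 2)) ^ b))_{n ≥ 1}`. -/
def logSeq (a b : ℝ) : ℕ → ℂ := fun k => (logWeight a b (k + 1) : ℂ)

end

/-!
# Monomial convergence on `ℓ_r`

Domains of monomial convergence of bounded holomorphic functions on the unit ball of `ℓ_r`.

All coefficient estimates come from averaging over the compact torus `Torus = ℕ → Circle`: the
monomials `chr α` are orthonormal characters, and on the finite dimensional sections `emb r N` of
the ball the coefficients of a holomorphic `f` are, up to normalisation, Fourier coefficients of `f`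
on a torus (`exists_isMonomialExpansion`, `fourierT_of_isMonomialExpansion`).

*Convergence.* Write a multi-index as `α + τ + e_k`, where `α` lives on the first `n` coordinates,
`τ` on the later ones and `k` is the largest index. A bound `C q ^ |α| (1/2) ^ |τ|` for the sum over
`k` and `τ` gives convergence (`summable_of_forall_sum_le`). Since `f` is bounded on the ball, so is
its derivative: `|f'(x) y| ≤ M` whenever `‖x‖ + ‖y‖ < 1`. The coefficients of `f'` in the direction
`e_k` are essentially the `c_(α + τ + e_k)`, so choosing the signs of `y_k` yields bounds for sums
over `k`.

* For `r ≥ 2` one uses an `L²` version,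
  `∑_k y_k (∑_τ |c_(α + τ + e_k)|² s^(2 (α + τ)))^(1/2) ≤ 2^m M` with `|τ| = m`
  (`sum_mul_sqrt_sum_coeff_sq_le`). It rests on a comparison of `L¹` and `L²` norms on the torus
  (`sqrt_sum_sq_le_integral_norm`), applied to the part of the series with fixed head `α` and degree
  `m` in the tail: a frequency is a sum of two such multi-indices in at most `4 ^ m` ways. The
  Cauchy-Schwarz inequality finishes the proof, because the sum of the monomials `x ^ τ` over all
  `τ` of degree `m` with indices up to `k` is at most `√(k + 2)` when `x_j ≤ 1 / (4 (j + 1))`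
  (`sum_antidiag_monom_le`).
* For `r ≤ 2` the bound is applied, for each `τ`, at the point `s` with coordinates
  `δ (τ_j / m) ^ (1 / r)`, which maximises `s ^ τ` on a ball of `ℓ_r` (`norm_emb_rpow_div_le`). By
  the weighted inequality between the arithmetic and the geometric mean with exponents `1 / r` and
  `σ = 1 - 1 / r`, the sum over `τ` splits into a multinomial sum of the `|u_j| ^ r` and a sum of
  monomials in the weights (`summable_of_le_rpow_weight`).

*Divergence.* For each `m` take a polynomial of degree `m`, linear in the variables of each of the
dyadic blocks `[2 ^ (m + l), 2 ^ (m + l + 1))`, `l < m`, with coefficients `±1`. For random signs its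
norm as a multilinear form on Euclidean spaces is at most exponential in `m`
(`exists_signs_norm_sum_prod_le`). Because the blocks are disjoint, the inequality between the means
gains a factor `m ^ (-m / r)` on the unit ball of `ℓ_r` (`prod_sqrt_sum_blockIdx_le`); the powers of
the block sizes lost in passing from `ℓ_r` to `ℓ_2` are recovered from the sums of `x^(β)` over the
blocks (`mul_rpow_le_sum_norm_blockIdx`). A lacunary
series of these polynomials is a bounded holomorphic function, and absolute convergence of its
expansion at `c x^(β)` forces `(κ m ^ (1 / r - β)) ^ m` to be bounded, whence `β ≥ 1 / r`.
-/

noncomputable section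

open MeasureTheory Finset
open scoped ENNReal Topology

/-! ### Monomials -/

/-- The monomial `∏ i, x i ^ α i` in an arbitrary commutative monoid. -/
def monom {R : Type*} [CommMonoid R] (x : ℕ → R) (α : ℕ →₀ ℕ) : R :=
  α.prod fun i k => x i ^ k

lemma seqMonomial_eq_monom (z : ℕ → ℂ) (α : ℕ →₀ ℕ) : seqMonomial z α = monom z α := rfl

section monom

variable {R : Type*} [CommMonoid R]

@[simp] lemma monom_zero (x : ℕ → R) : monom x 0 = 1 := by simp [monom]

@[simp] lemma monom_one (α : ℕ →₀ ℕ) : monom (1 : ℕ → R) α = 1 := by simp [monom, Finsupp.prod]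

lemma monom_add (x : ℕ → R) (α β : ℕ →₀ ℕ) : monom x (α + β) = monom x α * monom x β :=
  Finsupp.prod_add_index' (by simp) (by simp [pow_add])

lemma monom_mul (x y : ℕ → R) (α : ℕ →₀ ℕ) :
    monom (fun i => x i * y i) α = monom x α * monom y α := by
  simp [monom, Finsupp.prod, mul_pow, Finset.prod_mul_distrib]

@[simp] lemma monom_single (x : ℕ → R) (i k : ℕ) : monom x (Finsupp.single i k) = x i ^ k := by
  simp [monom]

lemma map_monom {S F : Type*} [CommMonoid S] [FunLike F R S] [MonoidHomClass F R S] (φ : F)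
    (x : ℕ → R) (α : ℕ →₀ ℕ) : φ (monom x α) = monom (fun i => φ (x i)) α := by
  simp [monom, Finsupp.prod, map_prod]

lemma monom_congr {x y : ℕ → R} {α : ℕ →₀ ℕ} (h : ∀ i ∈ α.support, x i = y i) :
    monom x α = monom y α :=
  Finset.prod_congr rfl fun i hi => by simp only [h i hi]

lemma monom_eq_prod {s : Finset ℕ} {α : ℕ →₀ ℕ} (h : α.support ⊆ s) (x : ℕ → R) :
    monom x α = ∏ i ∈ s, x i ^ α i :=
  Finsupp.prod_of_support_subset _ h _ (by simp)

lemma monom_comp (x : ℕ → R) (p : ℕ → ℕ) (α : ℕ →₀ ℕ) :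
    monom (fun i => x (p i)) α = monom x (α.mapDomain p) := by
  rw [monom, monom, Finsupp.prod_mapDomain_index (by simp) (by simp [pow_add])]

lemma monom_const (t : R) (α : ℕ →₀ ℕ) : monom (fun _ => t) α = t ^ α.degree := by
  simp [monom, Finsupp.prod, Finsupp.degree_apply, Finset.prod_pow_eq_pow_sum]

end monom

lemma norm_monom (z : ℕ → ℂ) (α : ℕ →₀ ℕ) : ‖monom z α‖ = monom (fun i => ‖z i‖) α := by
  simp [monom, Finsupp.prod, norm_prod]

lemma monom_nonneg {x : ℕ → ℝ} (hx : ∀ i, 0 ≤ x i) (α : ℕ →₀ ℕ) : 0 ≤ monom x α :=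
  Finset.prod_nonneg fun i _ => pow_nonneg (hx i) _

lemma monom_le_monom {x y : ℕ → ℝ} {α : ℕ →₀ ℕ} (hx : ∀ i, 0 ≤ x i)
    (h : ∀ i ∈ α.support, x i ≤ y i) : monom x α ≤ monom y α :=
  Finset.prod_le_prod (fun i _ => pow_nonneg (hx i) _)
    fun i hi => pow_le_pow_left₀ (hx i) (h i hi) _

lemma monom_eq_zero {M : Type*} [CommMonoidWithZero M] [NoZeroDivisors M] [Nontrivial M]
    {x : ℕ → M} {α : ℕ →₀ ℕ} {i : ℕ}
    (hi : i ∈ α.support) (hx : x i = 0) : monom x α = 0 := by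
  refine Finset.prod_eq_zero hi ?_
  simp [hx, Finsupp.mem_support_iff.mp hi]

/-! ### Harmonic analysis on the infinite torus -/

instance : MeasurableSpace Circle := borel Circle

instance : BorelSpace Circle := ⟨rfl⟩

/-- The normalized Haar measure of a compact group. -/
def probHaar (G : Type*) [Group G] [TopologicalSpace G] [IsTopologicalGroup G] [CompactSpace G]
    [MeasurableSpace G] [BorelSpace G] : Measure G :=
  Measure.haarMeasure ⊤

section probHaar

variable (G : Type*) [Group G] [TopologicalSpace G] [IsTopologicalGroup G] [CompactSpace G]
  [MeasurableSpace G] [BorelSpace G]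

instance : (probHaar G).IsHaarMeasure := by unfold probHaar; infer_instance

instance : IsProbabilityMeasure (probHaar G) :=
  ⟨by simpa [probHaar] using Measure.haarMeasure_self (G := G) (K₀ := ⊤)⟩

variable {G}

lemma Continuous.integrable_probHaar {E : Type*} [NormedAddCommGroup E]
    [SecondCountableTopologyEither G E] {g : G → E} (hg : Continuous g) :
    Integrable g (probHaar G) :=
  hg.integrable_of_hasCompactSupport (HasCompactSupport.of_compactSpace g)

end probHaar

lemma integral_eq_zero_of_mul_left {G : Type*} [Group G] [MeasurableSpace G] [MeasurableMul G]
    {μ : Measure G} [μ.IsMulLeftInvariant]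
    {F : G → ℂ} {c : ℂ} (g : G) (hc : c ≠ 1) (h : ∀ x, F (g * x) = c * F x) :
    ∫ x, F x ∂μ = 0 := by
  have h1 : ∫ x, F x ∂μ = c * ∫ x, F x ∂μ := by
    rw [← integral_const_mul, ← integral_mul_left_eq_self F g]
    simp_rw [h]
  have h2 : (1 - c) * ∫ x, F x ∂μ = 0 := by linear_combination h1
  exact (mul_eq_zero.mp h2).resolve_left (sub_ne_zero.mpr hc.symm)

/-- The infinite dimensional torus. -/
abbrev Torus : Type := ℕ → Circle

/-- The normalized Haar measure of the infinite dimensional torus. -/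
abbrev haarT : Measure Torus := probHaar Torus

/-- The character `θ ↦ θ^α` of the torus, with complex values. -/
def chr (α : ℕ →₀ ℕ) (θ : Torus) : ℂ := monom (fun j => (θ j : ℂ)) α

lemma chr_mul (α : ℕ →₀ ℕ) (θ η : Torus) : chr α (θ * η) = chr α θ * chr α η := by
  simp [chr, ← monom_mul]

lemma chr_add (α β : ℕ →₀ ℕ) (θ : Torus) : chr (α + β) θ = chr α θ * chr β θ := monom_add ..

@[simp] lemma norm_chr (α : ℕ →₀ ℕ) (θ : Torus) : ‖chr α θ‖ = 1 := by
  rw [chr, norm_monom]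
  exact (monom_congr fun i _ => (θ i).norm_coe).trans (monom_one α)

@[fun_prop] lemma continuous_chr (α : ℕ →₀ ℕ) : Continuous (chr α) := by
  unfold chr monom Finsupp.prod
  fun_prop

lemma exp_pi_div_pow_mul_conj_pow {a b : ℕ} (h : a ≠ b) :
    ((Circle.exp (Real.pi / ((a : ℝ) - b)) : ℂ)) ^ a *
      starRingEnd ℂ ((Circle.exp (Real.pi / ((a : ℝ) - b)) : ℂ) ^ b) = -1 := by
  have hab : ((a : ℂ) - b) ≠ 0 := sub_ne_zero.mpr (by exact_mod_cast h)
  rw [Circle.coe_exp, ← Complex.exp_nat_mul, ← Complex.exp_nat_mul, ← Complex.exp_conj,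
    ← Complex.exp_add, ← Complex.exp_pi_mul_I]
  congr 1
  simp only [map_mul, Complex.conj_ofReal, Complex.conj_I, map_natCast]
  push_cast
  field_simp
  ring

lemma integral_circle_pow_mul_conj_pow (a b : ℕ) :
    ∫ φ : Circle, (φ : ℂ) ^ a * starRingEnd ℂ ((φ : ℂ) ^ b) ∂(probHaar Circle) =
      if a = b then 1 else 0 := by
  split_ifs with h
  · subst h
    have : ∀ φ : Circle, (φ : ℂ) ^ a * starRingEnd ℂ ((φ : ℂ) ^ a) = 1 := fun φ => by
      rw [Complex.mul_conj, Complex.normSq_eq_norm_sq]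
      simp [φ.norm_coe]
    simp [this, -map_pow]
  · refine integral_eq_zero_of_mul_left (c := -1) (Circle.exp (Real.pi / ((a : ℝ) - b)))
      (by norm_num) fun φ => ?_
    rw [← exp_pi_div_pow_mul_conj_pow h]
    simp only [Circle.coe_mul, mul_pow, map_mul]
    ring

lemma chr_mulSingle (α : ℕ →₀ ℕ) (j : ℕ) (φ : Circle) :
    chr α (Pi.mulSingle j φ) = (φ : ℂ) ^ α j := by
  rw [chr, monom_eq_prod (s := insert j α.support) (by simp),
    Finset.prod_eq_single_of_mem j (by simp)]
  · simp
  · intro i _ hij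
    simp [Pi.mulSingle_eq_of_ne hij]

/-- Orthonormality of the characters `θ ↦ θ^α`. -/
lemma integral_chr_mul_conj (α β : ℕ →₀ ℕ) :
    ∫ θ, chr α θ * starRingEnd ℂ (chr β θ) ∂haarT = if α = β then 1 else 0 := by
  split_ifs with h
  · subst h
    simp [Complex.mul_conj, Complex.normSq_eq_norm_sq]
  · obtain ⟨j, hj⟩ : ∃ j, α j ≠ β j := by
      by_contra! h'
      exact h (Finsupp.ext h')
    refine integral_eq_zero_of_mul_left (c := -1)
      (Pi.mulSingle j (Circle.exp (Real.pi / ((α j : ℝ) - β j)))) (by norm_num) fun θ => ?_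
    rw [← exp_pi_div_pow_mul_conj_pow hj, chr_mul, chr_mul, chr_mulSingle, chr_mulSingle, map_mul]
    ring

/-- The Fourier coefficient of a function on the torus at a multi-index. -/
def fourierT (g : Torus → ℂ) (α : ℕ →₀ ℕ) : ℂ := ∫ θ, g θ * starRingEnd ℂ (chr α θ) ∂haarT

lemma norm_fourierT_le_integral (g : Torus → ℂ) (α : ℕ →₀ ℕ) :
    ‖fourierT g α‖ ≤ ∫ θ, ‖g θ‖ ∂haarT := by
  refine (norm_integral_le_integral_norm _).trans_eq ?_
  simp

lemma norm_fourierT_le {g : Torus → ℂ} {M : ℝ} (h : ∀ θ, ‖g θ‖ ≤ M) (α : ℕ →₀ ℕ) :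
    ‖fourierT g α‖ ≤ M := by
  have := norm_integral_le_of_norm_le_const (μ := haarT)
    (f := fun θ => g θ * starRingEnd ℂ (chr α θ)) (C := M) (by simpa using .of_forall h)
  simpa [fourierT] using this

/-- The Fourier coefficients of the sum of an everywhere convergent series of multiples of
characters. -/
lemma fourierT_hasSum {ι : Type*} [Countable ι] {e : ι → ℕ →₀ ℕ} {q : ι → ℂ} {g : Torus → ℂ}
    (h : ∀ θ, HasSum (fun i => q i * chr (e i) θ) (g θ)) (β : ℕ →₀ ℕ) :
    HasSum (fun i => if e i = β then q i else 0) (fourierT g β) := by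
  have hq : Summable fun i => ‖q i‖ := by
    simpa only [norm_mul, norm_chr, mul_one] using (h 1).summable.norm
  have key := hasSum_integral_of_summable_integral_norm (μ := haarT)
    (F := fun i θ => q i * chr (e i) θ * starRingEnd ℂ (chr β θ))
    (fun i => Continuous.integrable_probHaar (by fun_prop)) (by simpa using hq)
  convert! key using 1
  · ext i
    simp_rw [mul_assoc]
    rw [integral_const_mul, integral_chr_mul_conj]
    simp
  · refine integral_congr_ae (.of_forall fun θ => ?_)
    simp only
    rw [tsum_mul_right, (h θ).tsum_eq]

lemma fourierT_eq_of_hasSum {q : (ℕ →₀ ℕ) → ℂ} {g : Torus → ℂ}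
    (h : ∀ θ, HasSum (fun α => q α * chr α θ) (g θ)) (β : ℕ →₀ ℕ) : fourierT g β = q β := by
  have := fourierT_hasSum (e := id) h β
  simp only [id] at this
  rw [← this.tsum_eq, tsum_ite_eq]

lemma continuous_of_hasSum_chr {ι : Type*} {e : ι → ℕ →₀ ℕ} {q : ι → ℂ} {g : Torus → ℂ}
    (h : ∀ θ, HasSum (fun i => q i * chr (e i) θ) (g θ)) : Continuous g := by
  have hq : Summable fun i => ‖q i‖ := by
    simpa only [norm_mul, norm_chr, mul_one] using (h 1).summable.norm
  have : g = fun θ => ∑' i, q i * chr (e i) θ := funext fun θ => (h θ).tsum_eq.symm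
  rw [this]
  exact continuous_tsum (fun i => by fun_prop) hq (by simp)

/-! ### Comparing `L¹` and `L²` norms of trigonometric polynomials -/

lemma integral_norm_sq_sum_chr_eq {ι : Type*} (I : Finset ι) (e : ι → ℕ →₀ ℕ) (b : ι → ℂ) :
    ((∫ θ, ‖∑ i ∈ I, b i * chr (e i) θ‖ ^ 2 ∂haarT : ℝ) : ℂ) =
      ∑ i ∈ I, ∑ j ∈ I, if e i = e j then b i * starRingEnd ℂ (b j) else 0 := by
  have hpt : ∀ θ : Torus, ((‖∑ i ∈ I, b i * chr (e i) θ‖ ^ 2 : ℝ) : ℂ) =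
      ∑ i ∈ I, ∑ j ∈ I, b i * starRingEnd ℂ (b j) *
        (chr (e i) θ * starRingEnd ℂ (chr (e j) θ)) := fun θ => by
    push_cast
    rw [← Complex.mul_conj', map_sum, Finset.sum_mul_sum]
    refine Finset.sum_congr rfl fun i _ => Finset.sum_congr rfl fun j _ => ?_
    rw [map_mul]
    ring
  rw [← integral_complex_ofReal]
  simp_rw [hpt]
  rw [integral_finsetSum _ fun i _ => Continuous.integrable_probHaar (by fun_prop)]
  refine Finset.sum_congr rfl fun i _ => ?_
  rw [integral_finsetSum _ fun i _ => Continuous.integrable_probHaar (by fun_prop)]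
  refine Finset.sum_congr rfl fun j _ => ?_
  rw [integral_const_mul, integral_chr_mul_conj]
  simp

/-- If each frequency occurs at most `K` times, then the squared `L²` norm of a trigonometric
polynomial is at most `K` times the sum of the squares of its coefficients. -/
lemma integral_norm_sq_sum_chr_le {ι : Type*} (I : Finset ι) (e : ι → ℕ →₀ ℕ) (b : ι → ℂ) {K : ℕ}
    (hK : ∀ γ, #{j ∈ I | e j = γ} ≤ K) :
    ∫ θ, ‖∑ i ∈ I, b i * chr (e i) θ‖ ^ 2 ∂haarT ≤ K * ∑ i ∈ I, ‖b i‖ ^ 2 := by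
  have h0 : 0 ≤ ∫ θ, ‖∑ i ∈ I, b i * chr (e i) θ‖ ^ 2 ∂haarT :=
    integral_nonneg fun θ => by positivity
  have h1 := congrArg norm (integral_norm_sq_sum_chr_eq I e b)
  rw [Complex.norm_real, Real.norm_of_nonneg h0] at h1
  rw [h1]
  have hsum : ∀ i, ∑ j ∈ I, (if e i = e j then ‖b i‖ ^ 2 else 0) ≤ K * ‖b i‖ ^ 2 := fun i => by
    rw [← Finset.sum_filter, Finset.sum_const, nsmul_eq_mul]
    gcongr
    simpa only [eq_comm] using hK (e i)
  calc ‖∑ i ∈ I, ∑ j ∈ I, if e i = e j then b i * starRingEnd ℂ (b j) else 0‖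
      ≤ ∑ i ∈ I, ∑ j ∈ I, (if e i = e j then (‖b i‖ ^ 2 + ‖b j‖ ^ 2) / 2 else 0) := by
        refine (norm_sum_le _ _).trans (Finset.sum_le_sum fun i _ => ?_)
        refine (norm_sum_le _ _).trans (Finset.sum_le_sum fun j _ => ?_)
        split_ifs
        · rw [norm_mul, RCLike.norm_conj]
          nlinarith [sq_nonneg (‖b i‖ - ‖b j‖)]
        · simp
    _ = (∑ i ∈ I, ∑ j ∈ I, (if e i = e j then ‖b i‖ ^ 2 else 0)) / 2 +
          (∑ i ∈ I, ∑ j ∈ I, (if e i = e j then ‖b j‖ ^ 2 else 0)) / 2 := by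
        rw [← add_div, ← Finset.sum_add_distrib, Finset.sum_div]
        refine Finset.sum_congr rfl fun i _ => ?_
        rw [← Finset.sum_add_distrib, Finset.sum_div]
        refine Finset.sum_congr rfl fun j _ => ?_
        by_cases h : e i = e j <;> simp [h]
    _ = (∑ i ∈ I, ∑ j ∈ I, (if e i = e j then ‖b i‖ ^ 2 else 0)) / 2 +
          (∑ j ∈ I, ∑ i ∈ I, (if e j = e i then ‖b j‖ ^ 2 else 0)) / 2 := by
        congr 2
        rw [Finset.sum_comm]
        simp only [eq_comm]
    _ ≤ (∑ i ∈ I, K * ‖b i‖ ^ 2) / 2 + (∑ j ∈ I, K * ‖b j‖ ^ 2) / 2 := by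
        gcongr <;> exact hsum _
    _ = K * ∑ i ∈ I, ‖b i‖ ^ 2 := by rw [add_halves, Finset.mul_sum]

/-- Parseval's identity for trigonometric polynomials. -/
lemma integral_norm_sq_sum_chr (S : Finset (ℕ →₀ ℕ)) (b : (ℕ →₀ ℕ) → ℂ) :
    ∫ θ, ‖∑ α ∈ S, b α * chr α θ‖ ^ 2 ∂haarT = ∑ α ∈ S, ‖b α‖ ^ 2 := by
  have := integral_norm_sq_sum_chr_eq S id b
  simp only [id, Finset.sum_ite_eq, Complex.mul_conj'] at this
  rw [Finset.sum_congr rfl (fun i hi => if_pos hi)] at this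
  exact_mod_cast this

/-- Comparison of the `L¹` and the `L²` norm of a trigonometric polynomial whose square has few
coincidences between the frequencies of its terms. -/
lemma sqrt_sum_sq_le_integral_norm (S : Finset (ℕ →₀ ℕ)) (b : (ℕ →₀ ℕ) → ℂ) {K : ℕ}
    (hK : ∀ γ, #{x ∈ S ×ˢ S | x.1 + x.2 = γ} ≤ K) :
    √(∑ α ∈ S, ‖b α‖ ^ 2) ≤ √K * ∫ θ, ‖∑ α ∈ S, b α * chr α θ‖ ∂haarT := by
  set Q : Torus → ℂ := fun θ => ∑ α ∈ S, b α * chr α θ with hQ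
  set I₂ : ℝ := ∑ α ∈ S, ‖b α‖ ^ 2 with hI₂
  set I₁ : ℝ := ∫ θ, ‖Q θ‖ ∂haarT with hI₁
  have hI₁0 : 0 ≤ I₁ := integral_nonneg fun θ => norm_nonneg _
  have hQc : Continuous Q := by fun_prop
  have e2 : ∫ θ, ‖Q θ‖ ^ 2 ∂haarT = I₂ := integral_norm_sq_sum_chr S b
  have e4 : ∫ θ, ‖Q θ‖ ^ 4 ∂haarT ≤ K * I₂ ^ 2 := by
    have := integral_norm_sq_sum_chr_le (S ×ˢ S) (fun x => x.1 + x.2) (fun x => b x.1 * b x.2) hK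
    have h2 : ∑ x ∈ S ×ˢ S, ‖b x.1 * b x.2‖ ^ 2 = I₂ ^ 2 := by
      rw [sq, hI₂, Finset.sum_mul_sum, Finset.sum_product]
      simp [mul_pow]
    rw [h2] at this
    refine le_trans (le_of_eq (integral_congr_ae (.of_forall fun θ => ?_))) this
    simp only [hQ]
    rw [show (4 : ℕ) = 2 * 2 by norm_num, pow_mul, ← norm_pow, sq (∑ α ∈ S, b α * chr α θ),
      Finset.sum_mul_sum, Finset.sum_product]
    simp only [chr_add]
    congr 2
    refine Finset.sum_congr rfl fun i _ => Finset.sum_congr rfl fun j _ => by ring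
  rcases (show 0 ≤ I₂ by positivity).eq_or_lt with h0 | h0
  · rw [← h0, Real.sqrt_zero]
    positivity
  obtain ⟨α, hα⟩ : S.Nonempty := by
    by_contra h
    simp [hI₂, Finset.not_nonempty_iff_eq_empty.mp h] at h0
  have hK1 : 1 ≤ K := le_trans
    (Finset.card_pos.mpr ⟨(α, α), by simp [hα]⟩) (hK (α + α))
  have hK0 : (0 : ℝ) < K := by exact_mod_cast hK1
  set τ : ℝ := √(K * I₂) with hτ
  have hτ2 : τ ^ 2 = K * I₂ := Real.sq_sqrt (by positivity)
  have hτ0 : 0 < τ := Real.sqrt_pos.mpr (by positivity)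
  have hint : 3 * τ ^ 2 * I₂ ≤ 2 * τ ^ 3 * I₁ + K * I₂ ^ 2 := by
    calc 3 * τ ^ 2 * I₂ = ∫ θ, 3 * τ ^ 2 * ‖Q θ‖ ^ 2 ∂haarT := by rw [integral_const_mul, e2]
      _ ≤ ∫ θ, (2 * τ ^ 3 * ‖Q θ‖ + ‖Q θ‖ ^ 4) ∂haarT := by
          refine integral_mono (Continuous.integrable_probHaar (by fun_prop))
            (Continuous.integrable_probHaar (by fun_prop)) fun θ => ?_
          -- `x (x - τ)² (x + 2 τ) ≥ 0`
          have hx := norm_nonneg (Q θ)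
          have : 0 ≤ ‖Q θ‖ * ((‖Q θ‖ - τ) ^ 2 * (‖Q θ‖ + 2 * τ)) := by positivity
          simp only
          nlinarith [this]
      _ = 2 * τ ^ 3 * I₁ + ∫ θ, ‖Q θ‖ ^ 4 ∂haarT := by
          rw [integral_add (Continuous.integrable_probHaar (by fun_prop))
            (Continuous.integrable_probHaar (by fun_prop)), integral_const_mul]
      _ ≤ _ := by gcongr
  have h3 : I₂ ≤ τ * I₁ := by
    have : K * I₂ * (2 * I₂) ≤ K * I₂ * (2 * (τ * I₁)) := by
      have : τ ^ 3 = K * I₂ * τ := by rw [← hτ2]; ring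
      rw [hτ2, this] at hint
      nlinarith [hint]
    have := le_of_mul_le_mul_left this (by positivity)
    linarith
  have h4 : √I₂ * √I₂ ≤ √I₂ * (√K * I₁) := by
    rw [Real.mul_self_sqrt h0.le]
    rw [hτ, Real.sqrt_mul hK0.le] at h3
    linarith
  exact le_of_mul_le_mul_left h4 (Real.sqrt_pos.mpr h0)

lemma chr_comp_mul (α : ℕ →₀ ℕ) (p : ℕ → ℕ) (η θ : Torus) :
    chr α (fun j => η (p j) * θ j) = chr α θ * chr (α.mapDomain p) η := by
  rw [chr, chr, chr, ← monom_comp, ← monom_mul]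
  simp [mul_comm]

/-- Averaging over a subtorus extracts the part of a trigonometric series whose frequencies have a
prescribed image under `Finsupp.mapDomain p`, and does not increase the `L¹` norm. -/
lemma integral_norm_sum_fiber_le {q : (ℕ →₀ ℕ) → ℂ} {g : Torus → ℂ}
    (h : ∀ θ, HasSum (fun α => q α * chr α θ) (g θ)) (p : ℕ → ℕ) (φ : ℕ →₀ ℕ)
    (S : Finset (ℕ →₀ ℕ)) (hS : ∀ α, α.mapDomain p = φ → q α ≠ 0 → α ∈ S)
    (hS' : ∀ α ∈ S, α.mapDomain p = φ) :
    ∫ θ, ‖∑ α ∈ S, q α * chr α θ‖ ∂haarT ≤ ∫ θ, ‖g θ‖ ∂haarT := by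
  have hg : Continuous g := continuous_of_hasSum_chr h
  have key : ∀ θ : Torus, ∑ α ∈ S, q α * chr α θ =
      fourierT (fun η => g (fun j => η (p j) * θ j)) φ := fun θ => by
    have h1 := fourierT_hasSum (e := fun α => α.mapDomain p) (q := fun α => q α * chr α θ)
      (g := fun η => g (fun j => η (p j) * θ j)) (fun η => by
        convert! h _ using 2 with α
        rw [chr_comp_mul, mul_assoc]) φ
    rw [← h1.tsum_eq, tsum_eq_sum (s := S)]
    · exact Finset.sum_congr rfl fun α hα => by rw [if_pos (hS' α hα)]
    · intro α hα
      split_ifs with h2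
      · rw [not_imp_comm.mp (hS α h2) hα, zero_mul]
      · rfl
  have hint : Integrable (Function.uncurry
      fun θ η : Torus => ‖g ((fun j => η (p j)) * θ)‖) (haarT.prod haarT) := by
    refine Continuous.integrable_of_hasCompactSupport ?_ (HasCompactSupport.of_compactSpace _)
    simp only [Function.uncurry_def]
    fun_prop
  calc ∫ θ, ‖∑ α ∈ S, q α * chr α θ‖ ∂haarT
      ≤ ∫ θ, ∫ η : Torus, ‖g ((fun j => η (p j)) * θ)‖ ∂haarT ∂haarT := by
        refine integral_mono (Continuous.integrable_probHaar (by fun_prop))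
          hint.integral_prod_left fun θ => ?_
        simp only [key]
        exact norm_fourierT_le_integral _ _
    _ = ∫ η : Torus, ∫ θ, ‖g ((fun j => η (p j)) * θ)‖ ∂haarT ∂haarT := by
        exact integral_integral_swap hint
    _ = ∫ θ, ‖g θ‖ ∂haarT := by
        simp_rw [integral_mul_left_eq_self (fun θ => ‖g θ‖)]
        simp

lemma card_Iic_finsupp_le (f : ℕ →₀ ℕ) : #(Finset.Iic f) ≤ 2 ^ f.degree := by
  rw [Finsupp.card_Iic, Finsupp.degree_apply, ← Finset.prod_pow_eq_pow_sum]
  refine Finset.prod_le_prod' fun i _ => ?_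
  simpa using Nat.lt_two_pow_self (n := f i)

lemma degree_of_mem_finsuppAntidiag {s : Finset ℕ} {m : ℕ} {τ : ℕ →₀ ℕ}
    (h : τ ∈ s.finsuppAntidiag m) : τ.degree = m := by
  rw [mem_finsuppAntidiag] at h
  rw [← h.1, Finsupp.degree_apply]
  exact Finset.sum_subset h.2 (by simp)

lemma mapDomain_min_of_support_subset {n : ℕ} {α : ℕ →₀ ℕ} (h : α.support ⊆ range n) :
    α.mapDomain (fun j => min j n) = α := by
  rw [Finsupp.mapDomain_congr (g := id) fun j hj => ?_, Finsupp.mapDomain_id]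
  exact min_eq_left (Finset.mem_range.mp (h hj)).le

lemma mapDomain_min_of_le_support {n : ℕ} {α : ℕ →₀ ℕ} (h : ∀ j ∈ α.support, n ≤ j) :
    α.mapDomain (fun j => min j n) = Finsupp.single n α.degree := by
  rw [Finsupp.mapDomain_congr (g := fun _ => n) fun j hj => min_eq_right (h j hj),
    Finsupp.mapDomain, Finsupp.sum, ← Finsupp.single_finsetSum, Finsupp.degree_apply]

lemma support_filter_lt_subset (n : ℕ) (α : ℕ →₀ ℕ) : (α.filter (· < n)).support ⊆ range n := by
  intro j hj
  simp only [Finsupp.support_filter, Finset.mem_filter] at hj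
  simpa using hj.2

lemma exists_of_mapDomain_min_eq {n N m : ℕ} {α' α : ℕ →₀ ℕ} (hα' : α'.support ⊆ range n)
    (hα : α.support ⊆ range N)
    (h : α.mapDomain (fun j => min j n) = α' + Finsupp.single n m) :
    ∃ τ ∈ (Ico n N).finsuppAntidiag m, α = α' + τ := by
  have hsplit := Finsupp.filter_add_filter_not α (· < n)
  set α₁ := α.filter (· < n)
  set τ := α.filter (fun j => ¬ j < n) with hτ
  have hτs : ∀ j ∈ τ.support, n ≤ j := fun j hj => by
    simp only [hτ, Finsupp.support_filter, Finset.mem_filter] at hj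
    omega
  have hα₁ : α₁.support ⊆ range n := support_filter_lt_subset n α
  rw [← hsplit, Finsupp.mapDomain_add, mapDomain_min_of_support_subset hα₁,
    mapDomain_min_of_le_support hτs] at h
  have h0 : ∀ β : ℕ →₀ ℕ, β.support ⊆ range n → ∀ j, n ≤ j → β j = 0 := fun β hβ j hj => by
    by_contra hne
    have := hβ (Finsupp.mem_support_iff.mpr hne)
    simp at this
    omega
  have hdeg : τ.degree = m := by
    have := DFunLike.congr_fun h n
    simpa [h0 _ hα₁ n le_rfl, h0 _ hα' n le_rfl] using this
  rw [hdeg] at h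
  refine ⟨τ, ?_, by rw [← hsplit, add_right_cancel h]⟩
  have hsub : τ.support ⊆ Ico n N := fun j hj => by
    have h1 : j ∈ α.support := by
      simp only [hτ, Finsupp.support_filter, Finset.mem_filter] at hj
      exact hj.1
    simpa [hτs j hj] using hα h1
  refine mem_finsuppAntidiag.mpr ⟨?_, hsub⟩
  rw [← hdeg, Finsupp.degree_apply]
  exact (Finset.sum_subset hsub (by simp)).symm

lemma mapDomain_min_of_mem {n N m : ℕ} {α' τ : ℕ →₀ ℕ} (hα' : α'.support ⊆ range n)
    (hτ : τ ∈ (Ico n N).finsuppAntidiag m) :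
    (α' + τ).mapDomain (fun j => min j n) = α' + Finsupp.single n m := by
  rw [Finsupp.mapDomain_add, mapDomain_min_of_support_subset hα', mapDomain_min_of_le_support,
    degree_of_mem_finsuppAntidiag hτ]
  intro j hj
  have := (mem_finsuppAntidiag.mp hτ).2 hj
  simp at this
  exact this.1

/-- Hypercontractive estimate: for an absolutely convergent trigonometric series in the first `N`
variables, the coefficients whose dependence on the first `n` variables is prescribed and which
have degree `m` in the remaining ones are controlled in `ℓ₂` by the `L¹` norm of the sum. -/
lemma sqrt_sum_antidiag_le {q : (ℕ →₀ ℕ) → ℂ} {g : Torus → ℂ}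
    (h : ∀ θ, HasSum (fun α => q α * chr α θ) (g θ)) {n N : ℕ}
    (hq : ∀ α : ℕ →₀ ℕ, q α ≠ 0 → α.support ⊆ range N)
    {α' : ℕ →₀ ℕ} (hα' : α'.support ⊆ range n) (m : ℕ) :
    √(∑ τ ∈ (Ico n N).finsuppAntidiag m, ‖q (α' + τ)‖ ^ 2) ≤ 2 ^ m * ∫ θ, ‖g θ‖ ∂haarT := by
  set S := ((Ico n N).finsuppAntidiag m).image (α' + ·) with hS
  have hcard : ∀ γ, #{x ∈ S ×ˢ S | x.1 + x.2 = γ} ≤ 4 ^ m := by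
    intro γ
    rcases Finset.eq_empty_or_nonempty {x ∈ S ×ˢ S | x.1 + x.2 = γ} with he | ⟨x₀, hx₀⟩
    · simp [he]
    -- all the pairs are determined by a multi-index below `τ₁ + τ₂`
    have hmem : ∀ x, x ∈ ({x ∈ S ×ˢ S | x.1 + x.2 = γ} : Finset _) →
        ∃ τ₁ ∈ (Ico n N).finsuppAntidiag m, ∃ τ₂ ∈ (Ico n N).finsuppAntidiag m,
          x = (α' + τ₁, α' + τ₂) ∧ γ = α' + α' + (τ₁ + τ₂) := by
      rintro ⟨x, y⟩ hx
      simp only [hS, Finset.mem_filter, Finset.mem_product, Finset.mem_image] at hx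
      obtain ⟨⟨⟨τ₁, h1, rfl⟩, τ₂, h2, rfl⟩, h3⟩ := hx
      exact ⟨τ₁, h1, τ₂, h2, rfl, by rw [← h3]; abel⟩
    obtain ⟨τ₁, hτ₁, τ₂, hτ₂, -, hγ⟩ := hmem x₀ hx₀
    calc #{x ∈ S ×ˢ S | x.1 + x.2 = γ} ≤ #(Finset.Iic (τ₁ + τ₂)) := by
          refine Finset.card_le_card_of_injOn (fun x => x.1 - α') ?_ ?_
          · intro x hx
            obtain ⟨σ₁, -, σ₂, -, rfl, h2⟩ := hmem x hx
            have : τ₁ + τ₂ = σ₁ + σ₂ := add_left_cancel (hγ.symm.trans h2)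
            simp [this]
          · intro x hx y hy hxy
            obtain ⟨σ₁, -, σ₂, -, rfl, h2⟩ := hmem x hx
            obtain ⟨ρ₁, -, ρ₂, -, rfl, h3⟩ := hmem y hy
            have h4 : σ₁ = ρ₁ := by simpa using hxy
            have h5 : σ₁ + σ₂ = ρ₁ + ρ₂ := add_left_cancel (h2.symm.trans h3)
            rw [h4] at h5 ⊢
            rw [add_left_cancel h5]
      _ ≤ 2 ^ (τ₁ + τ₂).degree := card_Iic_finsupp_le _
      _ = 4 ^ m := by
          rw [map_add, degree_of_mem_finsuppAntidiag hτ₁, degree_of_mem_finsuppAntidiag hτ₂,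
            ← two_mul, pow_mul]
          norm_num
  have h1 := sqrt_sum_sq_le_integral_norm S q hcard
  rw [hS, Finset.sum_image (by simp), ← hS] at h1
  have h2 : √((4 ^ m : ℕ) : ℝ) = 2 ^ m := by
    push_cast
    rw [show (4 : ℝ) = 2 ^ 2 by norm_num, ← pow_mul, mul_comm, pow_mul, Real.sqrt_sq (by positivity)]
  rw [h2] at h1
  refine h1.trans (mul_le_mul_of_nonneg_left ?_ (by positivity))
  refine integral_norm_sum_fiber_le h (fun j => min j n) (α' + Finsupp.single n m) S ?_ ?_
  · intro α h1 h2
    obtain ⟨τ, hτ, rfl⟩ := exists_of_mapDomain_min_eq hα' (hq α h2) h1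
    exact Finset.mem_image_of_mem _ hτ
  · intro α hα
    obtain ⟨τ, hτ, rfl⟩ := Finset.mem_image.mp hα
    exact mapDomain_min_of_mem hα' hτ

section

/-! ### Product geometric series -/

lemma support_erase_subset_range {N : ℕ} {α : ℕ →₀ ℕ} :
    (α.erase N).support ⊆ range N ↔ α.support ⊆ range (N + 1) := by
  rw [Finsupp.support_erase, Finset.range_add_one, Finset.subset_insert_iff]

lemma hasSum_prod_mul_of_hasSum {ι κ 𝕜 : Type*} [RCLike 𝕜] {f : ι → 𝕜} {g : κ → 𝕜} {a b : 𝕜}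
    (hf : HasSum f a) (hg : HasSum g b) (hf' : Summable fun i => ‖f i‖)
    (hg' : Summable fun k => ‖g k‖) :
    HasSum (fun x : ι × κ => f x.1 * g x.2) (a * b) := by
  have h : Summable fun x : ι × κ => f x.1 * g x.2 := by
    apply summable_mul_of_summable_norm hf' hg'
  exact hf.mul hg h

lemma hasSum_monom_range {𝕜 : Type*} [RCLike 𝕜] {x : ℕ → 𝕜} (hx : ∀ j, ‖x j‖ < 1) (N : ℕ) :
    HasSum (fun α : ℕ →₀ ℕ => if α.support ⊆ range N then monom x α else 0)
      (∏ j ∈ range N, (1 - x j)⁻¹) := by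
  induction N with
  | zero =>
    convert! hasSum_ite_eq (0 : ℕ →₀ ℕ) (1 : 𝕜) using 2 with α
    by_cases h : α = 0 <;> simp [h]
  | succ N ih =>
    rw [Finset.prod_range_succ]
    have hgeom := hasSum_geometric_of_norm_lt_one (hx N)
    have hF : Summable fun α : ℕ →₀ ℕ => ‖if α.support ⊆ range N then monom x α else 0‖ :=
      ih.summable.norm
    have hG : Summable fun k : ℕ => ‖x N ^ k‖ := hgeom.summable.norm
    have hmul := hasSum_prod_mul_of_hasSum ih hgeom hF hG
    -- a multi-index is determined by its `N`-th entry and by the others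
    have hinj : Function.Injective fun α : ℕ →₀ ℕ => (α.erase N, α N) := fun α β h => by
      simp only [Prod.mk.injEq] at h
      rw [← Finsupp.erase_add_single N α, ← Finsupp.erase_add_single N β, h.1, h.2]
    rw [← hinj.hasSum_iff] at hmul
    · convert! hmul using 2 with α
      have hm : monom x α = monom x (α.erase N) * x N ^ α N := by
        conv_lhs => rw [← Finsupp.erase_add_single N α, monom_add, monom_single]
      by_cases h : (α.erase N).support ⊆ range N
      · simp only [Function.comp_apply, if_pos h, if_pos (support_erase_subset_range.mp h), hm]
      · simp only [Function.comp_apply, if_neg h, zero_mul,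
          if_neg (mt support_erase_subset_range.mpr h)]
    · rintro ⟨β, k⟩ hβ
      rw [if_neg, zero_mul]
      refine fun h => hβ ⟨β + Finsupp.single N k, ?_⟩
      have h0 : β N = 0 := by
        by_contra h0
        simpa using h (Finsupp.mem_support_iff.mpr h0)
      simp [Finsupp.erase_add, Finsupp.erase_of_notMem_support, h0]

/-! ### Finitely supported vectors -/

variable (r : ℝ≥0∞)

/-- The vector of `ℓ_r` whose first `N` coordinates are those of `a`, the others being zero. -/
def emb (N : ℕ) (a : ℕ → ℂ) : SeqSpace r := ∑ j ∈ range N, lp.single r j (a j)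

variable {r}

lemma emb_apply (N : ℕ) (a : ℕ → ℂ) (j : ℕ) : emb r N a j = if j < N then a j else 0 := by
  rw [emb, lp.coeFn_sum, Finset.sum_apply]
  simp [lp.single_apply, Pi.single_apply]

lemma emb_congr {N : ℕ} {a b : ℕ → ℂ} (h : ∀ j < N, a j = b j) : emb r N a = emb r N b :=
  Finset.sum_congr rfl fun j hj => by rw [h j (Finset.mem_range.mp hj)]

lemma emb_add (N : ℕ) (a b : ℕ → ℂ) : emb r N (fun j => a j + b j) = emb r N a + emb r N b := by
  simp [emb, lp.single_add, Finset.sum_add_distrib]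

lemma emb_smul (N : ℕ) (t : ℂ) (a : ℕ → ℂ) : emb r N (fun j => t * a j) = t • emb r N a := by
  simp only [emb, Finset.smul_sum, ← lp.single_smul, smul_eq_mul]

lemma emb_head_add_tail (N n : ℕ) (a b : ℕ → ℂ) :
    (emb r N fun k => if k < n then a k else b k) =
      (emb r N fun k => if k < n then a k else 0) + emb r N fun k => if k < n then 0 else b k := by
  rw [← emb_add]
  refine emb_congr fun k _ => ?_
  split_ifs <;> simp

lemma eq_emb_of_support {u : SeqSpace r} {N : ℕ} (h : Function.support (u : ℕ → ℂ) ⊆ Set.Iio N) :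
    u = emb r N u := by
  ext j
  rw [emb_apply]
  split_ifs with hj
  · rfl
  · by_contra h'
    exact hj (h h')

lemma exists_eq_emb {u : SeqSpace r} (h : (Function.support (u : ℕ → ℂ)).Finite) :
    ∃ N, u = emb r N u := by
  obtain ⟨N, hN⟩ := h.bddAbove
  exact ⟨N + 1, eq_emb_of_support fun j hj => Nat.lt_succ_of_le (hN hj)⟩

lemma seqMonomial_emb (N : ℕ) (a : ℕ → ℂ) (α : ℕ →₀ ℕ) :
    seqMonomial (emb r N a) α = if α.support ⊆ range N then monom a α else 0 := by
  rw [seqMonomial_eq_monom]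
  split_ifs with h
  · refine monom_congr fun j hj => ?_
    rw [emb_apply, if_pos (Finset.mem_range.mp (h hj))]
  · obtain ⟨j, hj, hjN⟩ := Finset.not_subset.mp h
    exact monom_eq_zero hj (by rw [emb_apply, if_neg (by simpa using hjN)])

variable [hr : Fact (1 ≤ r)]

lemma norm_emb_le {N : ℕ} {a : ℕ → ℂ} {v : SeqSpace r} (h : ∀ j < N, ‖a j‖ ≤ ‖v j‖) :
    ‖emb r N a‖ ≤ ‖v‖ := by
  refine lp.norm_mono (zero_lt_one.trans_le hr.out).ne' fun j => ?_
  rw [emb_apply]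
  split_ifs with hj
  · exact h j hj
  · simp

lemma norm_emb_mono {N : ℕ} {a b : ℕ → ℂ} (h : ∀ j < N, ‖a j‖ ≤ ‖b j‖) :
    ‖emb r N a‖ ≤ ‖emb r N b‖ :=
  norm_emb_le fun j hj => by simpa [emb_apply, hj] using h j hj

lemma continuous_emb (N : ℕ) : Continuous (emb r N) := by
  unfold emb
  refine continuous_finsetSum _ fun j _ => ?_
  exact (lp.isometry_single (E := fun _ : ℕ => ℂ) (p := r) j).continuous.comp (continuous_apply j)

/-! ### Cauchy's formula on the torus -/

lemma integral_circle_mul_inv_one_sub {h : ℂ → ℂ} {R : ℝ} (hR : 1 < R)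
    (hh : DifferentiableOn ℂ h (Metric.ball 0 R)) {w : ℂ} (hw : ‖w‖ < 1) :
    ∫ φ : Circle, h φ * (1 - w * starRingEnd ℂ (φ : ℂ))⁻¹ ∂(probHaar Circle) = h w := by
  set a : ℕ → ℂ := fun n => (n.factorial : ℂ)⁻¹ * iteratedDeriv n h 0 with ha
  have hser : ∀ z : ℂ, ‖z‖ < R → HasSum (fun n => a n * z ^ n) (h z) := fun z hz => by
    have := Complex.hasSum_taylorSeries_on_ball hh (z := z) (by simpa using hz)
    convert! this using 2 with n
    simp only [ha, smul_eq_mul, sub_zero]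
    ring
  have hc : Continuous fun φ : Circle => h φ :=
    hh.continuousOn.comp_continuous (by fun_prop) fun φ => by simpa [φ.norm_coe] using hR
  have hasum : Summable fun n => ‖a n‖ := by
    simpa using (hser 1 (by simpa using hR)).summable.norm
  -- the Fourier coefficients of `h` on the circle are its Taylor coefficients
  have hcoef : ∀ k : ℕ, ∫ φ : Circle, h φ * starRingEnd ℂ ((φ : ℂ) ^ k) ∂(probHaar Circle) = a k :=
    fun k => by
      have key := hasSum_integral_of_summable_integral_norm (μ := probHaar Circle)
        (F := fun n (φ : Circle) => a n * ((φ : ℂ) ^ n * starRingEnd ℂ ((φ : ℂ) ^ k)))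
        (fun i => Continuous.integrable_probHaar (by fun_prop))
        (by simpa [Circle.norm_coe] using hasum)
      simp_rw [integral_const_mul, integral_circle_pow_mul_conj_pow] at key
      simp only [mul_ite, mul_one, mul_zero] at key
      have hk : HasSum (fun n => if n = k then a n else 0) (a k) := by
        convert! hasSum_ite_eq k (a k) using 2 with n
        by_cases h : n = k <;> simp [h]
      rw [hk.unique key]
      refine integral_congr_ae (.of_forall fun φ => ?_)
      simp only [← mul_assoc]
      rw [tsum_mul_right, (hser φ (by simpa [Circle.norm_coe] using hR)).tsum_eq]
  have key := hasSum_integral_of_summable_integral_norm (μ := probHaar Circle)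
    (F := fun k (φ : Circle) => w ^ k * (h φ * starRingEnd ℂ ((φ : ℂ) ^ k)))
    (fun i => Continuous.integrable_probHaar
      (continuous_const.mul (hc.mul (by fun_prop : Continuous fun φ : Circle => _))))
    (by
      simp only [norm_mul, norm_pow, RCLike.norm_conj, Circle.norm_coe, one_pow, mul_one]
      simp_rw [integral_const_mul]
      exact (summable_geometric_of_lt_one (norm_nonneg w) hw).mul_right _)
  simp_rw [integral_const_mul, hcoef] at key
  have h2 := hser w (hw.trans hR)
  simp_rw [mul_comm (a _)] at h2
  rw [h2.unique key]
  refine integral_congr_ae (.of_forall fun φ => ?_)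
  have hg := (hasSum_geometric_of_norm_lt_one
    (show ‖w * starRingEnd ℂ (φ : ℂ)‖ < 1 by simpa [φ.norm_coe] using hw)).mul_left (h φ)
  refine hg.unique ?_
  convert! hg.summable.hasSum using 1
  refine tsum_congr fun k => ?_
  simp only [mul_pow, map_pow]
  ring

end

section

variable {r : ℝ≥0∞} [hr : Fact (1 ≤ r)]

lemma differentiable_emb (N : ℕ) {a : ℂ → ℕ → ℂ} (h : ∀ j, Differentiable ℂ fun t => a t j) :
    Differentiable ℂ fun t => emb r N (a t) := by
  unfold emb
  refine Differentiable.fun_sum fun j _ => ?_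
  exact (lp.singleContinuousLinearMap ℂ (fun _ : ℕ => ℂ) r j).differentiable.comp (h j)

lemma continuous_comp_emb {X : Type*} [TopologicalSpace X] {f : SeqSpace r → ℂ}
    (hf : DifferentiableOn ℂ f (Metric.ball 0 1)) {N : ℕ} {a : X → ℕ → ℂ}
    (ha : ∀ j, Continuous fun t => a t j) (h : ∀ t, ‖emb r N (a t)‖ < 1) :
    Continuous fun t => f (emb r N (a t)) :=
  hf.continuousOn.comp_continuous ((continuous_emb N).comp (continuous_pi ha))
    fun t => by simpa using h t

lemma norm_emb_mul_le {N : ℕ} {s x : ℕ → ℂ} {R : ℝ} (hR : 0 ≤ R) (hx : ∀ j, ‖x j‖ ≤ R) :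
    ‖emb r N (fun j => s j * x j)‖ ≤ R * ‖emb r N s‖ := by
  have : R * ‖emb r N s‖ = ‖emb r N fun j => (R : ℂ) * s j‖ := by
    rw [emb_smul, norm_smul, Complex.norm_real, Real.norm_of_nonneg hR]
  rw [this]
  refine norm_emb_mono fun j _ => ?_
  rw [norm_mul, norm_mul, Complex.norm_real, Real.norm_of_nonneg hR, mul_comm]
  gcongr
  exact hx j

/-- Cauchy's integral formula on a polydisc, one factor of the kernel for each of the variables
in `J`. -/
lemma integral_mul_prod_inv_one_sub {f : SeqSpace r → ℂ}
    (hf : DifferentiableOn ℂ f (Metric.ball 0 1)) {N : ℕ} {s : ℕ → ℂ} (hs : ‖emb r N s‖ < 1)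
    {w : ℕ → ℂ} (hw : ∀ j, ‖w j‖ < 1) (J : Finset ℕ) :
    ∫ θ : Torus, f (emb r N fun j => s j * if j ∈ J then (θ j : ℂ) else w j) *
      ∏ j ∈ J, (1 - w j * starRingEnd ℂ (θ j : ℂ))⁻¹ ∂haarT = f (emb r N fun j => s j * w j) := by
  induction J using Finset.induction_on with
  | empty => simp
  | insert k J hk ih =>
    rw [← ih]
    have hx : ∀ (J : Finset ℕ) (θ : Torus) (j : ℕ), ‖if j ∈ J then (θ j : ℂ) else w j‖ ≤ 1 := by
      intro J θ j
      split_ifs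
      · exact (θ j).norm_coe.le
      · exact (hw j).le
    have hk0 : ∀ (j : ℕ) (φ : Circle), (1 - w j * starRingEnd ℂ (φ : ℂ)) ≠ 0 := fun j φ h => by
      have h1 : ‖w j * starRingEnd ℂ (φ : ℂ)‖ = 1 := by rw [← sub_eq_zero.mp h, norm_one]
      rw [norm_mul, RCLike.norm_conj, φ.norm_coe, mul_one] at h1
      exact (hw j).ne h1
    have hcont : ∀ J : Finset ℕ, Continuous fun θ : Torus =>
        f (emb r N fun j => s j * if j ∈ J then (θ j : ℂ) else w j) *
          ∏ j ∈ J, (1 - w j * starRingEnd ℂ (θ j : ℂ))⁻¹ := fun J => by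
      refine (continuous_comp_emb hf (fun j => ?_) fun θ => ?_).mul
        (continuous_finsetProd _ fun j _ => Continuous.inv₀ (by fun_prop) fun θ => hk0 _ _)
      · split_ifs <;> fun_prop
      · refine (norm_emb_mul_le zero_le_one (hx J θ)).trans_lt ?_
        rwa [one_mul]
    set H : Torus → ℂ := fun θ =>
        f (emb r N fun j => s j * if j ∈ insert k J then (θ j : ℂ) else w j) *
          ∏ j ∈ insert k J, (1 - w j * starRingEnd ℂ (θ j : ℂ))⁻¹ with hH
    have hHc : Continuous H := hcont (insert k J)
    have hsingle : Continuous fun φ : Circle => (Pi.mulSingle k φ : Torus) :=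
      continuous_const.update k continuous_id
    obtain ⟨R, hR1, hR⟩ : ∃ R : ℝ, 1 < R ∧ R * ‖emb r N s‖ < 1 := by
      rcases (norm_nonneg (emb r N s)).eq_or_lt with h0 | h0
      · exact ⟨2, by norm_num, by simp [← h0]⟩
      · obtain ⟨R, h1, h2⟩ := exists_between (one_lt_inv_iff₀.mpr ⟨h0, hs⟩)
        exact ⟨R, h1, by rwa [← lt_div_iff₀ h0, one_div]⟩
    calc ∫ θ, H θ ∂haarT =
          ∫ φ : Circle, ∫ θ, H (Pi.mulSingle k φ * θ) ∂haarT ∂(probHaar Circle) := by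
          simp_rw [integral_mul_left_eq_self H]
          simp
      _ = ∫ θ, ∫ φ : Circle, H (Pi.mulSingle k φ * θ) ∂(probHaar Circle) ∂haarT := by
          refine integral_integral_swap ?_
          refine Continuous.integrable_of_hasCompactSupport ?_ (HasCompactSupport.of_compactSpace _)
          simp only [Function.uncurry_def]
          fun_prop
      _ = _ := integral_congr_ae (.of_forall fun θ => ?_)
    -- the function of the `k`-th variable to which the one variable formula is applied
    set h : ℂ → ℂ := fun t =>
      f (emb r N fun j => s j * if j = k then t else if j ∈ J then (θ j : ℂ) else w j) with hh
    have hdiff : DifferentiableOn ℂ h (Metric.ball 0 R) := by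
      refine hf.comp (differentiable_emb N fun j => ?_).differentiableOn fun t ht => ?_
      · split_ifs <;> fun_prop
      · rw [mem_ball_zero_iff] at ht ⊢
        refine (norm_emb_mul_le (by linarith) fun j => ?_).trans_lt hR
        split_ifs
        · exact ht.le
        · rw [(θ j).norm_coe]; exact hR1.le
        · exact (hw j).le.trans hR1.le
    have hval : ∀ φ : Circle, H (Pi.mulSingle k φ * θ) =
        h (φ * θ k : Circle) * (1 - w k * starRingEnd ℂ ((φ * θ k : Circle) : ℂ))⁻¹ *
          ∏ j ∈ J, (1 - w j * starRingEnd ℂ (θ j : ℂ))⁻¹ := fun φ => by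
      rw [hH]
      simp only
      rw [Finset.prod_insert hk, ← mul_assoc]
      congr 1
      · congr 1
        · rw [hh]
          refine congrArg f (emb_congr fun j _ => ?_)
          by_cases hjk : j = k
          · subst hjk; simp
          · simp [hjk]
        · simp
      · refine Finset.prod_congr rfl fun j hj => ?_
        have : j ≠ k := fun h => hk (h ▸ hj)
        simp [this]
    simp_rw [hval]
    rw [integral_mul_const, integral_mul_right_eq_self
      (fun φ : Circle => h φ * (1 - w k * starRingEnd ℂ (φ : ℂ))⁻¹),
      integral_circle_mul_inv_one_sub hR1 hdiff (hw k)]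
    congr 1
    refine congrArg f (emb_congr fun j _ => ?_)
    by_cases hjk : j = k
    · subst hjk; simp [hk]
    · simp [hjk]

/-- Expansion of a holomorphic function on a polydisc contained in the ball. -/
lemma hasSum_fourierT_mul_monom {f : SeqSpace r → ℂ}
    (hf : DifferentiableOn ℂ f (Metric.ball 0 1)) {N : ℕ} {s : ℕ → ℂ} (hs : ‖emb r N s‖ < 1)
    {w : ℕ → ℂ} (hw : ∀ j, ‖w j‖ < 1) :
    HasSum (fun α => fourierT (fun θ => f (emb r N fun j => s j * θ j)) α *
      if α.support ⊆ range N then monom w α else 0) (f (emb r N fun j => s j * w j)) := by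
  set G : Torus → ℂ := fun θ => f (emb r N fun j => s j * θ j) with hG
  have hGc : Continuous G := continuous_comp_emb hf (fun j => by fun_prop) fun θ =>
    (norm_emb_mul_le zero_le_one fun j => (θ j).norm_coe.le).trans_lt (by rwa [one_mul])
  have hsum : ∀ θ : Torus, HasSum
      (fun α : ℕ →₀ ℕ =>
        if α.support ⊆ range N then monom (fun j => w j * starRingEnd ℂ (θ j : ℂ)) α else 0)
      (∏ j ∈ range N, (1 - w j * starRingEnd ℂ (θ j : ℂ))⁻¹) := fun θ =>
    hasSum_monom_range (fun j => by simpa [(θ j).norm_coe] using hw j) N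
  have hmon : ∀ (θ : Torus) α, monom (fun j => w j * starRingEnd ℂ (θ j : ℂ)) α =
      monom w α * starRingEnd ℂ (chr α θ) := fun θ α => by
    rw [monom_mul, chr, map_monom]
  have key := hasSum_integral_of_summable_integral_norm (μ := haarT)
    (F := fun (α : ℕ →₀ ℕ) θ => (if α.support ⊆ range N then monom w α else 0) *
      (G θ * starRingEnd ℂ (chr α θ)))
    (fun α => Continuous.integrable_probHaar
      (continuous_const.mul (hGc.mul (by fun_prop : Continuous fun θ => starRingEnd ℂ (chr α θ)))))
    (by
      simp only [norm_mul, RCLike.norm_conj, norm_chr, mul_one]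
      simp_rw [integral_const_mul]
      exact (hasSum_monom_range hw N).summable.norm.mul_right _)
  simp_rw [integral_const_mul] at key
  convert! key using 1
  · ext α
    rw [mul_comm, fourierT]
  · rw [← integral_mul_prod_inv_one_sub hf hs hw (range N)]
    refine integral_congr_ae (.of_forall fun θ => ?_)
    simp only
    have hemb : (emb r N fun j => s j * if j ∈ range N then (θ j : ℂ) else w j) =
        emb r N fun j => s j * θ j := emb_congr fun j hj => by simp [hj]
    rw [hemb]
    refine ((hsum θ).mul_left (G θ)).unique ?_
    convert! ((hsum θ).mul_left (G θ)).summable.hasSum using 1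
    refine tsum_congr fun α => ?_
    rw [hmon]
    split_ifs <;> ring


lemma fourierT_scale {f : SeqSpace r → ℂ} (hf : DifferentiableOn ℂ f (Metric.ball 0 1))
    {N : ℕ} {s t : ℕ → ℂ} (hs : ‖emb r N s‖ < 1) (ht : ∀ j, ‖t j‖ < 1) {α : ℕ →₀ ℕ}
    (hα : α.support ⊆ range N) :
    fourierT (fun θ => f (emb r N fun j => s j * t j * θ j)) α =
      fourierT (fun θ => f (emb r N fun j => s j * θ j)) α * monom t α := by
  rw [fourierT_eq_of_hasSum (q := fun α => fourierT (fun θ => f (emb r N fun j => s j * θ j)) α *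
    if α.support ⊆ range N then monom t α else 0), if_pos hα]
  intro θ
  have := hasSum_fourierT_mul_monom hf hs (w := fun j => t j * θ j)
    (fun j => by simpa [(θ j).norm_coe] using ht j)
  simp_rw [← mul_assoc] at this
  convert! this using 2 with β
  rw [monom_mul, mul_assoc, chr]
  split_ifs <;> simp

lemma norm_emb_half_pow_lt (N : ℕ) : ‖emb r N fun j => (1 / 2 : ℂ) ^ (j + 2)‖ < 1 := by
  have h1 : ‖emb r N fun j => (1 / 2 : ℂ) ^ (j + 2)‖ ≤ ∑ j ∈ range N, (1 / 2 : ℝ) ^ (j + 2) := by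
    refine (norm_sum_le _ _).trans (Finset.sum_le_sum fun j _ => ?_)
    rw [lp.norm_single (zero_lt_one.trans_le hr.out)]
    simp
  refine h1.trans_lt ?_
  simp_rw [pow_add]
  rw [← Finset.sum_mul]
  have := (summable_geometric_two).sum_le_tsum (range N) (fun j _ => by positivity)
  rw [tsum_geometric_two] at this
  nlinarith

lemma exists_lt_norm_emb_lt {N : ℕ} {a : ℕ → ℂ} (ha : ‖emb r N a‖ < 1) :
    ∃ s : ℕ → ℝ, (∀ j, ‖a j‖ < s j) ∧ ‖emb r N fun j => (s j : ℂ)‖ < 1 := by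
  obtain ⟨η, hη0, hη⟩ : ∃ η : ℝ, 0 < η ∧ η * (‖emb r N fun _ => (1 : ℂ)‖ + 1) < 1 - ‖emb r N a‖ := by
    have h1 : 0 < ‖emb r N fun _ => (1 : ℂ)‖ + 1 := by positivity
    obtain ⟨η, h2, h3⟩ := exists_between (div_pos (sub_pos.mpr ha) h1)
    exact ⟨η, h2, by rwa [lt_div_iff₀ h1] at h3⟩
  refine ⟨fun j => ‖a j‖ + η, fun j => by simpa using hη0, ?_⟩
  have h1 : (emb r N fun j => ((‖a j‖ + η : ℝ) : ℂ)) =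
      (emb r N fun j => (‖a j‖ : ℂ)) + (η : ℂ) • emb r N fun _ => (1 : ℂ) := by
    rw [← emb_smul, ← emb_add]
    simp
  have h2 : ‖emb r N fun j => (‖a j‖ : ℂ)‖ ≤ ‖emb r N a‖ := norm_emb_mono fun j _ => by simp
  rw [h1]
  refine (norm_add_le _ _).trans_lt ?_
  rw [norm_smul, Complex.norm_real, Real.norm_of_nonneg hη0.le]
  nlinarith [norm_nonneg (emb r N fun _ => (1 : ℂ))]

/-- Every holomorphic function on the unit ball of `ℓ_r` has a monomial expansion. -/
theorem exists_isMonomialExpansion {f : SeqSpace r → ℂ}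
    (hf : DifferentiableOn ℂ f (Metric.ball 0 1)) : ∃ c, IsMonomialExpansion r f c := by
  set s₀ : ℕ → ℂ := fun j => (1 / 2 : ℂ) ^ (j + 2) with hs₀
  have hs₀0 : ∀ j, s₀ j ≠ 0 := fun j => pow_ne_zero _ (by norm_num)
  set A : ℕ → (ℕ →₀ ℕ) → ℂ := fun N α => fourierT (fun θ => f (emb r N fun j => s₀ j * θ j)) α
    with hA
  -- the coefficients at the radii `s₀` do not depend on the number of variables
  have hAN : ∀ (α : ℕ →₀ ℕ) (n N : ℕ), α.support ⊆ range n → n ≤ N → A N α = A n α := by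
    intro α n N hα hnN
    set t : ℕ → ℂ := fun j => if j < n then 1 / 2 else 0 with ht
    have ht1 : ∀ j, ‖t j‖ < 1 := fun j => by
      simp only [ht]; split_ifs <;> norm_num
    have hN := fourierT_scale hf (norm_emb_half_pow_lt N) ht1 (hα.trans (by simpa using hnN))
    have hn := fourierT_scale hf (norm_emb_half_pow_lt n) ht1 hα
    have heq : ∀ θ : Torus, (emb r N fun j => s₀ j * t j * θ j) = emb r n fun j => s₀ j * t j * θ j :=
      fun θ => by
        ext j
        simp only [emb_apply, ht]
        by_cases h : j < n
        · simp [h, h.trans_le hnN]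
        · simp [h]
    have ht0 : monom t α ≠ 0 := by
      refine Finset.prod_ne_zero_iff.mpr fun j hj => pow_ne_zero _ ?_
      simp [ht, Finset.mem_range.mp (hα hj)]
    refine mul_right_cancel₀ ht0 ?_
    rw [hA]
    simp only
    rw [← hN, ← hn]
    exact congrArg (fourierT · α) (funext fun θ => congrArg f (heq θ))
  refine ⟨fun α => A (α.support.sup id + 1) α / monom s₀ α, ?_⟩
  intro u hu hfin
  obtain ⟨N, hN⟩ := exists_eq_emb hfin
  rw [mem_ball_zero_iff, hN] at hu
  obtain ⟨s, hs, hs1⟩ := exists_lt_norm_emb_lt hu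
  have hs0 : ∀ j, 0 < s j := fun j => (norm_nonneg _).trans_lt (hs j)
  -- the coefficients at the radii `s`
  have hcoef : ∀ α : ℕ →₀ ℕ, α.support ⊆ range N →
      fourierT (fun θ => f (emb r N fun j => (s j : ℂ) * θ j)) α =
        A N α / monom s₀ α * monom (fun j => (s j : ℂ)) α := by
    intro α hα
    obtain ⟨δ, hδ0, hδ1, hδ⟩ : ∃ δ : ℝ, 0 < δ ∧ δ < 1 ∧ ∀ j ∈ range N, δ * s j < ‖s₀ j‖ := by
      have h1 : ∀ᶠ δ : ℝ in 𝓝[>] 0, ∀ j ∈ range N, δ * s j < ‖s₀ j‖ := by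
        rw [Filter.eventually_all_finset]
        intro j _
        refine nhdsWithin_le_nhds ?_
        have : Filter.Tendsto (fun δ : ℝ => δ * s j) (𝓝 0) (𝓝 (0 * s j)) :=
          (continuous_mul_const _).tendsto _
        exact this.eventually_lt_const (by simpa using hs₀0 j)
      have h2 : ∀ᶠ δ : ℝ in 𝓝[>] 0, δ < 1 := nhdsWithin_le_nhds (gt_mem_nhds one_pos)
      obtain ⟨δ, h3, h4, h5⟩ := (h1.and (h2.and self_mem_nhdsWithin)).exists
      exact ⟨δ, h5, h4, h3⟩
    have e1 := fourierT_scale hf hs1 (t := fun _ => (δ : ℂ))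
      (fun j => by simpa [abs_of_pos hδ0] using hδ1) hα
    have e2 := fourierT_scale hf (norm_emb_half_pow_lt N)
      (t := fun j => if j < N then (δ * s j / s₀ j : ℂ) else 0) (fun j => by
        split_ifs with hj
        · rw [norm_div, norm_mul, Complex.norm_real, Complex.norm_real, Real.norm_of_nonneg hδ0.le,
            Real.norm_of_nonneg (hs0 j).le, div_lt_one (norm_pos_iff.mpr (hs₀0 j))]
          exact hδ j (Finset.mem_range.mpr hj)
        · simp) hα
    have heq : ∀ θ : Torus, (emb r N fun j => (s j : ℂ) * δ * θ j) =
        emb r N fun j => (1 / 2 : ℂ) ^ (j + 2) * (if j < N then (δ * s j / s₀ j : ℂ) else 0) * θ j :=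
      fun θ => emb_congr fun j hj => by
        have := hs₀0 j
        simp only [hj, if_true]
        rw [mul_div_cancel₀ _ this]
        ring
    have hmon : monom s₀ α * monom (fun j => if j < N then (δ * s j / s₀ j : ℂ) else 0) α =
        monom (fun j => (s j : ℂ)) α * monom (fun _ => (δ : ℂ)) α := by
      rw [← monom_mul, ← monom_mul]
      refine monom_congr fun j hj => ?_
      rw [if_pos (Finset.mem_range.mp (hα hj)), mul_div_cancel₀ _ (hs₀0 j), mul_comm]
    have hne : ∀ x : ℕ → ℂ, (∀ j, x j ≠ 0) → monom x α ≠ 0 := fun x hx =>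
      Finset.prod_ne_zero_iff.mpr fun j _ => pow_ne_zero _ (hx j)
    have hδne := hne (fun _ => (δ : ℂ)) fun _ => by exact_mod_cast hδ0.ne'
    have hs₀ne := hne s₀ hs₀0
    simp_rw [heq] at e1
    rw [e2] at e1
    refine mul_right_cancel₀ hδne ?_
    rw [← e1, div_mul_eq_mul_div, div_mul_eq_mul_div, eq_div_iff hs₀ne,
      mul_assoc (A N α) (monom (fun j => (s j : ℂ)) α), ← hmon]
    ring
  have hmain := hasSum_fourierT_mul_monom hf hs1 (w := fun j => u j / s j) (fun j => by
    rw [norm_div, Complex.norm_real, Real.norm_of_nonneg (hs0 j).le, div_lt_one (hs0 j)]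
    exact hs j)
  have hsu : (emb r N fun j => (s j : ℂ) * (u j / s j)) = u := by
    conv_rhs => rw [hN]
    refine emb_congr fun j _ => mul_div_cancel₀ _ ?_
    exact_mod_cast (hs0 j).ne'
  rw [hsu] at hmain
  convert! hmain using 2 with α
  conv_lhs => rw [hN, seqMonomial_emb]
  split_ifs with hα
  · have hsup : α.support ⊆ range (α.support.sup id + 1) := fun j hj =>
      Finset.mem_range.mpr (Nat.lt_succ_of_le (Finset.le_sup (f := id) hj))
    have hAA : A (α.support.sup id + 1) α = A N α := by
      rw [← hAN α _ (max N (α.support.sup id + 1)) hsup (le_max_right _ _),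
        hAN α N _ hα (le_max_left _ _)]
    simp only [hAA]
    rw [hcoef α hα, mul_assoc, ← monom_mul]
    congr 1
    refine monom_congr fun j _ => (mul_div_cancel₀ _ ?_).symm
    exact_mod_cast (hs0 j).ne'
  · simp

/-- Cauchy's formula for the monomial coefficients. -/
lemma fourierT_of_isMonomialExpansion {f : SeqSpace r → ℂ} {c : (ℕ →₀ ℕ) → ℂ}
    (hc : IsMonomialExpansion r f c) {N : ℕ} {a : ℕ → ℂ} (ha : ‖emb r N a‖ < 1) (α : ℕ →₀ ℕ) :
    fourierT (fun θ => f (emb r N fun j => a j * θ j)) α =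
      if α.support ⊆ range N then c α * monom a α else 0 := by
  rw [fourierT_eq_of_hasSum (q := fun α => if α.support ⊆ range N then c α * monom a α else 0)]
  intro θ
  have hball : (emb r N fun j => a j * θ j) ∈ Metric.ball (0 : SeqSpace r) 1 := by
    rw [mem_ball_zero_iff]
    refine (norm_emb_mul_le zero_le_one fun j => (θ j).norm_coe.le).trans_lt (by rwa [one_mul])
  have := hc _ hball ((Set.finite_lt_nat N).subset fun j hj => by
    by_contra h
    simp only [Set.mem_ofPred_eq] at h
    simp [emb_apply, h] at hj)
  convert! this using 2 with β
  rw [seqMonomial_emb, monom_mul]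
  split_ifs
  · rw [mul_assoc, chr]
  · simp

/-! ### Cauchy estimates for the derivative -/

lemma norm_fderiv_apply_le {E : Type*} [NormedAddCommGroup E] [NormedSpace ℂ E] {f : E → ℂ}
    {R M : ℝ} (hf : DifferentiableOn ℂ f (Metric.ball 0 R)) (hM : ∀ u ∈ Metric.ball 0 R, ‖f u‖ ≤ M)
    {x y : E} (hxy : ‖x‖ + ‖y‖ < R) : ‖fderiv ℂ f x y‖ ≤ M := by
  have hmem : ∀ t : ℂ, ‖t‖ ≤ 1 → x + t • y ∈ Metric.ball (0 : E) R := fun t ht => by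
    rw [mem_ball_zero_iff]
    refine ((norm_add_le _ _).trans ?_).trans_lt hxy
    rw [norm_smul]
    nlinarith [norm_nonneg y]
  have hd : DifferentiableOn ℂ (fun t : ℂ => f (x + t • y)) (Metric.closedBall 0 1) := by
    refine hf.comp (Differentiable.differentiableOn (by fun_prop)) fun t ht => ?_
    exact hmem t (by simpa using ht)
  have h1 := Complex.norm_deriv_le_of_forall_mem_sphere_norm_le (f := fun t : ℂ => f (x + t • y))
    one_pos (hd.diffContOnCl_ball (c := 0) (R := 1) subset_rfl)
    (fun t ht => hM _ (hmem t (by simpa using (mem_sphere_zero_iff_norm.mp ht).le)))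
  have hx : x ∈ Metric.ball (0 : E) R := by simpa using hmem 0 (by simp)
  have h2 : HasDerivAt (fun t : ℂ => f (x + t • y)) (fderiv ℂ f x y) 0 := by
    have hfx : HasFDerivAt f (fderiv ℂ f x) (x + (0 : ℂ) • y) := by
      simpa using (hf.differentiableAt (Metric.isOpen_ball.mem_nhds hx)).hasFDerivAt
    have hl : HasDerivAt (fun t : ℂ => x + t • y) y 0 := by
      simpa using ((hasDerivAt_id (0 : ℂ)).smul_const y).const_add x
    exact hfx.comp_hasDerivAt _ hl
  rwa [h2.deriv, div_one] at h1

lemma exists_norm_le_one_mul_eq_norm (z : ℂ) : ∃ ε : ℂ, ‖ε‖ ≤ 1 ∧ ε * z = ‖z‖ := by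
  rcases eq_or_ne z 0 with rfl | hz
  · exact ⟨0, by simp, by simp⟩
  · have h : (‖z‖ : ℂ) ≠ 0 := by exact_mod_cast norm_ne_zero_iff.mpr hz
    refine ⟨starRingEnd ℂ z / ‖z‖, by simp [hz], ?_⟩
    rw [div_mul_eq_mul_div, mul_comm, Complex.mul_conj', sq, mul_div_assoc, div_self h, mul_one]

lemma sum_mul_norm_fderiv_single_le {f : SeqSpace r → ℂ} {M : ℝ}
    (hf : DifferentiableOn ℂ f (Metric.ball 0 1)) (hM : ∀ u ∈ Metric.ball 0 1, ‖f u‖ ≤ M)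
    {N : ℕ} {x : SeqSpace r} {y : ℕ → ℝ}
    (hxy : ‖x‖ + ‖emb r N fun k => (y k : ℂ)‖ < 1) :
    ∑ k ∈ range N, y k * ‖fderiv ℂ f x (lp.single r k 1)‖ ≤ M := by
  choose ε hε1 hε using fun k => exists_norm_le_one_mul_eq_norm (fderiv ℂ f x (lp.single r k 1))
  have h1 : (∑ k ∈ range N, y k * ‖fderiv ℂ f x (lp.single r k 1)‖ : ℝ) =
      fderiv ℂ f x (emb r N fun k => y k * ε k) := by
    rw [emb, map_sum]
    push_cast
    refine Finset.sum_congr rfl fun k _ => ?_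
    have : lp.single r k ((y k : ℂ) * ε k) =
        ((y k : ℂ) * ε k) • lp.single (E := fun _ : ℕ => ℂ) r k 1 := by
      rw [← lp.single_smul, smul_eq_mul, mul_one]
    rw [this, map_smul, smul_eq_mul, mul_assoc, hε]
  have h2 : ‖emb r N fun k => (y k : ℂ) * ε k‖ ≤ ‖emb r N fun k => (y k : ℂ)‖ := by
    simpa using norm_emb_mul_le (r := r) (N := N) (s := fun k => (y k : ℂ)) zero_le_one hε1
  have h3 := norm_fderiv_apply_le hf hM (x := x) (y := emb r N fun k => (y k : ℂ) * ε k)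
    (by linarith)
  rw [← h1, Complex.norm_real] at h3
  exact (le_abs_self _).trans h3

/-! ### The monomial expansion of the derivative -/

lemma monom_update (a : ℕ → ℂ) (k : ℕ) (t : ℂ) (γ : ℕ →₀ ℕ) :
    monom (Function.update a k t) γ = monom a (γ.erase k) * t ^ γ k := by
  conv_lhs => rw [← Finsupp.erase_add_single k γ, monom_add, monom_single, Function.update_self]
  congr 1
  refine monom_congr fun i hi => Function.update_of_ne ?_ _ _
  rintro rfl
  simp at hi

lemma support_add_single_subset_iff {α : ℕ →₀ ℕ} {k N : ℕ} (hk : k < N) :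
    (α + Finsupp.single k 1).support ⊆ range N ↔ α.support ⊆ range N := by
  refine ⟨fun h j hj => h ?_, fun h => Finsupp.support_add.trans (Finset.union_subset h ?_)⟩
  · simp only [Finsupp.mem_support_iff, Finsupp.add_apply] at hj ⊢
    omega
  · exact Finsupp.support_single_subset.trans (by simpa using hk)

lemma hasSum_fderiv_single {f : SeqSpace r → ℂ} {c : (ℕ →₀ ℕ) → ℂ}
    (hf : DifferentiableOn ℂ f (Metric.ball 0 1)) (hc : IsMonomialExpansion r f c)
    {N : ℕ} {a : ℕ → ℂ} (ha : ‖emb r N a‖ < 1) {k : ℕ} (hk : k < N) :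
    HasSum (fun α : ℕ →₀ ℕ => if α.support ⊆ range N then
      (α k + 1) * c (α + Finsupp.single k 1) * monom a α else 0)
      (fderiv ℂ f (emb r N a) (lp.single r k 1)) := by
  set F : (ℕ →₀ ℕ) → ℂ → ℂ := fun γ t =>
    if γ.support ⊆ range N then c γ * monom (Function.update a k (a k + t)) γ else 0 with hF
  obtain ⟨s, has, hs⟩ := exists_lt_norm_emb_lt ha
  have hsupp : ∀ b : ℕ → ℂ, (Function.support (emb r N b : ℕ → ℂ)).Finite := fun b =>
    (Set.finite_lt_nat N).subset fun j hj => by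
      by_contra h
      simp only [Set.mem_ofPred_eq] at h
      simp [emb_apply, h] at hj
  have hupd : ∀ t : ℂ, ‖t‖ < s k - ‖a k‖ → ∀ j, ‖Function.update a k (a k + t) j‖ ≤ s j := by
    intro t ht j
    by_cases hj : j = k
    · subst hj
      rw [Function.update_self]
      linarith [norm_add_le (a j) t]
    · rw [Function.update_of_ne hj]
      exact (has j).le
  have hs0 : ∀ j, 0 ≤ s j := fun j => (norm_nonneg _).trans (has j).le
  have hsum : ∀ t : ℂ, ‖t‖ < s k - ‖a k‖ →
      HasSum (fun γ => F γ t) (f (emb r N (Function.update a k (a k + t)))) := by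
    intro t ht
    have h1 : ‖emb r N (Function.update a k (a k + t))‖ < 1 := by
      refine (norm_emb_mono fun j _ => ?_).trans_lt hs
      rw [Complex.norm_real, Real.norm_of_nonneg (hs0 j)]
      exact hupd t ht j
    convert! hc _ (mem_ball_zero_iff.mpr h1) (hsupp _) using 2 with γ
    rw [seqMonomial_emb, hF]
    simp
  have hu : Summable fun γ : ℕ →₀ ℕ => ‖c γ * seqMonomial (emb r N fun j => (s j : ℂ)) γ‖ :=
    (hc _ (mem_ball_zero_iff.mpr hs) (hsupp _)).summable.norm
  have hder : ∀ γ t, HasDerivAt (F γ) (if γ.support ⊆ range N then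
      c γ * (monom a (γ.erase k) * (γ k * (a k + t) ^ (γ k - 1))) else 0) t := by
    intro γ t
    simp only [hF]
    split_ifs
    · simp_rw [monom_update]
      refine HasDerivAt.const_mul _ (HasDerivAt.const_mul _ ?_)
      simpa using ((hasDerivAt_id t).const_add (a k)).fun_pow (γ k)
    · exact hasDerivAt_const _ _
  have hpos : 0 < s k - ‖a k‖ := sub_pos.mpr (has k)
  have key := Complex.hasSum_deriv_of_summable_norm (U := Metric.ball 0 (s k - ‖a k‖)) (z := 0)
    (F := F) hu (fun γ t _ => (hder γ t).differentiableAt.differentiableWithinAt)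
    Metric.isOpen_ball (fun γ t ht => ?_) (Metric.mem_ball_self hpos)
  · -- the derivatives at `0`, indexed by `α` with `γ = α + e_k`
    have hinj : Function.Injective fun α : ℕ →₀ ℕ => α + Finsupp.single k 1 :=
      add_left_injective _
    rw [← hinj.hasSum_iff] at key
    · have hval : deriv (fun w => ∑' γ, F γ w) 0 = fderiv ℂ f (emb r N a) (lp.single r k 1) := by
        have h1 : (fun w => ∑' γ, F γ w) =ᶠ[𝓝 0]
            fun t => f (emb r N a + t • lp.single r k (1 : ℂ)) := by
          filter_upwards [Metric.ball_mem_nhds (0 : ℂ) hpos] with t ht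
          rw [(hsum t (by simpa using ht)).tsum_eq]
          congr 1
          have hsm : t • lp.single (E := fun _ : ℕ => ℂ) r k 1 = lp.single r k t := by
            rw [← lp.single_smul, smul_eq_mul, mul_one]
          rw [hsm]
          ext j
          rw [lp.coeFn_add, Pi.add_apply, emb_apply, emb_apply]
          by_cases hj : j = k
          · subst hj
            simp [hk]
          · simp [hj]
        rw [h1.deriv_eq]
        have hfx : HasFDerivAt f (fderiv ℂ f (emb r N a))
            (emb r N a + (0 : ℂ) • lp.single r k (1 : ℂ)) := by
          simpa using (hf.differentiableAt
            (Metric.isOpen_ball.mem_nhds (mem_ball_zero_iff.mpr ha))).hasFDerivAt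
        have hl : HasDerivAt (fun t : ℂ => emb r N a + t • lp.single r k (1 : ℂ))
            (lp.single r k (1 : ℂ)) 0 := by
          simpa using ((hasDerivAt_id (0 : ℂ)).smul_const
            (lp.single (E := fun _ : ℕ => ℂ) r k 1)).const_add (emb r N a)
        exact (hfx.comp_hasDerivAt _ hl).deriv
      rw [← hval]
      convert! key using 2 with α
      have hsub : (α + Finsupp.single k 1).support ⊆ range N ↔ α.support ⊆ range N :=
        support_add_single_subset_iff hk
      simp only [Function.comp_apply, (hder _ _).deriv, hsub]
      split_ifs
      · have : (α + Finsupp.single k 1).erase k = α.erase k := by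
          rw [Finsupp.erase_add, Finsupp.erase_single, add_zero]
        have hm : monom a α = monom a (α.erase k) * a k ^ α k := by
          conv_lhs => rw [← Finsupp.erase_add_single k α, monom_add, monom_single]
        rw [this, hm]
        simp
        ring
      · rfl
    · intro γ hγ
      have h0 : γ k = 0 := by
        by_contra h0
        refine hγ ⟨γ - Finsupp.single k 1, tsub_add_cancel_of_le ?_⟩
        simpa [Nat.one_le_iff_ne_zero] using h0
      simp [(hder _ _).deriv, h0]
  · simp only [hF]
    rw [seqMonomial_emb]
    split_ifs
    · rw [norm_mul, norm_mul, norm_monom, norm_monom]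
      refine mul_le_mul_of_nonneg_left (monom_le_monom (fun _ => norm_nonneg _) fun j _ => ?_)
        (norm_nonneg _)
      rw [Complex.norm_real, Real.norm_of_nonneg (hs0 j)]
      exact hupd t (by simpa using ht) j
    · simp

lemma hasSum_fderiv_emb {f : SeqSpace r → ℂ} {c : (ℕ →₀ ℕ) → ℂ}
    (hf : DifferentiableOn ℂ f (Metric.ball 0 1)) (hc : IsMonomialExpansion r f c)
    {N : ℕ} {a : ℕ → ℂ} (ha : ‖emb r N a‖ < 1) (y : ℕ → ℂ) :
    HasSum (fun α : ℕ →₀ ℕ => if α.support ⊆ range N then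
      (∑ k ∈ range N, y k * ((α k + 1) * c (α + Finsupp.single k 1))) * monom a α else 0)
      (fderiv ℂ f (emb r N a) (emb r N y)) := by
  have h := hasSum_sum fun k (hk : k ∈ range N) =>
    (hasSum_fderiv_single hf hc ha (Finset.mem_range.mp hk)).mul_left (y k)
  convert! h using 1
  · ext α
    split_ifs
    · rw [Finset.sum_mul]
      exact Finset.sum_congr rfl fun k _ => by ring
    · simp
  · rw [show emb r N y = ∑ j ∈ range N, lp.single r j (y j) from rfl, map_sum]
    refine Finset.sum_congr rfl fun k _ => ?_
    have : lp.single r k (y k) = y k • lp.single (E := fun _ : ℕ => ℂ) r k 1 := by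
      rw [← lp.single_smul, smul_eq_mul, mul_one]
    rw [this, map_smul, smul_eq_mul]

/-- The coefficients `c (α + e_k)`, for fixed `α`, are those of a linear functional on `ℓ_r` whose
norm is controlled by Cauchy's inequalities. -/
lemma sum_mul_norm_coeff_le {f : SeqSpace r → ℂ} {c : (ℕ →₀ ℕ) → ℂ} {M : ℝ}
    (hf : DifferentiableOn ℂ f (Metric.ball 0 1)) (hM : ∀ u ∈ Metric.ball 0 1, ‖f u‖ ≤ M)
    (hc : IsMonomialExpansion r f c) {N : ℕ} {s y : ℕ → ℝ} (hs : ∀ k, 0 ≤ s k) (hy : ∀ k, 0 ≤ y k)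
    (hsy : (‖emb r N fun k => (s k : ℂ)‖ + ‖emb r N fun k => (y k : ℂ)‖) < 1)
    {α : ℕ →₀ ℕ} (hα : α.support ⊆ range N) :
    (∑ k ∈ range N, y k * ‖c (α + Finsupp.single k 1)‖) * monom s α ≤ M := by
  choose ε hε1 hε using fun k => exists_norm_le_one_mul_eq_norm (c (α + Finsupp.single k 1))
  have hs1 : ‖emb r N fun k => (s k : ℂ)‖ < 1 := by
    linarith [norm_nonneg (emb r N fun k => (y k : ℂ))]
  have hrot : ∀ θ : Torus, ‖emb r N fun k => (s k : ℂ) * θ k‖ ≤ ‖emb r N fun k => (s k : ℂ)‖ :=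
    fun θ => by
      simpa using norm_emb_mul_le (r := r) (N := N) (s := fun k => (s k : ℂ)) zero_le_one
        fun k => (θ k).norm_coe.le
  have h2 : ‖emb r N fun k => (y k : ℂ) * ε k‖ ≤ ‖emb r N fun k => (y k : ℂ)‖ := by
    simpa using norm_emb_mul_le (r := r) (N := N) (s := fun k => (y k : ℂ)) zero_le_one hε1
  have h3 := fourierT_eq_of_hasSum (g := fun θ => fderiv ℂ f (emb r N fun k => (s k : ℂ) * θ k)
      (emb r N fun k => (y k : ℂ) * ε k))
    (q := fun α => if α.support ⊆ range N then
      (∑ k ∈ range N, y k * ε k * ((α k + 1) * c (α + Finsupp.single k 1))) *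
        monom (fun k => (s k : ℂ)) α else 0) (fun θ => by
    convert! hasSum_fderiv_emb hf hc ((hrot θ).trans_lt hs1) (fun k => (y k : ℂ) * ε k) using 2 with β
    rw [monom_mul]
    split_ifs
    · rw [chr, mul_assoc]
    · simp) α
  have h4 := norm_fourierT_le (g := fun θ => fderiv ℂ f (emb r N fun k => (s k : ℂ) * θ k)
      (emb r N fun k => (y k : ℂ) * ε k)) (M := M)
      (fun θ => norm_fderiv_apply_le hf hM (by linarith [hrot θ])) α
  rw [h3, if_pos hα] at h4
  have h5 : (∑ k ∈ range N, (y k : ℂ) * ε k * ((α k + 1) * c (α + Finsupp.single k 1))) *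
        monom (fun k => (s k : ℂ)) α =
      (((∑ k ∈ range N, y k * ((α k + 1) * ‖c (α + Finsupp.single k 1)‖)) * monom s α : ℝ) : ℂ) := by
    push_cast
    congr 1
    · refine Finset.sum_congr rfl fun k _ => ?_
      rw [← hε]
      ring
    · exact (map_monom Complex.ofRealHom s α).symm
  rw [h5, Complex.norm_real] at h4
  refine le_trans ?_ ((le_abs_self _).trans h4)
  refine mul_le_mul_of_nonneg_right (Finset.sum_le_sum fun k _ => ?_) (monom_nonneg hs α)
  refine mul_le_mul_of_nonneg_left ?_ (hy k)
  nlinarith [norm_nonneg (c (α + Finsupp.single k 1)), (α k).cast_nonneg (α := ℝ)]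

/-- Mixed `ℓ₁`-`ℓ₂` estimate for the coefficients `c (α + e_k)`, where the dependence of `α` on the
first `n` variables is fixed and `α` has degree `m` in the other ones. -/
lemma sum_mul_sqrt_sum_coeff_sq_le {f : SeqSpace r → ℂ} {c : (ℕ →₀ ℕ) → ℂ} {M : ℝ}
    (hf : DifferentiableOn ℂ f (Metric.ball 0 1)) (hM : ∀ u ∈ Metric.ball 0 1, ‖f u‖ ≤ M)
    (hc : IsMonomialExpansion r f c) {n N : ℕ} {s y : ℕ → ℝ} (hs : ∀ k, 0 ≤ s k)
    (hy : ∀ k, 0 ≤ y k)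
    (hsy : (‖emb r N fun k => (s k : ℂ)‖ + ‖emb r N fun k => (y k : ℂ)‖) < 1)
    {α' : ℕ →₀ ℕ} (hα' : α'.support ⊆ range n) (hnN : n ≤ N) (m : ℕ) :
    ∑ k ∈ range N, y k * √(∑ τ ∈ (Ico n N).finsuppAntidiag m,
      (‖c (α' + τ + Finsupp.single k 1)‖ * monom s (α' + τ)) ^ 2) ≤ 2 ^ m * M := by
  have hs1 : ‖emb r N fun k => (s k : ℂ)‖ < 1 := by
    linarith [norm_nonneg (emb r N fun k => (y k : ℂ))]
  have hrot : ∀ θ : Torus, ‖emb r N fun k => (s k : ℂ) * θ k‖ ≤ ‖emb r N fun k => (s k : ℂ)‖ :=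
    fun θ => by
      simpa using norm_emb_mul_le (r := r) (N := N) (s := fun k => (s k : ℂ)) zero_le_one
        fun k => (θ k).norm_coe.le
  set g : ℕ → Torus → ℂ := fun k θ =>
    fderiv ℂ f (emb r N fun k => (s k : ℂ) * θ k) (lp.single r k 1) with hg
  set q : ℕ → (ℕ →₀ ℕ) → ℂ := fun k α => if α.support ⊆ range N then
      (α k + 1) * c (α + Finsupp.single k 1) * monom (fun k => (s k : ℂ)) α else 0 with hq
  have hgq : ∀ k ∈ range N, ∀ θ, HasSum (fun α => q k α * chr α θ) (g k θ) := fun k hk θ => by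
    convert! hasSum_fderiv_single hf hc ((hrot θ).trans_lt hs1) (Finset.mem_range.mp hk)
      using 2 with β
    rw [monom_mul, hq]
    simp only
    split_ifs
    · rw [chr, mul_assoc]
    · simp
  have hgc : ∀ k ∈ range N, Continuous (g k) := fun k hk => continuous_of_hasSum_chr (hgq k hk)
  have h1 : ∀ k ∈ range N, √(∑ τ ∈ (Ico n N).finsuppAntidiag m,
      (‖c (α' + τ + Finsupp.single k 1)‖ * monom s (α' + τ)) ^ 2) ≤
        2 ^ m * ∫ θ, ‖g k θ‖ ∂haarT := fun k hk => by
    refine le_trans (Real.sqrt_le_sqrt (Finset.sum_le_sum fun τ hτ => ?_))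
      (sqrt_sum_antidiag_le (hgq k hk) (fun α hα => ?_) hα' m)
    · refine pow_le_pow_left₀ (mul_nonneg (norm_nonneg _) (monom_nonneg hs _)) ?_ 2
      have hsub : (α' + τ).support ⊆ range N := by
        refine Finsupp.support_add.trans (Finset.union_subset ?_ ?_)
        · exact hα'.trans (by simpa using hnN)
        · refine (mem_finsuppAntidiag.mp hτ).2.trans fun j hj => ?_
          simp at hj ⊢
          exact hj.2
      rw [hq]
      simp only [if_pos hsub]
      rw [norm_mul, norm_mul, norm_monom]
      have h2 : (monom (fun i => ‖(s i : ℂ)‖) (α' + τ)) = monom s (α' + τ) :=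
        monom_congr fun i _ => by rw [Complex.norm_real, Real.norm_of_nonneg (hs i)]
      have h3 : ‖(((α' + τ) k : ℂ) + 1)‖ = ((α' + τ) k : ℝ) + 1 := by
        have : (((α' + τ) k : ℂ) + 1) = (((α' + τ) k + 1 : ℕ) : ℂ) := by push_cast; rfl
        rw [this, Complex.norm_natCast]
        push_cast; rfl
      rw [h2, h3]
      refine mul_le_mul_of_nonneg_right ?_ (monom_nonneg hs _)
      nlinarith [norm_nonneg (c (α' + τ + Finsupp.single k 1)),
        ((α' + τ) k).cast_nonneg (α := ℝ)]
    · by_contra h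
      exact hα (by simp only [hq, if_neg h])
  calc ∑ k ∈ range N, y k * √(∑ τ ∈ (Ico n N).finsuppAntidiag m,
        (‖c (α' + τ + Finsupp.single k 1)‖ * monom s (α' + τ)) ^ 2)
      ≤ ∑ k ∈ range N, y k * (2 ^ m * ∫ θ, ‖g k θ‖ ∂haarT) :=
        Finset.sum_le_sum fun k hk => mul_le_mul_of_nonneg_left (h1 k hk) (hy k)
    _ = 2 ^ m * ∫ θ, ∑ k ∈ range N, y k * ‖g k θ‖ ∂haarT := by
        rw [integral_finsetSum (f := fun k θ => y k * ‖g k θ‖) _ fun k hk =>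
          (continuous_const.mul (hgc k hk).norm).integrable_probHaar, Finset.mul_sum]
        refine Finset.sum_congr rfl fun k _ => ?_
        rw [integral_const_mul]
        ring
    _ ≤ 2 ^ m * ∫ _ : Torus, M ∂haarT := by
        refine mul_le_mul_of_nonneg_left (integral_mono ?_ (integrable_const _) fun θ => ?_)
          (by positivity)
        · exact (continuous_finsetSum _ fun k hk =>
            continuous_const.mul (hgc k hk).norm).integrable_probHaar
        · exact sum_mul_norm_fderiv_single_le hf hM (by linarith [hrot θ])
    _ = 2 ^ m * M := by simp

/-! ### Sums over multi-indices -/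

lemma sum_le_sum_of_forall_exists {ι κ : Type*} [DecidableEq κ] {h : κ → ℝ} (hh : ∀ x, 0 ≤ h x)
    {Γ : Finset κ} {Y : Finset ι} {Φ : ι → κ} (hsub : ∀ γ ∈ Γ, ∃ y ∈ Y, Φ y = γ) :
    ∑ γ ∈ Γ, h γ ≤ ∑ y ∈ Y, h (Φ y) := by
  refine le_trans (Finset.sum_le_sum fun γ hγ => ?_)
    (Finset.sum_fiberwise_le_sum_of_sum_fiber_nonneg (s := Y) (t := Γ) (g := Φ)
      fun γ _ => Finset.sum_nonneg fun y _ => hh _)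
  obtain ⟨y, hy, rfl⟩ := hsub γ hγ
  exact Finset.single_le_sum (f := fun y => h (Φ y)) (fun y _ => hh _) (by simp [hy])

/-- A multi-index with a non-zero entry at or after `n` is the sum of a multi-index supported
before `n`, of one supported between `n` and `k`, and of the `k`-th unit multi-index. -/
lemma exists_eq_add_add_single {n : ℕ} {γ : ℕ →₀ ℕ} (hγ : ¬ γ.support ⊆ range n) :
    ∃ k ∈ γ.support, n ≤ k ∧ ∃ τ ∈ (Ico n (k + 1)).finsuppAntidiag τ.degree,
      τ.degree < γ.degree ∧ γ = γ.filter (· < n) + τ + Finsupp.single k 1 := by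
  obtain ⟨j, hj, hjn⟩ := Finset.not_subset.mp hγ
  have hne : γ.support.Nonempty := ⟨j, hj⟩
  set k := γ.support.max' hne with hk
  have hkmem : k ∈ γ.support := Finset.max'_mem _ _
  have hnk : n ≤ k := (by simpa using hjn : n ≤ j).trans (Finset.le_max' _ _ hj)
  set β := γ.filter (fun j => ¬ j < n) with hβ
  have hβk : β k = γ k := Finsupp.filter_apply_pos _ _ (by omega)
  have hle : Finsupp.single k 1 ≤ β := by
    rw [Finsupp.single_le_iff, hβk]
    exact Nat.one_le_iff_ne_zero.mpr (Finsupp.mem_support_iff.mp hkmem)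
  have hγeq : γ = γ.filter (· < n) + (β - Finsupp.single k 1) + Finsupp.single k 1 := by
    rw [add_assoc, tsub_add_cancel_of_le hle]
    exact (Finsupp.filter_add_filter_not γ (· < n)).symm
  have hsub : (β - Finsupp.single k 1).support ⊆ Ico n (k + 1) := by
    intro i hi
    have h1 : β i ≠ 0 := by
      rw [Finsupp.mem_support_iff, Finsupp.tsub_apply] at hi
      omega
    have h2 : i ∈ γ.support ∧ ¬ i < n := by
      rw [← Finsupp.mem_support_iff, hβ, Finsupp.support_filter] at h1
      simpa using h1
    have := Finset.le_max' _ _ h2.1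
    rw [Finset.mem_Ico]
    omega
  refine ⟨k, hkmem, hnk, β - Finsupp.single k 1, mem_finsuppAntidiag.mpr ⟨?_, hsub⟩, ?_, hγeq⟩
  · rw [Finsupp.degree_apply]
    exact (Finset.sum_subset hsub (by simp)).symm
  · have := congrArg Finsupp.degree hγeq
    rw [map_add, map_add, Finsupp.degree_single] at this
    omega

/-- A family indexed by multi-indices is summable if it decays geometrically both in the degree of
the first `n` variables and in the degree of the others. -/
lemma summable_of_forall_sum_le {h : (ℕ →₀ ℕ) → ℝ} (hh : ∀ γ, 0 ≤ h γ) {n : ℕ} {q C : ℝ}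
    (hq0 : 0 ≤ q) (hq1 : q < 1)
    (h0 : ∀ α : ℕ →₀ ℕ, α.support ⊆ range n → h α ≤ C * q ^ α.degree)
    (h1 : ∀ α : ℕ →₀ ℕ, α.support ⊆ range n → ∀ m N : ℕ, n ≤ N →
      ∑ k ∈ Ico n N, ∑ τ ∈ (Ico n (k + 1)).finsuppAntidiag m, h (α + τ + Finsupp.single k 1) ≤
        C * q ^ α.degree * (1 / 2) ^ m) : Summable h := by
  have hC : 0 ≤ C := by
    have := (hh 0).trans (h0 0 (by simp))
    simpa using this
  have hgeo := hasSum_monom_range (𝕜 := ℝ) (x := fun _ => q)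
    (fun _ => by rwa [Real.norm_of_nonneg hq0]) n
  set G := ∏ j ∈ range n, (1 - q)⁻¹
  have hA : ∀ A : Finset (ℕ →₀ ℕ), (∀ α ∈ A, α.support ⊆ range n) →
      ∑ α ∈ A, q ^ α.degree ≤ G := fun A hA => by
    refine le_trans (le_of_eq (Finset.sum_congr rfl fun α hα => ?_))
      (sum_le_hasSum A (fun α _ => ?_) hgeo)
    · rw [if_pos (hA α hα), monom_const]
    · split_ifs
      · exact monom_nonneg (fun _ => hq0) α
      · exact le_rfl
  refine summable_of_sum_le (c := C * G + C * G * 2) hh fun Γ => ?_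
  rw [← Finset.sum_filter_add_sum_filter_not Γ (fun γ => γ.support ⊆ range n)]
  refine add_le_add ?_ ?_
  · calc ∑ γ ∈ Γ with γ.support ⊆ range n, h γ
        ≤ ∑ γ ∈ Γ with γ.support ⊆ range n, C * q ^ γ.degree :=
          Finset.sum_le_sum fun γ hγ => h0 γ (Finset.mem_filter.mp hγ).2
      _ ≤ C * G := by
          rw [← Finset.mul_sum]
          exact mul_le_mul_of_nonneg_left (hA _ fun α hα => (Finset.mem_filter.mp hα).2) hC
  · set N := max n ((Γ.biUnion Finsupp.support).sup id + 1) with hN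
    set D := Γ.sup Finsupp.degree with hD
    set A := Γ.image fun γ => γ.filter (· < n) with hAdef
    have hAr : ∀ α ∈ A, α.support ⊆ range n := fun α hα => by
      obtain ⟨γ, -, rfl⟩ := Finset.mem_image.mp hα
      exact support_filter_lt_subset n γ
    calc ∑ γ ∈ Γ with ¬ γ.support ⊆ range n, h γ
        ≤ ∑ y ∈ A.sigma fun _ => (range D).sigma fun m => (Ico n N).sigma fun k =>
            (Ico n (k + 1)).finsuppAntidiag m,
              h (y.1 + y.2.2.2 + Finsupp.single y.2.2.1 1) := by
          refine sum_le_sum_of_forall_exists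
            (Φ := fun y : (_ : ℕ →₀ ℕ) × (_ : ℕ) × (_ : ℕ) × (ℕ →₀ ℕ) =>
            y.1 + y.2.2.2 + Finsupp.single y.2.2.1 1) hh fun γ hγ => ?_
          rw [Finset.mem_filter] at hγ
          obtain ⟨k, hk, hnk, τ, hτ, hdeg, hγe⟩ := exists_eq_add_add_single hγ.2
          refine ⟨⟨γ.filter (· < n), τ.degree, k, τ⟩, ?_, hγe.symm⟩
          simp only [Finset.mem_sigma, Finset.mem_range, Finset.mem_Ico]
          refine ⟨Finset.mem_image_of_mem _ hγ.1, hdeg.trans_le (Finset.le_sup hγ.1), ⟨hnk, ?_⟩, hτ⟩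
          have : k ≤ (Γ.biUnion Finsupp.support).sup id :=
            Finset.le_sup (f := id) (Finset.mem_biUnion.mpr ⟨γ, hγ.1, hk⟩)
          omega
      _ = ∑ α ∈ A, ∑ m ∈ range D, ∑ k ∈ Ico n N, ∑ τ ∈ (Ico n (k + 1)).finsuppAntidiag m,
            h (α + τ + Finsupp.single k 1) := by
          simp only [Finset.sum_sigma]
      _ ≤ ∑ α ∈ A, ∑ m ∈ range D, C * q ^ α.degree * (1 / 2) ^ m :=
          Finset.sum_le_sum fun α hα => Finset.sum_le_sum fun m _ =>
            h1 α (hAr α hα) m N (le_max_left _ _)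
      _ ≤ ∑ α ∈ A, C * q ^ α.degree * 2 := by
          refine Finset.sum_le_sum fun α _ => ?_
          rw [← Finset.mul_sum]
          refine mul_le_mul_of_nonneg_left ?_ (mul_nonneg hC (pow_nonneg hq0 _))
          have := summable_geometric_two.sum_le_tsum (range D) (fun j _ => by positivity)
          rwa [tsum_geometric_two] at this
      _ ≤ C * G * 2 := by
          rw [← Finset.sum_mul, ← Finset.mul_sum]
          gcongr
          exact hA A hAr

/-- Sums of monomials of fixed degree in variables decaying like `1 / (j + 1)` grow slowly with the
number of variables. -/
lemma sum_antidiag_monom_le {x : ℕ → ℝ} {n : ℕ} (hx0 : ∀ j, 0 ≤ x j)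
    (hx : ∀ j, n ≤ j → x j ≤ 1 / (4 * (j + 1))) (K m : ℕ) :
    ∑ τ ∈ (Ico n K).finsuppAntidiag m, monom x τ ≤ √(K + 1) := by
  have hzero : ∀ K : ℕ, 1 ≤ √((K : ℝ) + 1) := fun K => by
    rw [Real.one_le_sqrt]
    linarith [K.cast_nonneg (α := ℝ)]
  induction K generalizing m with
  | zero =>
    rcases m.eq_zero_or_pos with rfl | hm
    · simp
    · simp [hm.ne']
  | succ K ih =>
    rcases lt_or_ge K n with hK | hK
    · rw [Finset.Ico_eq_empty (by omega)]
      rcases m.eq_zero_or_pos with rfl | hm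
      · simpa using hzero (K + 1)
      · simp [hm.ne']
    induction m with
    | zero => simpa using hzero (K + 1)
    | succ m ihm =>
      -- `h_{m+1}(x_n, …, x_K) ≤ h_{m+1}(x_n, …, x_{K-1}) + x_K h_m(x_n, …, x_K)`
      have hsub : ∀ τ ∈ (Ico n (K + 1)).finsuppAntidiag (m + 1),
          ∃ y ∈ ((Ico n K).finsuppAntidiag (m + 1)).disjSum ((Ico n (K + 1)).finsuppAntidiag m),
            Sum.elim id (· + Finsupp.single K 1) y = τ := by
        intro τ hτ
        obtain ⟨hsum, hsupp⟩ := mem_finsuppAntidiag.mp hτ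
        by_cases h : τ K = 0
        · refine ⟨Sum.inl τ, ?_, rfl⟩
          rw [Finset.inl_mem_disjSum, mem_finsuppAntidiag]
          constructor
          · rw [← hsum, Finset.sum_Ico_succ_top hK, h, add_zero]
          · intro j hj
            have h1 := hsupp hj
            have h2 : j ≠ K := fun h2 => Finsupp.mem_support_iff.mp hj (h2 ▸ h)
            rw [Finset.mem_Ico] at h1 ⊢
            omega
        · have hle : Finsupp.single K 1 ≤ τ := by
            rw [Finsupp.single_le_iff]
            exact Nat.one_le_iff_ne_zero.mpr h
          refine ⟨Sum.inr (τ - Finsupp.single K 1), ?_, tsub_add_cancel_of_le hle⟩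
          rw [Finset.inr_mem_disjSum, mem_finsuppAntidiag']
          have h3 := degree_of_mem_finsuppAntidiag hτ
          rw [← tsub_add_cancel_of_le hle, map_add, Finsupp.degree_single] at h3
          constructor
          · exact Nat.succ_injective h3
          · intro j hj
            refine hsupp ?_
            rw [Finsupp.mem_support_iff, Finsupp.tsub_apply] at hj
            rw [Finsupp.mem_support_iff]
            omega
      refine (sum_le_sum_of_forall_exists (h := monom x) (monom_nonneg hx0) hsub).trans ?_
      rw [Finset.sum_disjSum]
      simp only [Sum.elim_inl, Sum.elim_inr, id, monom_add, monom_single, pow_one]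
      rw [← Finset.sum_mul]
      have h1 := ih (m + 1)
      have h2 : (∑ τ ∈ (Ico n (K + 1)).finsuppAntidiag m, monom x τ) * x K ≤
          √((K : ℝ) + 2) * (1 / (4 * (K + 1))) := by
        refine mul_le_mul (ihm.trans_eq ?_) (hx K hK) (hx0 K) (Real.sqrt_nonneg _)
        push_cast
        ring_nf
      have hK1 : (0 : ℝ) < K + 1 := by positivity
      have h3 : √((K : ℝ) + 1) ≤ √((K : ℝ) + 2) * (1 - 1 / (4 * (K + 1))) := by
        have h4 : 0 ≤ 1 - 1 / (4 * ((K : ℝ) + 1)) := by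
          rw [sub_nonneg, div_le_one (by positivity)]
          linarith
        rw [← Real.sqrt_sq h4, ← Real.sqrt_mul (by positivity)]
        refine Real.sqrt_le_sqrt ?_
        have h5 : ((K : ℝ) + 2) * (1 - 1 / (4 * (K + 1))) ^ 2 - (K + 1) =
            (8 * (K + 1) ^ 2 - 7 * (K + 1) + 1) / (16 * (K + 1) ^ 2) := by
          field_simp
          ring
        have h6 : 0 ≤ (8 * ((K : ℝ) + 1) ^ 2 - 7 * (K + 1) + 1) / (16 * (K + 1) ^ 2) := by
          refine div_nonneg ?_ (by positivity)
          nlinarith [K.cast_nonneg (α := ℝ)]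
        linarith
      have h7 : √(((K + 1 : ℕ) : ℝ) + 1) = √((K : ℝ) + 2) := by
        push_cast
        ring_nf
      rw [h7]
      linarith

/-! ### Sufficient conditions for monomial convergence -/

lemma norm_coeff_mul_monom_le {f : SeqSpace r → ℂ} {c : (ℕ →₀ ℕ) → ℂ} {M : ℝ}
    (hM : ∀ u ∈ Metric.ball 0 1, ‖f u‖ ≤ M) (hc : IsMonomialExpansion r f c) {N : ℕ} {s : ℕ → ℝ}
    (hs : ∀ k, 0 ≤ s k) (hs1 : ‖emb r N fun k => (s k : ℂ)‖ < 1) {α : ℕ →₀ ℕ}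
    (hα : α.support ⊆ range N) : ‖c α‖ * monom s α ≤ M := by
  have h1 := fourierT_of_isMonomialExpansion hc hs1 α
  rw [if_pos hα] at h1
  have h2 := norm_fourierT_le (g := fun θ => f (emb r N fun k => (s k : ℂ) * θ k)) (M := M)
    (fun θ => hM _ (mem_ball_zero_iff.mpr
      ((norm_emb_mul_le zero_le_one fun k => (θ k).norm_coe.le).trans_lt (by rwa [one_mul])))) α
  rw [h1, norm_mul, norm_monom] at h2
  convert! h2 using 2
  exact monom_congr fun i _ => by rw [Complex.norm_real, Real.norm_of_nonneg (hs i)]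

lemma norm_emb_real_smul_le {N : ℕ} {t : ℝ} (ht : 0 ≤ t) (a : ℕ → ℂ) {b : ℕ → ℂ}
    (hb : ∀ k, ‖b k‖ ≤ t * ‖a k‖) : ‖emb r N b‖ ≤ t * ‖emb r N a‖ := by
  have h : t * ‖emb r N a‖ = ‖emb r N fun k => (t : ℂ) * a k‖ := by
    rw [emb_smul, norm_smul, Complex.norm_real, Real.norm_of_nonneg ht]
  rw [h]
  refine norm_emb_mono fun k _ => ?_
  rw [norm_mul, Complex.norm_real, Real.norm_of_nonneg ht]
  exact hb k

/-- Monomial convergence at the product of a vector of `ℓ_r` by weights which are small compared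
with `j ^ (-1/2)`, up to finitely many coordinates. -/
theorem summable_of_le_sqrt_weight {f : SeqSpace r → ℂ} {c : (ℕ →₀ ℕ) → ℂ} {M : ℝ}
    (hf : DifferentiableOn ℂ f (Metric.ball 0 1)) (hM : ∀ u ∈ Metric.ball 0 1, ‖f u‖ ≤ M)
    (hc : IsMonomialExpansion r f c) {z : ℕ → ℂ} {n : ℕ} {q : ℝ} (hq0 : 0 < q) (hq1 : q < 1)
    {v κ : ℕ → ℝ} (hv : ∀ k, 0 ≤ v k) (hκ0 : ∀ k, 0 ≤ κ k)
    (hκ : ∀ k, n ≤ k → κ k ^ 2 ≤ 1 / (256 * (k + 1)))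
    (hz : ∀ k, n ≤ k → ‖z k‖ ≤ κ k * v k)
    (hnorm : ∀ N, ‖emb r N fun k => if k < n then z k else 0‖ / q +
      ‖emb r N fun k => if k < n then 0 else (v k : ℂ)‖ < 1) :
    Summable fun α => ‖c α * seqMonomial z α‖ := by
  set s : ℕ → ℝ := fun k => if k < n then ‖z k‖ / q else v k / 2 with hs
  set y : ℕ → ℝ := fun k => if k < n then 0 else v k / 2 with hy
  have hs0 : ∀ k, 0 ≤ s k := fun k => by
    simp only [hs]; split_ifs
    · positivity
    · exact div_nonneg (hv k) two_pos.le
  have hy0 : ∀ k, 0 ≤ y k := fun k => by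
    simp only [hy]; split_ifs
    · exact le_rfl
    · exact div_nonneg (hv k) two_pos.le
  have hM0 : 0 ≤ M := (norm_nonneg _).trans (hM 0 (by simp))
  have hsN : ∀ N, ‖emb r N fun k => (s k : ℂ)‖ ≤
      ‖emb r N fun k => if k < n then z k else 0‖ / q +
        1 / 2 * ‖emb r N fun k => if k < n then 0 else (v k : ℂ)‖ := fun N => by
    have h1 : (emb r N fun k => (s k : ℂ)) =
        emb r N fun k => if k < n then ((‖z k‖ / q : ℝ) : ℂ) else ((v k / 2 : ℝ) : ℂ) :=
      emb_congr fun k _ => by simp only [hs]; split_ifs <;> rfl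
    rw [h1, emb_head_add_tail]
    refine (norm_add_le _ _).trans (add_le_add ?_ ?_)
    · rw [div_eq_inv_mul]
      refine norm_emb_real_smul_le (inv_nonneg.mpr hq0.le) _ fun k => ?_
      split_ifs
      · rw [Complex.norm_real, Real.norm_of_nonneg (by positivity), div_eq_inv_mul]
      · simp
    · refine norm_emb_real_smul_le (by norm_num) _ fun k => ?_
      split_ifs
      · simp
      · rw [Complex.norm_real, Complex.norm_real, Real.norm_of_nonneg (hv k),
          Real.norm_of_nonneg (div_nonneg (hv k) two_pos.le)]
        linarith
  have hyN : ∀ N, ‖emb r N fun k => (y k : ℂ)‖ ≤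
      1 / 2 * ‖emb r N fun k => if k < n then 0 else (v k : ℂ)‖ := fun N => by
    refine norm_emb_real_smul_le (by norm_num) _ fun k => ?_
    simp only [hy]
    split_ifs
    · simp
    · rw [Complex.norm_real, Complex.norm_real, Real.norm_of_nonneg (hv k),
        Real.norm_of_nonneg (div_nonneg (hv k) two_pos.le)]
      linarith
  have hsy : ∀ N, ‖emb r N fun k => (s k : ℂ)‖ + ‖emb r N fun k => (y k : ℂ)‖ < 1 := fun N => by
    linarith [hsN N, hyN N, hnorm N]
  have hs1 : ∀ N, ‖emb r N fun k => (s k : ℂ)‖ < 1 := fun N => by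
    linarith [hsy N, norm_nonneg (emb r N fun k => (y k : ℂ))]
  have hhead : ∀ α : ℕ →₀ ℕ, α.support ⊆ range n →
      monom (fun k => ‖z k‖) α = q ^ α.degree * monom s α := fun α hα => by
    rw [← monom_const, ← monom_mul]
    refine monom_congr fun k hk => ?_
    simp only [hs, if_pos (Finset.mem_range.mp (hα hk))]
    field_simp
  have hnormeq : ∀ α, ‖c α * seqMonomial z α‖ = ‖c α‖ * monom (fun k => ‖z k‖) α := fun α => by
    rw [norm_mul, seqMonomial_eq_monom, norm_monom]
  simp_rw [hnormeq]
  refine summable_of_forall_sum_le (n := n) (q := q) (C := M)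
    (fun γ => mul_nonneg (norm_nonneg _) (monom_nonneg (fun _ => norm_nonneg _) _)) hq0.le hq1
    (fun α hα => ?_) fun α hα m N hnN => ?_
  · rw [hhead α hα]
    have := norm_coeff_mul_monom_le hM hc hs0 (hs1 n) hα
    nlinarith [pow_pos hq0 α.degree]
  set x : ℕ → ℝ := fun j => 64 * κ j ^ 2 with hx
  have hxW : ∀ j, n ≤ j → x j ≤ 1 / (4 * (j + 1)) := fun j hj => by
    have := hκ j hj
    simp only [hx]
    calc 64 * κ j ^ 2 ≤ 64 * (1 / (256 * (j + 1))) := by gcongr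
      _ = 1 / (4 * (j + 1)) := by field_simp; norm_num
  have hW := fun k => sum_antidiag_monom_le (x := x) (n := n)
    (fun j => by positivity) hxW (k + 1) m
  have hmain := sum_mul_sqrt_sum_coeff_sq_le hf hM hc hs0 hy0 (hsy N) hα hnN m
  -- the contribution of the monomials with largest index `k`
  have hk : ∀ k ∈ Ico n N, ∑ τ ∈ (Ico n (k + 1)).finsuppAntidiag m,
      ‖c (α + τ + Finsupp.single k 1)‖ * monom (fun k => ‖z k‖) (α + τ + Finsupp.single k 1) ≤
      q ^ α.degree * (1 / 4) ^ m * (y k * √(∑ τ ∈ (Ico n N).finsuppAntidiag m,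
        (‖c (α + τ + Finsupp.single k 1)‖ * monom s (α + τ)) ^ 2)) := by
    intro k hkI
    rw [Finset.mem_Ico] at hkI
    have hterm : ∀ τ ∈ (Ico n (k + 1)).finsuppAntidiag m,
        ‖c (α + τ + Finsupp.single k 1)‖ * monom (fun k => ‖z k‖) (α + τ + Finsupp.single k 1) ≤
        q ^ α.degree * (2 * κ k * y k) * ((‖c (α + τ + Finsupp.single k 1)‖ * monom s (α + τ)) *
          monom (fun j => 2 * κ j) τ) := by
      intro τ hτ
      have hτn : ∀ j ∈ τ.support, n ≤ j := fun j hj => by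
        have := (mem_finsuppAntidiag.mp hτ).2 hj
        rw [Finset.mem_Ico] at this
        exact this.1
      have hz1 : ‖z k‖ ≤ 2 * κ k * y k := by
        refine (hz k hkI.1).trans_eq ?_
        simp only [hy, if_neg (not_lt.mpr hkI.1)]
        ring
      have hz2 : monom (fun k => ‖z k‖) τ ≤ monom (fun j => 2 * κ j) τ * monom s τ := by
        rw [← monom_mul]
        refine monom_le_monom (fun _ => norm_nonneg _) fun j hj => ?_
        refine (hz j (hτn j hj)).trans_eq ?_
        simp only [hs, if_neg (not_lt.mpr (hτn j hj))]
        ring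
      have hκ2 : 0 ≤ monom (fun j => 2 * κ j) τ :=
        monom_nonneg (fun j => mul_nonneg two_pos.le (hκ0 j)) τ
      calc ‖c (α + τ + Finsupp.single k 1)‖ *
            monom (fun k => ‖z k‖) (α + τ + Finsupp.single k 1)
          = ‖c (α + τ + Finsupp.single k 1)‖ *
            ((q ^ α.degree * monom s α) * monom (fun k => ‖z k‖) τ * ‖z k‖) := by
            rw [monom_add, monom_add, monom_single, pow_one, hhead α hα]
        _ ≤ ‖c (α + τ + Finsupp.single k 1)‖ *
            ((q ^ α.degree * monom s α) * (monom (fun j => 2 * κ j) τ * monom s τ) *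
              (2 * κ k * y k)) := by
            have hsα := monom_nonneg hs0 α
            have hsτ := monom_nonneg hs0 τ
            gcongr
        _ = _ := by rw [monom_add]; ring
    have hCS := Real.sum_mul_le_sqrt_mul_sqrt ((Ico n (k + 1)).finsuppAntidiag m)
      (fun τ => ‖c (α + τ + Finsupp.single k 1)‖ * monom s (α + τ))
      (fun τ => monom (fun j => 2 * κ j) τ)
    have hsub : (Ico n (k + 1)).finsuppAntidiag m ⊆ (Ico n N).finsuppAntidiag m :=
      Finset.finsuppAntidiag_mono (Finset.Ico_subset_Ico_right (by omega)) m
    have h1 : √(∑ τ ∈ (Ico n (k + 1)).finsuppAntidiag m,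
        (‖c (α + τ + Finsupp.single k 1)‖ * monom s (α + τ)) ^ 2) ≤
        √(∑ τ ∈ (Ico n N).finsuppAntidiag m,
        (‖c (α + τ + Finsupp.single k 1)‖ * monom s (α + τ)) ^ 2) :=
      Real.sqrt_le_sqrt (Finset.sum_le_sum_of_subset_of_nonneg hsub fun _ _ _ => sq_nonneg _)
    have h2 : 2 * κ k * √(∑ τ ∈ (Ico n (k + 1)).finsuppAntidiag m,
        monom (fun j => 2 * κ j) τ ^ 2) ≤ (1 / 4) ^ m := by
      have h3 : ∑ τ ∈ (Ico n (k + 1)).finsuppAntidiag m, monom (fun j => 2 * κ j) τ ^ 2 ≤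
          (1 / 16) ^ m * √(k + 2) := by
        have h4 : ∀ τ ∈ (Ico n (k + 1)).finsuppAntidiag m,
            monom (fun j => 2 * κ j) τ ^ 2 = (1 / 16) ^ m * monom x τ := fun τ hτ => by
          rw [← degree_of_mem_finsuppAntidiag hτ, ← monom_const, ← monom_mul, sq, ← monom_mul]
          refine monom_congr fun j _ => ?_
          simp only [hx]
          ring
        rw [Finset.sum_congr rfl h4, ← Finset.mul_sum]
        refine mul_le_mul_of_nonneg_left ((hW k).trans_eq ?_) (by positivity)
        push_cast
        ring_nf
      refine abs_le_of_sq_le_sq' ?_ (by positivity) |>.2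
      rw [mul_pow, Real.sq_sqrt (Finset.sum_nonneg fun _ _ => sq_nonneg _), mul_pow]
      have h5 : √((k : ℝ) + 2) ≤ k + 2 := by
        rw [Real.sqrt_le_left (by positivity)]
        nlinarith [k.cast_nonneg (α := ℝ)]
      have hk1 : (0 : ℝ) < k + 1 := by positivity
      calc 2 ^ 2 * κ k ^ 2 * ∑ τ ∈ (Ico n (k + 1)).finsuppAntidiag m,
            monom (fun j => 2 * κ j) τ ^ 2
          ≤ 2 ^ 2 * (1 / (256 * (k + 1))) * ((1 / 16) ^ m * (k + 2)) := by
            have := hκ k hkI.1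
            have h6 := h3.trans (mul_le_mul_of_nonneg_left h5 (by positivity))
            gcongr
        _ ≤ 1 * (1 / 16) ^ m := by
            rw [mul_comm ((1 / 16 : ℝ) ^ m), ← mul_assoc]
            refine mul_le_mul_of_nonneg_right ?_ (by positivity)
            rw [← div_eq_mul_one_div, div_mul_eq_mul_div, div_le_one (by positivity)]
            nlinarith [k.cast_nonneg (α := ℝ)]
        _ = ((1 / 4) ^ m) ^ 2 := by
            rw [one_mul, ← pow_mul, mul_comm m 2, pow_mul]
            norm_num
    have hyk := hy0 k
    have hqd : 0 ≤ q ^ α.degree := by positivity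
    calc _ ≤ ∑ τ ∈ (Ico n (k + 1)).finsuppAntidiag m, q ^ α.degree * (2 * κ k * y k) *
          ((‖c (α + τ + Finsupp.single k 1)‖ * monom s (α + τ)) *
            monom (fun j => 2 * κ j) τ) := Finset.sum_le_sum hterm
      _ = q ^ α.degree * (2 * κ k * y k) * ∑ τ ∈ (Ico n (k + 1)).finsuppAntidiag m,
          ((‖c (α + τ + Finsupp.single k 1)‖ * monom s (α + τ)) *
            monom (fun j => 2 * κ j) τ) := by rw [Finset.mul_sum]
      _ ≤ q ^ α.degree * (2 * κ k * y k) * (√(∑ τ ∈ (Ico n N).finsuppAntidiag m,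
          (‖c (α + τ + Finsupp.single k 1)‖ * monom s (α + τ)) ^ 2) *
            √(∑ τ ∈ (Ico n (k + 1)).finsuppAntidiag m, monom (fun j => 2 * κ j) τ ^ 2)) := by
          have := hκ0 k
          refine mul_le_mul_of_nonneg_left (hCS.trans ?_) (by positivity)
          exact mul_le_mul_of_nonneg_right h1 (Real.sqrt_nonneg _)
      _ = q ^ α.degree * (y k * √(∑ τ ∈ (Ico n N).finsuppAntidiag m,
          (‖c (α + τ + Finsupp.single k 1)‖ * monom s (α + τ)) ^ 2)) *
          (2 * κ k * √(∑ τ ∈ (Ico n (k + 1)).finsuppAntidiag m,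
            monom (fun j => 2 * κ j) τ ^ 2)) := by ring
      _ ≤ q ^ α.degree * (y k * √(∑ τ ∈ (Ico n N).finsuppAntidiag m,
          (‖c (α + τ + Finsupp.single k 1)‖ * monom s (α + τ)) ^ 2)) * (1 / 4) ^ m :=
          mul_le_mul_of_nonneg_left h2 (by positivity)
      _ = _ := by ring
  calc _ ≤ ∑ k ∈ Ico n N, q ^ α.degree * (1 / 4) ^ m *
        (y k * √(∑ τ ∈ (Ico n N).finsuppAntidiag m,
        (‖c (α + τ + Finsupp.single k 1)‖ * monom s (α + τ)) ^ 2)) := Finset.sum_le_sum hk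
    _ ≤ q ^ α.degree * (1 / 4) ^ m * (2 ^ m * M) := by
        rw [← Finset.mul_sum]
        refine mul_le_mul_of_nonneg_left (le_trans ?_ hmain) (by positivity)
        refine Finset.sum_le_sum_of_subset_of_nonneg (fun k hk => ?_) fun k _ _ =>
          mul_nonneg (hy0 k) (Real.sqrt_nonneg _)
        rw [Finset.mem_Ico] at hk
        exact Finset.mem_range.mpr hk.2
    _ = M * q ^ α.degree * (1 / 2) ^ m := by
        have : (1 / 4 : ℝ) ^ m * 2 ^ m = (1 / 2) ^ m := by rw [← mul_pow]; norm_num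
        rw [← this]
        ring

/-- The multinomial theorem, as a bound for sums over multi-indices of fixed degree: the
reciprocals of the maxima of the monomials on the simplex are multinomial coefficients up to an
exponential factor. -/
lemma sum_antidiag_div_pow_mul_monom_le (s : Finset ℕ) (m : ℕ) {x : ℕ → ℝ} (hx : ∀ j, 0 ≤ x j) :
    ∑ τ ∈ s.finsuppAntidiag m, (monom (fun j => (τ j : ℝ) / m) τ)⁻¹ * monom x τ ≤
      (Real.exp 1 * ∑ j ∈ s, x j) ^ m := by
  have hterm : ∀ τ ∈ s.finsuppAntidiag m, (monom (fun j => (τ j : ℝ) / m) τ)⁻¹ * monom x τ ≤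
      Real.exp 1 ^ m * ((Nat.multinomial s τ : ℝ) * ∏ j ∈ s, x j ^ τ j) := by
    intro τ hτ
    obtain ⟨hsum, hsupp⟩ := mem_finsuppAntidiag.mp hτ
    have hdeg := degree_of_mem_finsuppAntidiag hτ
    rw [← monom_eq_prod hsupp x, ← mul_assoc]
    refine mul_le_mul_of_nonneg_right ?_ (monom_nonneg hx τ)
    have hD : monom (fun j => (τ j : ℝ) / m) τ = (∏ j ∈ s, (τ j : ℝ) ^ τ j) / m ^ m := by
      rw [monom_eq_prod hsupp]
      simp_rw [div_pow]
      rw [Finset.prod_div_distrib, Finset.prod_pow_eq_pow_sum, hsum]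
    have hspec : ((∏ j ∈ s, (τ j).factorial : ℕ) : ℝ) * Nat.multinomial s τ = (m.factorial : ℝ) := by
      rw [← hsum]
      exact_mod_cast Nat.multinomial_spec s τ
    have hfac : ((∏ j ∈ s, (τ j).factorial : ℕ) : ℝ) ≤ ∏ j ∈ s, (τ j : ℝ) ^ τ j := by
      push_cast
      refine Finset.prod_le_prod (fun _ _ => by positivity) fun j _ => ?_
      exact_mod_cast Nat.factorial_le_pow (τ j)
    have hexp : (m : ℝ) ^ m ≤ Real.exp 1 ^ m * m.factorial := by
      have := Real.pow_div_factorial_le_exp m (by positivity) m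
      rw [div_le_iff₀ (by positivity)] at this
      rwa [← Real.exp_nat_mul, mul_one]
    have hpos : 0 < ∏ j ∈ s, (τ j : ℝ) ^ τ j := by
      refine Finset.prod_pos fun j _ => ?_
      rcases Nat.eq_zero_or_pos (τ j) with h | h
      · simp [h]
      · positivity
    rw [hD, inv_div, div_le_iff₀ hpos]
    calc (m : ℝ) ^ m ≤ Real.exp 1 ^ m * m.factorial := hexp
      _ = Real.exp 1 ^ m * (((∏ j ∈ s, (τ j).factorial : ℕ) : ℝ) * Nat.multinomial s τ) := by
          rw [hspec]
      _ ≤ Real.exp 1 ^ m * ((∏ j ∈ s, (τ j : ℝ) ^ τ j) * Nat.multinomial s τ) := by gcongr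
      _ = _ := by ring
  refine (Finset.sum_le_sum hterm).trans_eq ?_
  rw [← Finset.mul_sum, mul_pow, Finset.sum_pow_eq_sum_piAntidiag]
  congr 1
  refine Finset.sum_bij (fun τ _ => ⇑τ) ?_ ?_ ?_ ?_
  · intro τ hτ
    obtain ⟨hsum, hsupp⟩ := mem_finsuppAntidiag.mp hτ
    rw [mem_piAntidiag]
    exact ⟨hsum, fun i hi => hsupp (Finsupp.mem_support_iff.mpr hi)⟩
  · intro τ _ σ _ h
    exact DFunLike.coe_injective h
  · intro g hg
    rw [mem_piAntidiag] at hg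
    refine ⟨Finsupp.onFinset s g hg.2, ?_, rfl⟩
    rw [mem_finsuppAntidiag]
    exact ⟨hg.1, Finsupp.support_onFinset_subset⟩
  · intro τ _
    rfl

/-- The sum of the monomials of fixed degree in variables bounded by `1 / (4 (j + 1))`, with an
additional weight at the largest index, is bounded independently of the number of variables. -/
lemma sum_antidiag_sup_mul_monom_le {x : ℕ → ℝ} {n : ℕ} (hx0 : ∀ j, 0 ≤ x j)
    (hx : ∀ j, n ≤ j → x j ≤ 1 / (4 * (j + 1))) {m : ℕ} (hm : 0 < m) (N : ℕ) :
    ∑ τ ∈ (Ico n N).finsuppAntidiag m, x (τ.support.sup id) * monom x τ ≤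
      ∑' k : ℕ, 1 / ((k : ℝ) + 1) ^ (3 / 2 : ℝ) := by
  obtain ⟨m, rfl⟩ := Nat.exists_eq_succ_of_ne_zero hm.ne'
  have hsummable : Summable fun k : ℕ => 1 / ((k : ℝ) + 1) ^ (3 / 2 : ℝ) := by
    have := (summable_nat_add_iff 1).mpr
      (Real.summable_one_div_nat_rpow.mpr (by norm_num : (1 : ℝ) < 3 / 2))
    simpa using this
  calc ∑ τ ∈ (Ico n N).finsuppAntidiag (m + 1), x (τ.support.sup id) * monom x τ
      ≤ ∑ y ∈ (Ico n N).sigma fun k => (Ico n (k + 1)).finsuppAntidiag m,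
          x (((y.2 + Finsupp.single y.1 1).support).sup id) *
            monom x (y.2 + Finsupp.single y.1 1) := by
        refine sum_le_sum_of_forall_exists (h := fun τ => x (τ.support.sup id) * monom x τ)
          (Φ := fun y : (_ : ℕ) × (ℕ →₀ ℕ) => y.2 + Finsupp.single y.1 1)
          (fun τ => mul_nonneg (hx0 _) (monom_nonneg hx0 _)) fun τ hτ => ?_
        have hsupp := (mem_finsuppAntidiag.mp hτ).2
        have hdeg := degree_of_mem_finsuppAntidiag hτ
        have hne : ¬ τ.support ⊆ range n := by
          intro h
          have : τ.support = ∅ := by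
            refine Finset.eq_empty_of_forall_notMem fun j hj => ?_
            have h1 := Finset.mem_range.mp (h hj)
            have h2 := Finset.mem_Ico.mp (hsupp hj)
            omega
          rw [Finsupp.support_eq_empty.mp this, map_zero] at hdeg
          omega
        obtain ⟨k, hk, hnk, σ, hσ, -, hτe⟩ := exists_eq_add_add_single hne
        have hz : τ.filter (· < n) = 0 := by
          refine Finsupp.ext fun j => ?_
          rw [Finsupp.coe_zero, Pi.zero_apply, Finsupp.filter_apply]
          split_ifs with h
          · by_contra h'
            have h2 := Finset.mem_Ico.mp (hsupp (Finsupp.mem_support_iff.mpr h'))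
            omega
          · rfl
        rw [hz, zero_add] at hτe
        have hσm : σ.degree = m := by
          have := congrArg Finsupp.degree hτe
          rw [map_add, Finsupp.degree_single, hdeg] at this
          omega
        refine ⟨⟨k, σ⟩, ?_, hτe.symm⟩
        rw [Finset.mem_sigma]
        rw [hσm] at hσ
        exact ⟨hsupp hk, hσ⟩
    _ ≤ ∑ k ∈ Ico n N, 1 / ((k : ℝ) + 1) ^ (3 / 2 : ℝ) := by
        rw [Finset.sum_sigma]
        refine Finset.sum_le_sum fun k hk => ?_
        have hnk := (Finset.mem_Ico.mp hk).1
        have hsup : ∀ τ ∈ (Ico n (k + 1)).finsuppAntidiag m,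
            (τ + Finsupp.single k 1).support.sup id = k := fun τ hτ => by
          refine le_antisymm (Finset.sup_le fun j hj => ?_) (Finset.le_sup (f := id) ?_)
          · rcases Finset.mem_union.mp (Finsupp.support_add hj) with h | h
            · have := Finset.mem_Ico.mp ((mem_finsuppAntidiag.mp hτ).2 h)
              simp only [id]
              omega
            · have := Finsupp.support_single_subset h
              rw [Finset.mem_singleton] at this
              exact this.le
          · simp [Finsupp.mem_support_iff]
        have h1 : ∑ τ ∈ (Ico n (k + 1)).finsuppAntidiag m,
            x ((τ + Finsupp.single k 1).support.sup id) * monom x (τ + Finsupp.single k 1) =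
            x k ^ 2 * ∑ τ ∈ (Ico n (k + 1)).finsuppAntidiag m, monom x τ := by
          rw [Finset.mul_sum]
          refine Finset.sum_congr rfl fun τ hτ => ?_
          rw [hsup τ hτ, monom_add, monom_single]
          ring
        rw [h1]
        have h2 := sum_antidiag_monom_le hx0 hx (k + 1) m
        have hk1 : (0 : ℝ) < k + 1 := by positivity
        have h3 : √(((k + 1 : ℕ) : ℝ) + 1) ≤ 2 * √((k : ℝ) + 1) := by
          rw [show (2 : ℝ) * √((k : ℝ) + 1) = √(4 * ((k : ℝ) + 1)) by
            rw [Real.sqrt_mul (by norm_num), show (4 : ℝ) = 2 ^ 2 by norm_num,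
              Real.sqrt_sq (by norm_num)]]
          refine Real.sqrt_le_sqrt ?_
          push_cast
          linarith
        have h4 : ((k : ℝ) + 1) ^ (3 / 2 : ℝ) = (k + 1) * √((k : ℝ) + 1) := by
          rw [Real.sqrt_eq_rpow, ← Real.rpow_one_add' hk1.le (by norm_num)]
          norm_num
        have hs0 : 0 < √((k : ℝ) + 1) := Real.sqrt_pos.mpr hk1
        have hs2 : √((k : ℝ) + 1) ^ 2 = k + 1 := Real.sq_sqrt hk1.le
        calc x k ^ 2 * ∑ τ ∈ (Ico n (k + 1)).finsuppAntidiag m, monom x τ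
            ≤ (1 / (4 * (k + 1))) ^ 2 * (2 * √((k : ℝ) + 1)) := by
              have h5 := hx k hnk
              exact mul_le_mul (pow_le_pow_left₀ (hx0 k) h5 2) (h2.trans h3)
                (Finset.sum_nonneg fun τ _ => monom_nonneg hx0 τ) (by positivity)
          _ ≤ 1 / ((k : ℝ) + 1) ^ (3 / 2 : ℝ) := by
              rw [h4, div_pow, one_pow, one_div_mul_eq_div,
                div_le_div_iff₀ (by positivity) (by positivity)]
              nlinarith
    _ ≤ _ := hsummable.sum_le_tsum _ fun _ _ => by positivity

/-- The vector whose coordinates are the powers `(τ_j / m) ^ (1 / r)` is in the unit ball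
of `ℓ_r`. -/
lemma norm_emb_rpow_div_le (hr' : r ≠ ∞) {s : Finset ℕ} {m : ℕ} {τ : ℕ →₀ ℕ}
    (hτ : τ ∈ s.finsuppAntidiag m) {δ : ℝ} (hδ : 0 ≤ δ) (N : ℕ) :
    ‖emb r N fun j => ((δ * ((τ j : ℝ) / m) ^ (1 / r.toReal) : ℝ) : ℂ)‖ ≤ δ := by
  have hr0 : 0 < r.toReal := ENNReal.toReal_pos (zero_lt_one.trans_le hr.out).ne' hr'
  refine lp.norm_le_of_forall_sum_le hr0 hδ fun t => ?_
  calc ∑ j ∈ t, ‖emb r N (fun j => ((δ * ((τ j : ℝ) / m) ^ (1 / r.toReal) : ℝ) : ℂ)) j‖ ^ r.toReal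
      ≤ ∑ j ∈ t, δ ^ r.toReal * ((τ j : ℝ) / m) := by
        refine Finset.sum_le_sum fun j _ => ?_
        have h0 : 0 ≤ (τ j : ℝ) / m := by positivity
        rw [emb_apply]
        split_ifs
        · rw [Complex.norm_real, Real.norm_of_nonneg (by positivity),
            Real.mul_rpow hδ (by positivity), ← Real.rpow_mul h0, one_div_mul_cancel hr0.ne',
            Real.rpow_one]
        · rw [norm_zero, Real.zero_rpow hr0.ne']
          positivity
    _ = δ ^ r.toReal * ((∑ j ∈ t, (τ j : ℝ)) / m) := by rw [← Finset.mul_sum, Finset.sum_div]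
    _ ≤ δ ^ r.toReal * 1 := by
        refine mul_le_mul_of_nonneg_left (div_le_one_of_le₀ ?_ (by positivity)) (by positivity)
        rw [← degree_of_mem_finsuppAntidiag hτ, Finsupp.degree_apply]
        push_cast
        calc ∑ j ∈ t, (τ j : ℝ) ≤ ∑ j ∈ t ∪ τ.support, (τ j : ℝ) :=
              Finset.sum_le_sum_of_subset_of_nonneg Finset.subset_union_left
                fun _ _ _ => by positivity
          _ = ∑ j ∈ τ.support, (τ j : ℝ) := by
              refine (Finset.sum_subset Finset.subset_union_right fun j _ hj => ?_).symm
              simpa using hj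
    _ = δ ^ r.toReal := mul_one _

lemma monom_rpow {x : ℕ → ℝ} (hx : ∀ i, 0 ≤ x i) (t : ℝ) (α : ℕ →₀ ℕ) :
    monom (fun i => x i ^ t) α = monom x α ^ t := by
  rw [monom, monom, Finsupp.prod, Finsupp.prod,
    ← Real.finsetProd_rpow _ _ fun i _ => pow_nonneg (hx i) _]
  exact Finset.prod_congr rfl fun i _ => Real.rpow_pow_comm (hx i) t _

/-- Monomial convergence at the product of a vector `u` of `ℓ_r` by the weights `w ^ (1 - 1 / r)`,
where `w` is small compared with `1 / j`, up to finitely many coordinates. -/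
theorem summable_of_le_rpow_weight (hr' : r ≠ ∞) {f : SeqSpace r → ℂ} {c : (ℕ →₀ ℕ) → ℂ} {M : ℝ}
    (hf : DifferentiableOn ℂ f (Metric.ball 0 1)) (hM : ∀ u ∈ Metric.ball 0 1, ‖f u‖ ≤ M)
    (hc : IsMonomialExpansion r f c) {z : ℕ → ℂ} {n : ℕ} {q δ : ℝ} (hq0 : 0 < q) (hq1 : q < 1)
    (hδ : 0 < δ) {u w : ℕ → ℝ} (hu : ∀ k, 0 ≤ u k) (hw0 : ∀ k, 0 ≤ w k) (hw : Antitone w)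
    (hwx : ∀ k, n ≤ k → 2 / δ * w k ≤ 1 / (4 * (k + 1)))
    (hz : ∀ k, n ≤ k → ‖z k‖ ≤ w k ^ (1 - 1 / r.toReal) * u k)
    (hur : ∀ N, Real.exp 1 * ∑ k ∈ Ico n N, u k ^ r.toReal ≤ δ / 2)
    (hnorm : ∀ N, ‖emb r N fun k => if k < n then z k else 0‖ / q + δ +
      ‖emb r N fun k => if k < n then 0 else (u k : ℂ)‖ < 1) :
    Summable fun α => ‖c α * seqMonomial z α‖ := by
  have hr1 : 1 ≤ r.toReal := by
    rw [← ENNReal.toReal_one]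
    exact ENNReal.toReal_mono hr' hr.out
  have hr0 : 0 < r.toReal := zero_lt_one.trans_le hr1
  set p : ℝ := 1 / r.toReal with hp
  have hp0 : 0 ≤ p := by positivity
  have hp1 : p ≤ 1 := div_le_one_of_le₀ hr1 hr0.le
  set C : ℝ := ∑' k : ℕ, 1 / ((k : ℝ) + 1) ^ (3 / 2 : ℝ) with hC
  have hC0 : 0 ≤ C := tsum_nonneg fun k => by positivity
  have hM0 : 0 ≤ M := (norm_nonneg _).trans (hM 0 (by simp))
  set y : ℕ → ℝ := fun k => if k < n then 0 else u k with hy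
  have hy0 : ∀ k, 0 ≤ y k := fun k => by
    simp only [hy]; split_ifs
    · exact le_rfl
    · exact hu k
  have hyN : ∀ N, ‖emb r N fun k => (y k : ℂ)‖ ≤
      ‖emb r N fun k => if k < n then 0 else (u k : ℂ)‖ := fun N => by
    refine norm_emb_mono fun k _ => ?_
    simp only [hy]
    split_ifs <;> simp
  -- the vector adapted to the monomials `z ^ (α + τ)` with `α` in the head and `τ` in the tail
  set s : (ℕ →₀ ℕ) → ℕ → ℕ → ℝ := fun τ m k =>
    if k < n then ‖z k‖ / q else δ * ((τ k : ℝ) / m) ^ p with hs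
  have hs0 : ∀ τ m k, 0 ≤ s τ m k := fun τ m k => by
    simp only [hs]; split_ifs <;> positivity
  have hsN : ∀ (S : Finset ℕ) (m : ℕ), ∀ τ ∈ S.finsuppAntidiag m, ∀ N,
      ‖emb r N fun k => (s τ m k : ℂ)‖ ≤
      ‖emb r N fun k => if k < n then z k else 0‖ / q + δ := fun S m τ hτ N => by
    have h1 : (emb r N fun k => (s τ m k : ℂ)) = emb r N fun k =>
        if k < n then ((‖z k‖ / q : ℝ) : ℂ) else ((δ * ((τ k : ℝ) / m) ^ p : ℝ) : ℂ) :=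
      emb_congr fun k _ => by simp only [hs]; split_ifs <;> rfl
    rw [h1, emb_head_add_tail]
    refine (norm_add_le _ _).trans (add_le_add ?_ ?_)
    · rw [div_eq_inv_mul]
      refine norm_emb_real_smul_le (inv_nonneg.mpr hq0.le) _ fun k => ?_
      split_ifs
      · rw [Complex.norm_real, Real.norm_of_nonneg (by positivity), div_eq_inv_mul]
      · simp
    · refine le_trans (norm_emb_mono fun k _ => ?_) (norm_emb_rpow_div_le hr' hτ hδ.le N)
      split_ifs
      · rw [norm_zero]
        exact norm_nonneg _
      · rfl
  have hhead : ∀ τ m, ∀ α : ℕ →₀ ℕ, α.support ⊆ range n →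
      monom (fun k => ‖z k‖) α = q ^ α.degree * monom (s τ m) α := fun τ m α hα => by
    rw [← monom_const, ← monom_mul]
    refine monom_congr fun k hk => ?_
    simp only [hs, if_pos (Finset.mem_range.mp (hα hk))]
    field_simp
  have hnormeq : ∀ α, ‖c α * seqMonomial z α‖ = ‖c α‖ * monom (fun k => ‖z k‖) α := fun α => by
    rw [norm_mul, seqMonomial_eq_monom, norm_monom]
  simp_rw [hnormeq]
  refine summable_of_forall_sum_le (n := n) (q := q) (C := M * (1 + (w 0 + δ / 2 * C)))
    (fun γ => mul_nonneg (norm_nonneg _) (monom_nonneg (fun _ => norm_nonneg _) _)) hq0.le hq1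
    (fun α hα => ?_) fun α hα m N hnN => ?_
  · have hw00 := hw0 0
    rw [hhead 0 0 α hα]
    have h0 : (0 : ℕ →₀ ℕ) ∈ (∅ : Finset ℕ).finsuppAntidiag 0 := by simp
    have h1 : ‖emb r n fun k => (s 0 0 k : ℂ)‖ < 1 := by
      have := hsN ∅ 0 0 h0 n
      have := hnorm n
      linarith [norm_nonneg (emb r n fun k => if k < n then 0 else (u k : ℂ))]
    have h2 := norm_coeff_mul_monom_le hM hc (hs0 0 0) h1 hα
    calc ‖c α‖ * (q ^ α.degree * monom (s 0 0) α) = ‖c α‖ * monom (s 0 0) α * q ^ α.degree := by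
          ring
      _ ≤ M * (1 + (w 0 + δ / 2 * C)) * q ^ α.degree := by
          refine mul_le_mul_of_nonneg_right (h2.trans (le_mul_of_one_le_right hM0 ?_))
            (by positivity)
          nlinarith
  -- `X τ` depends only on `u` and sums up by the multinomial theorem, `Y τ` only on the weights
  set X : (ℕ →₀ ℕ) → ℝ := fun τ =>
    (monom (fun j => (τ j : ℝ) / m) τ)⁻¹ * monom (fun j => u j ^ r.toReal) τ with hX
  set Y : (ℕ →₀ ℕ) → ℝ := fun τ => w (τ.support.sup id) * monom w τ with hY
  have hX0 : ∀ τ, 0 ≤ X τ := fun τ => mul_nonneg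
    (inv_nonneg.mpr (monom_nonneg (fun j => by positivity) τ))
    (monom_nonneg (fun j => Real.rpow_nonneg (hu j) _) τ)
  have hY0 : ∀ τ, 0 ≤ Y τ := fun τ => mul_nonneg (hw0 _) (monom_nonneg hw0 τ)
  have hXsum : ∑ τ ∈ (Ico n N).finsuppAntidiag m, X τ ≤ (δ / 2) ^ m := by
    refine (sum_antidiag_div_pow_mul_monom_le _ m fun j => Real.rpow_nonneg (hu j) _).trans ?_
    refine pow_le_pow_left₀ (mul_nonneg (Real.exp_pos 1).le
      (Finset.sum_nonneg fun j _ => Real.rpow_nonneg (hu j) _)) (hur N) m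
  have hYsum : ∑ τ ∈ (Ico n N).finsuppAntidiag m, Y τ ≤ (δ / 2) ^ m * (w 0 + δ / 2 * C) := by
    rcases Nat.eq_zero_or_pos m with rfl | hm
    · simp only [hY, finsuppAntidiag_zero, Finset.sum_singleton, Finsupp.support_zero,
        Finset.sup_empty, monom_zero, pow_zero, mul_one, one_mul, Nat.bot_eq_zero]
      nlinarith
    · have h1 : ∀ τ ∈ (Ico n N).finsuppAntidiag m, Y τ = (δ / 2) ^ m * (δ / 2) *
          (2 / δ * w (τ.support.sup id) * monom (fun j => 2 / δ * w j) τ) := fun τ hτ => by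
        rw [monom_mul, monom_const, degree_of_mem_finsuppAntidiag hτ]
        have h2 : (δ / 2) ^ m * (2 / δ) ^ m = 1 := by
          rw [← mul_pow, div_mul_div_cancel₀ two_ne_zero, div_self hδ.ne', one_pow]
        have h3 : δ / 2 * (2 / δ) = 1 := by field_simp
        calc Y τ = ((δ / 2) ^ m * (2 / δ) ^ m) * (δ / 2 * (2 / δ)) * Y τ := by
              rw [h2, h3, one_mul, one_mul]
          _ = _ := by simp only [hY]; ring
      rw [Finset.sum_congr rfl h1, ← Finset.mul_sum, mul_assoc]
      refine mul_le_mul_of_nonneg_left ?_ (by positivity)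
      have h4 := sum_antidiag_sup_mul_monom_le (x := fun j => 2 / δ * w j)
        (fun j => mul_nonneg (by positivity) (hw0 j)) hwx hm N
      have := mul_le_mul_of_nonneg_left h4 (by positivity : 0 ≤ δ / 2)
      linarith [hw0 0]
  have hterm : ∀ τ ∈ (Ico n N).finsuppAntidiag m, ∀ k ∈ Ico n N, (∀ j ∈ τ.support, j ≤ k) →
      ‖c (α + τ + Finsupp.single k 1)‖ * monom (fun k => ‖z k‖) (α + τ + Finsupp.single k 1) ≤
      q ^ α.degree * (δ ^ m)⁻¹ * (X τ ^ p * Y τ ^ (1 - p)) *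
        (y k * ‖c (α + τ + Finsupp.single k 1)‖ * monom (s τ m) (α + τ)) := by
    intro τ hτ k hk hτk
    have hkn : n ≤ k := (Finset.mem_Ico.mp hk).1
    have hτn : ∀ j ∈ τ.support, n ≤ j := fun j hj =>
      (Finset.mem_Ico.mp ((mem_finsuppAntidiag.mp hτ).2 hj)).1
    have hwσ : ∀ j, 0 ≤ w j ^ (1 - p) := fun j => Real.rpow_nonneg (hw0 j) _
    have hD : 0 < monom (fun j => (τ j : ℝ) / m) τ := by
      refine Finset.prod_pos fun j hj => pow_pos ?_ _
      have h1 : 0 < τ j := Nat.pos_of_ne_zero (Finsupp.mem_support_iff.mp hj)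
      have h2 : τ j ≤ m := by
        rw [← degree_of_mem_finsuppAntidiag hτ]
        exact Finsupp.le_degree j τ
      have h3 : 0 < m := h1.trans_le h2
      positivity
    have hXp : X τ ^ p = ((monom (fun j => (τ j : ℝ) / m) τ) ^ p)⁻¹ * monom u τ := by
      simp only [hX]
      rw [Real.mul_rpow (inv_nonneg.mpr hD.le) (monom_nonneg (fun j => Real.rpow_nonneg (hu j) _) _),
        Real.inv_rpow hD.le, ← monom_rpow (fun j => Real.rpow_nonneg (hu j) _)]
      congr 1
      refine monom_congr fun j _ => ?_
      rw [← Real.rpow_mul (hu j), hp, mul_one_div_cancel hr0.ne', Real.rpow_one]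
    have hYσ : w k ^ (1 - p) * monom (fun j => w j ^ (1 - p)) τ ≤ Y τ ^ (1 - p) := by
      simp only [hY]
      rw [Real.mul_rpow (hw0 _) (monom_nonneg hw0 _), monom_rpow hw0]
      refine mul_le_mul_of_nonneg_right ?_ (Real.rpow_nonneg (monom_nonneg hw0 _) _)
      refine Real.rpow_le_rpow (hw0 k) (hw ?_) (by linarith)
      exact Finset.sup_le fun j hj => hτk j hj
    have hsτ : monom (s τ m) τ = δ ^ m * monom (fun j => (τ j : ℝ) / m) τ ^ p := by
      rw [← degree_of_mem_finsuppAntidiag hτ, ← monom_const,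
        ← monom_rpow (fun j => by positivity), ← monom_mul]
      refine monom_congr fun j hj => ?_
      simp only [hs, if_neg (not_lt.mpr (hτn j hj))]
    have hzτ : monom (fun k => ‖z k‖) τ ≤ monom (fun j => w j ^ (1 - p)) τ * monom u τ := by
      rw [← monom_mul]
      exact monom_le_monom (fun _ => norm_nonneg _) fun j hj => hz j (hτn j hj)
    have hyk : y k = u k := by simp only [hy, if_neg (not_lt.mpr hkn)]
    have hsα := monom_nonneg (hs0 τ m) α
    have huτ := monom_nonneg hu τ
    have hwτ := monom_nonneg hwσ τ
    have hwk := hwσ k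
    have huk := hu k
    calc ‖c (α + τ + Finsupp.single k 1)‖ *
          monom (fun k => ‖z k‖) (α + τ + Finsupp.single k 1)
        = ‖c (α + τ + Finsupp.single k 1)‖ *
          ((q ^ α.degree * monom (s τ m) α) * monom (fun k => ‖z k‖) τ * ‖z k‖) := by
          rw [monom_add, monom_add, monom_single, pow_one, hhead τ m α hα]
      _ ≤ ‖c (α + τ + Finsupp.single k 1)‖ *
          ((q ^ α.degree * monom (s τ m) α) * (monom (fun j => w j ^ (1 - p)) τ * monom u τ) *
            (w k ^ (1 - p) * u k)) := by
          have := hz k hkn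
          gcongr
      _ = q ^ α.degree * ‖c (α + τ + Finsupp.single k 1)‖ * monom (s τ m) α * monom u τ * u k *
          (w k ^ (1 - p) * monom (fun j => w j ^ (1 - p)) τ) := by ring
      _ ≤ q ^ α.degree * ‖c (α + τ + Finsupp.single k 1)‖ * monom (s τ m) α * monom u τ * u k *
          Y τ ^ (1 - p) := mul_le_mul_of_nonneg_left hYσ (by positivity)
      _ = _ := by
          rw [hXp, hyk, monom_add, hsτ]
          have := (Real.rpow_pos_of_pos hD p).ne'
          field_simp
  have hE : ∀ τ ∈ (Ico n N).finsuppAntidiag m,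
      ∑ k ∈ Ico n N, y k * ‖c (α + τ + Finsupp.single k 1)‖ * monom (s τ m) (α + τ) ≤ M := by
    intro τ hτ
    have hsupp : (α + τ).support ⊆ range N := by
      refine Finsupp.support_add.trans (Finset.union_subset
        (hα.trans (Finset.range_mono hnN)) fun j hj => ?_)
      have := Finset.mem_Ico.mp ((mem_finsuppAntidiag.mp hτ).2 hj)
      exact Finset.mem_range.mpr this.2
    refine le_trans ?_ (sum_mul_norm_coeff_le hf hM hc (hs0 τ m) hy0
      (by linarith [hsN _ m τ hτ N, hyN N, hnorm N]) hsupp)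
    rw [← Finset.sum_mul]
    refine mul_le_mul_of_nonneg_right ?_ (monom_nonneg (hs0 τ m) _)
    refine Finset.sum_le_sum_of_subset_of_nonneg (fun k hk => ?_) fun k _ _ =>
      mul_nonneg (hy0 k) (norm_nonneg _)
    exact Finset.mem_range.mpr (Finset.mem_Ico.mp hk).2
  calc ∑ k ∈ Ico n N, ∑ τ ∈ (Ico n (k + 1)).finsuppAntidiag m,
        ‖c (α + τ + Finsupp.single k 1)‖ * monom (fun k => ‖z k‖) (α + τ + Finsupp.single k 1)
      ≤ ∑ k ∈ Ico n N, ∑ τ ∈ (Ico n N).finsuppAntidiag m,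
        q ^ α.degree * (δ ^ m)⁻¹ * (X τ ^ p * Y τ ^ (1 - p)) *
        (y k * ‖c (α + τ + Finsupp.single k 1)‖ * monom (s τ m) (α + τ)) := by
        refine Finset.sum_le_sum fun k hk => ?_
        have hkN := (Finset.mem_Ico.mp hk).2
        have hsub : (Ico n (k + 1)).finsuppAntidiag m ⊆ (Ico n N).finsuppAntidiag m :=
          Finset.finsuppAntidiag_mono (Finset.Ico_subset_Ico_right (by omega)) m
        refine (Finset.sum_le_sum fun τ hτ => hterm τ (hsub hτ) k hk fun j hj => ?_).trans
          (Finset.sum_le_sum_of_subset_of_nonneg hsub fun τ _ _ => ?_)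
        · have := Finset.mem_Ico.mp ((mem_finsuppAntidiag.mp hτ).2 hj)
          omega
        · have h1 := Real.rpow_nonneg (hX0 τ) p
          have h2 := Real.rpow_nonneg (hY0 τ) (1 - p)
          have h3 := monom_nonneg (hs0 τ m) (α + τ)
          have h4 := hy0 k
          positivity
    _ = ∑ τ ∈ (Ico n N).finsuppAntidiag m, q ^ α.degree * (δ ^ m)⁻¹ * (X τ ^ p * Y τ ^ (1 - p)) *
        ∑ k ∈ Ico n N, y k * ‖c (α + τ + Finsupp.single k 1)‖ * monom (s τ m) (α + τ) := by
        rw [Finset.sum_comm]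
        simp_rw [Finset.mul_sum]
    _ ≤ ∑ τ ∈ (Ico n N).finsuppAntidiag m, q ^ α.degree * (δ ^ m)⁻¹ * (X τ + Y τ) * M := by
        refine Finset.sum_le_sum fun τ hτ => ?_
        have h0 : X τ ^ p * Y τ ^ (1 - p) ≤ X τ + Y τ := by
          refine (Real.geom_mean_le_arith_mean2_weighted hp0 (by linarith) (hX0 τ) (hY0 τ)
            (by ring)).trans (add_le_add ?_ ?_)
          · exact mul_le_of_le_one_left (hX0 τ) hp1
          · exact mul_le_of_le_one_left (hY0 τ) (by linarith)
        have h1 := hX0 τ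
        have h2 := hY0 τ
        refine (mul_le_mul_of_nonneg_left (hE τ hτ) ?_).trans
          (mul_le_mul_of_nonneg_right (mul_le_mul_of_nonneg_left h0 (by positivity)) hM0)
        have := Real.rpow_nonneg h1 p
        have := Real.rpow_nonneg h2 (1 - p)
        positivity
    _ = q ^ α.degree * (δ ^ m)⁻¹ * M * (∑ τ ∈ (Ico n N).finsuppAntidiag m, X τ +
        ∑ τ ∈ (Ico n N).finsuppAntidiag m, Y τ) := by
        rw [← Finset.sum_add_distrib, Finset.mul_sum]
        exact Finset.sum_congr rfl fun τ _ => by ring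
    _ ≤ q ^ α.degree * (δ ^ m)⁻¹ * M * ((δ / 2) ^ m + (δ / 2) ^ m * (w 0 + δ / 2 * C)) := by
        gcongr
    _ = M * (1 + (w 0 + δ / 2 * C)) * q ^ α.degree * (1 / 2) ^ m := by
        have : (δ ^ m)⁻¹ * (δ / 2) ^ m = (1 / 2) ^ m := by
          rw [← inv_pow, ← mul_pow]
          congr 1
          field_simp
        rw [← this]
        ring

lemma eventually_sum_Ico_le {x : ℕ → ℝ} (hx0 : ∀ k, 0 ≤ x k) (hx : Summable x) {ε : ℝ}
    (hε : 0 < ε) : ∀ᶠ n in Filter.atTop, ∀ N, ∑ k ∈ Ico n N, x k ≤ ε := by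
  have h1 : ∀ᶠ n in Filter.atTop, ∑' k, x k - ε < ∑ k ∈ range n, x k :=
    hx.hasSum.tendsto_sum_nat.eventually_const_lt (by linarith)
  filter_upwards [h1] with n hn N
  rcases le_total n N with h | h
  · have h2 := Finset.sum_range_add_sum_Ico x h
    have h3 := hx.sum_le_tsum (range N) fun k _ => hx0 k
    linarith
  · rw [Finset.Ico_eq_empty_of_le h, Finset.sum_empty]
    exact hε.le

lemma norm_emb_tail_le (hr' : r ≠ ∞) {v : ℕ → ℝ} (hv0 : ∀ k, 0 ≤ v k) {n N : ℕ} {ε : ℝ}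
    (hε : 0 ≤ ε) (h : ∑ k ∈ Ico n N, v k ^ r.toReal ≤ ε ^ r.toReal) :
    ‖emb r N fun k => if k < n then 0 else (v k : ℂ)‖ ≤ ε := by
  have hr0 : 0 < r.toReal := ENNReal.toReal_pos (zero_lt_one.trans_le hr.out).ne' hr'
  refine lp.norm_le_of_forall_sum_le hr0 hε fun t => le_trans ?_ h
  have h1 : ∀ k ∈ t, ‖emb r N (fun k => if k < n then 0 else (v k : ℂ)) k‖ ^ r.toReal =
      if k ∈ Ico n N then v k ^ r.toReal else 0 := fun k _ => by
    rw [emb_apply]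
    by_cases h2 : k ∈ Ico n N
    · have h3 := Finset.mem_Ico.mp h2
      rw [if_pos h2, if_pos h3.2, if_neg (not_lt.mpr h3.1), Complex.norm_real,
        Real.norm_of_nonneg (hv0 k)]
    · rw [if_neg h2]
      have h4 : (if k < N then (if k < n then 0 else (v k : ℂ)) else 0) = 0 := by
        rw [Finset.mem_Ico] at h2
        split_ifs
        · rfl
        · omega
        · rfl
      rw [h4, norm_zero, Real.zero_rpow hr0.ne']
  rw [Finset.sum_congr rfl h1, ← Finset.sum_filter]
  refine Finset.sum_le_sum_of_subset_of_nonneg (fun k hk => (Finset.mem_filter.mp hk).2)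
    fun k _ _ => Real.rpow_nonneg (hv0 k) _

lemma eventually_norm_emb_tail_le (hr' : r ≠ ∞) {v : ℕ → ℝ} (hv0 : ∀ k, 0 ≤ v k)
    (hv : Summable fun k => v k ^ r.toReal) {ε : ℝ} (hε : 0 < ε) :
    ∀ᶠ n in Filter.atTop, ∀ N, ‖emb r N fun k => if k < n then 0 else (v k : ℂ)‖ ≤ ε := by
  filter_upwards [eventually_sum_Ico_le (fun k => Real.rpow_nonneg (hv0 k) _) hv
    (Real.rpow_pos_of_pos hε r.toReal)] with n hn N
  exact norm_emb_tail_le hr' hv0 hε.le (hn N)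

lemma norm_emb_head_le {u : SeqSpace r} (n N : ℕ) :
    ‖emb r N fun k => if k < n then u k else 0‖ ≤ ‖u‖ :=
  norm_emb_le fun k _ => by split_ifs <;> simp

/-- Points of `ℓ_r` whose entries are bounded by the product of weights `κ = o(j ^ (-1/2))` and of
a vector with small tails in `ℓ_r` are points of monomial convergence. -/
theorem mem_monHInfty_of_sqrt_weight {z : ℕ → ℂ} (hz : z ∈ seqBall r) {v κ : ℕ → ℝ}
    (hv0 : ∀ k, 0 ≤ v k) (hκ0 : ∀ k, 0 ≤ κ k)
    (hκ : Filter.Tendsto (fun k : ℕ => κ k ^ 2 * (k + 1)) Filter.atTop (𝓝 0))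
    (hzv : ∀ k, ‖z k‖ ≤ κ k * v k)
    (hv : ∀ ε > 0, ∀ᶠ n in Filter.atTop, ∀ N,
      ‖emb r N fun k => if k < n then 0 else (v k : ℂ)‖ ≤ ε) :
    z ∈ monHInfty r := by
  refine ⟨hz, fun f hf => ?_⟩
  obtain ⟨hf, M, hM⟩ := hf
  obtain ⟨c, hc⟩ := exists_isMonomialExpansion hf
  obtain ⟨u, hu, rfl⟩ := hz
  set q : ℝ := (1 + ‖u‖) / 2 with hq
  -- dividing the head of `u` by `q > ‖u‖` leaves room for a small tail in the unit ball
  have hq0 : 0 < q := by positivity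
  have hq1 : q < 1 := by linarith
  have huq : ‖u‖ / q < 1 := (div_lt_one hq0).mpr (by linarith)
  have hκ' : ∀ᶠ k : ℕ in Filter.atTop, κ k ^ 2 * (k + 1) < 1 / 256 :=
    hκ.eventually_lt_const (by norm_num)
  obtain ⟨n, hn1, hn2⟩ := ((Filter.eventually_forall_ge_atTop.mpr hκ').and
    (hv ((1 - ‖u‖ / q) / 2) (by linarith))).exists
  refine ⟨c, hc, summable_of_le_sqrt_weight hf hM hc (n := n) hq0 hq1 hv0 hκ0 (fun k hk => ?_)
    (fun k _ => hzv k) fun N => ?_⟩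
  · have := hn1 k hk
    rw [le_div_iff₀ (by positivity)]
    linarith
  · have h1 := hn2 N
    have h2 : ‖emb r N fun k => if k < n then u k else 0‖ / q ≤ ‖u‖ / q :=
      div_le_div_of_nonneg_right (norm_emb_head_le n N) hq0.le
    linarith

/-- Points of `ℓ_r` whose entries are bounded by the product of the weights `w ^ (1 - 1 / r)`, where
`w = o(1 / j)`, and of a vector of `ℓ_r` are points of monomial convergence. -/
theorem mem_monHInfty_of_rpow_weight (hr' : r ≠ ∞) {z : ℕ → ℂ} (hz : z ∈ seqBall r) {v w : ℕ → ℝ}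
    (hv0 : ∀ k, 0 ≤ v k) (hw0 : ∀ k, 0 ≤ w k) (hw : Antitone w)
    (hwk : Filter.Tendsto (fun k : ℕ => w k * (k + 1)) Filter.atTop (𝓝 0))
    (hzv : ∀ k, ‖z k‖ ≤ w k ^ (1 - 1 / r.toReal) * v k)
    (hv : Summable fun k => v k ^ r.toReal) :
    z ∈ monHInfty r := by
  refine ⟨hz, fun f hf => ?_⟩
  obtain ⟨hf, M, hM⟩ := hf
  obtain ⟨c, hc⟩ := exists_isMonomialExpansion hf
  obtain ⟨u, hu, rfl⟩ := hz
  set q : ℝ := (1 + ‖u‖) / 2 with hq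
  -- dividing the head of `u` by `q > ‖u‖` leaves room for a small tail in the unit ball
  have hq0 : 0 < q := by positivity
  have hq1 : q < 1 := by linarith
  have huq : ‖u‖ / q < 1 := (div_lt_one hq0).mpr (by linarith)
  set δ : ℝ := (1 - ‖u‖ / q) / 3 with hδ
  have hδ0 : 0 < δ := by simp only [hδ]; linarith
  have hw' : ∀ᶠ k : ℕ in Filter.atTop, w k * (k + 1) < δ / 8 :=
    hwk.eventually_lt_const (by positivity)
  have he := Real.exp_pos 1
  obtain ⟨n, hn1, hn2, hn3⟩ := ((Filter.eventually_forall_ge_atTop.mpr hw').and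
    ((eventually_norm_emb_tail_le hr' hv0 hv hδ0).and
    (eventually_sum_Ico_le (fun k => Real.rpow_nonneg (hv0 k) _) hv
      (by positivity : 0 < δ / 2 / Real.exp 1)))).exists
  refine ⟨c, hc, summable_of_le_rpow_weight hr' hf hM hc (n := n) hq0 hq1 hδ0 hv0 hw0 hw
    (fun k hk => ?_) (fun k _ => hzv k) (fun N => ?_) fun N => ?_⟩
  · have := hn1 k hk
    rw [le_div_iff₀ (by positivity), div_mul_eq_mul_div, div_mul_eq_mul_div, div_le_one hδ0]
    linarith
  · have := hn3 N
    rw [le_div_iff₀ he] at this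
    linarith
  · have h1 := hn2 N
    have h2 : ‖emb r N fun k => if k < n then u k else 0‖ / q ≤ ‖u‖ / q :=
      div_le_div_of_nonneg_right (norm_emb_head_le n N) hq0.le
    have h3 : ‖u‖ / q = 1 - 3 * δ := by simp only [hδ]; ring
    linarith

/-! ### Logarithmic weights -/

lemma one_lt_log_add_three (k : ℕ) : 1 < Real.log ((k : ℝ) + 3) := by
  rw [Real.lt_log_iff_exp_lt (by positivity)]
  linarith [Real.exp_one_lt_three, k.cast_nonneg (α := ℝ)]

lemma tendsto_log_add_three_rpow_neg {θ : ℝ} (hθ : 0 < θ) :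
    Filter.Tendsto (fun k : ℕ => Real.log ((k : ℝ) + 3) ^ (-θ)) Filter.atTop (𝓝 0) :=
  (tendsto_rpow_neg_atTop hθ).comp (Real.tendsto_log_atTop.comp
    (Filter.tendsto_atTop_add_const_right _ _ tendsto_natCast_atTop_atTop))

lemma antitone_log_add_three_rpow_neg {θ : ℝ} (hθ : 0 ≤ θ) :
    Antitone fun k : ℕ => Real.log ((k : ℝ) + 3) ^ (-θ) := fun k l h => by
  have := one_lt_log_add_three k
  exact Real.rpow_le_rpow_of_nonpos (by linarith)
    (Real.log_le_log (by positivity) (by gcongr)) (by linarith)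

lemma logSeq_eq (a b : ℝ) (k : ℕ) :
    logSeq a b k = (((k : ℝ) + 1) ^ (-a) * Real.log ((k : ℝ) + 3) ^ (-b) : ℝ) := by
  have := one_lt_log_add_three k
  rw [logSeq, logWeight]
  push_cast
  rw [show (k : ℝ) + 1 + 2 = k + 3 by ring, Real.rpow_neg (by positivity),
    Real.rpow_neg (by linarith)]
  push_cast
  rw [one_div, mul_inv]

lemma norm_logSeq (a b : ℝ) (k : ℕ) :
    ‖logSeq a b k‖ = ((k : ℝ) + 1) ^ (-a) * Real.log ((k : ℝ) + 3) ^ (-b) := by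
  have := one_lt_log_add_three k
  rw [logSeq_eq, Complex.norm_real, Real.norm_of_nonneg]
  exact mul_nonneg (by positivity) (Real.rpow_nonneg (by linarith) _)

lemma norm_logSeq_le_one {a b : ℝ} (ha : 0 ≤ a) (hb : 0 ≤ b) (k : ℕ) : ‖logSeq a b k‖ ≤ 1 := by
  have := one_lt_log_add_three k
  rw [norm_logSeq]
  exact mul_le_one₀ (Real.rpow_le_one_of_one_le_of_nonpos (by simp) (by linarith))
    (Real.rpow_nonneg (by linarith) _)
    (Real.rpow_le_one_of_one_le_of_nonpos this.le (by linarith))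

lemma mul_mem_seqBall {a u : ℕ → ℂ} (ha : ∀ k, ‖a k‖ ≤ 1) (hu : u ∈ seqBall r) :
    a * u ∈ seqBall r := by
  obtain ⟨u, hu, rfl⟩ := hu
  have h : ∀ k, ‖(a * (u : ℕ → ℂ)) k‖ ≤ ‖u k‖ := fun k => by
    rw [Pi.mul_apply, norm_mul]
    exact mul_le_of_le_one_left (norm_nonneg _) (ha k)
  have hmem : Memℓp (a * (u : ℕ → ℂ)) r := (lp.memℓp u).mono' h
  exact ⟨⟨_, hmem⟩, (lp.norm_mono (zero_lt_one.trans_le hr.out).ne' h).trans_lt hu, rfl⟩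

/-- The series of the reciprocals of `k (log k) ^ b` converges for `b > 1`, by Cauchy
condensation. -/
lemma summable_inv_mul_log_rpow_neg {b : ℝ} (hb : 1 < b) :
    Summable fun k : ℕ => ((k : ℝ) + 1) ^ (-1 : ℝ) * Real.log ((k : ℝ) + 3) ^ (-b) := by
  have hlog := one_lt_log_add_three
  have hanti := antitone_log_add_three_rpow_neg (by linarith : 0 ≤ b)
  have h0 : ∀ k : ℕ, 0 ≤ Real.log ((k : ℝ) + 3) ^ (-b) := fun k =>
    Real.rpow_nonneg (by linarith [hlog k]) _
  rw [← summable_condensed_iff_of_nonneg (fun k => mul_nonneg (by positivity) (h0 k))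
    fun m n _ h => mul_le_mul (Real.rpow_le_rpow_of_nonpos (by positivity) (by gcongr)
      (by norm_num)) (hanti h) (h0 n) (by positivity)]
  have hl2 : 0 < Real.log 2 := Real.log_pos one_lt_two
  have hmaj : Summable fun k : ℕ => Real.log 2 ^ (-b) * (k : ℝ) ^ (-b) :=
    (Real.summable_nat_rpow.mpr (by linarith)).mul_left _
  refine Summable.of_norm_bounded_eventually_nat hmaj ?_
  filter_upwards [Filter.eventually_gt_atTop 0] with k hk
  have hk' : (0 : ℝ) < k := by exact_mod_cast hk
  rw [Real.norm_of_nonneg (mul_nonneg (by positivity) (mul_nonneg (by positivity) (h0 _))),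
    ← mul_assoc, ← Real.mul_rpow hl2.le hk'.le]
  push_cast
  have h1 : (2 : ℝ) ^ k * ((2 : ℝ) ^ k + 1) ^ (-1 : ℝ) ≤ 1 := by
    rw [Real.rpow_neg_one, ← div_eq_mul_inv, div_le_one (by positivity)]
    linarith
  have h2 : Real.log ((2 : ℝ) ^ k + 3) ^ (-b) ≤ (Real.log 2 * k) ^ (-b) := by
    refine Real.rpow_le_rpow_of_nonpos (by positivity) ?_ (by linarith)
    rw [mul_comm, ← Real.log_pow]
    exact Real.log_le_log (by positivity) (by linarith)
  have h3 : (0 : ℝ) ≤ Real.log ((2 : ℝ) ^ k + 3) ^ (-b) := by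
    have := h0 (2 ^ k)
    push_cast at this
    exact this
  calc _ ≤ 1 * (Real.log 2 * k) ^ (-b) := mul_le_mul h1 h2 h3 zero_le_one
    _ = _ := one_mul _

lemma recip_eq (r : ℝ≥0∞) : recip r = r.toReal⁻¹ := by rw [recip, ENNReal.toReal_inv]

lemma one_le_toReal (hr' : r ≠ ∞) : 1 ≤ r.toReal := by
  rw [← ENNReal.toReal_one]
  exact ENNReal.toReal_mono hr' hr.out

lemma sigmaExp_of_le_two {r : ℝ≥0∞} (h : r ≤ 2) : sigmaExp r = 1 - 1 / r.toReal := by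
  rw [sigmaExp, min_eq_left h, recip_eq, one_div]

lemma sigmaExp_of_two_le {r : ℝ≥0∞} (h : 2 ≤ r) : sigmaExp r = 1 / 2 := by
  rw [sigmaExp, min_eq_right h, recip_eq]
  norm_num

lemma summable_weight_rpow (hr' : r ≠ ∞) {b c : ℝ} (hb : recip r < b) (hc : 0 ≤ c) :
    Summable fun k : ℕ => (c * (((k : ℝ) + 1) ^ (-recip r) *
      Real.log ((k : ℝ) + 3) ^ (-b))) ^ r.toReal := by
  have hr1 := one_le_toReal hr'
  have hr0 : 0 < r.toReal := by linarith
  rw [recip_eq, inv_lt_iff_one_lt_mul₀' hr0] at hb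
  refine ((summable_inv_mul_log_rpow_neg hb).mul_left (c ^ r.toReal)).congr fun k => ?_
  have h1 := one_lt_log_add_three k
  have h2 : 0 ≤ Real.log ((k : ℝ) + 3) := by linarith
  rw [Real.mul_rpow hc (mul_nonneg (by positivity) (Real.rpow_nonneg h2 _)),
    Real.mul_rpow (by positivity) (Real.rpow_nonneg h2 _), ← Real.rpow_mul (by positivity),
    ← Real.rpow_mul h2, recip_eq]
  congr 3
  · field_simp
  · ring

/-- Any positive power of the logarithm suffices in the weight when `r ≤ 2`. -/
theorem logSeq_mul_mem_monHInfty_of_le_two (h2 : r ≤ 2) {θ : ℝ} (hθ : 0 < θ) {u : ℕ → ℂ}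
    (hu : u ∈ seqBall r) : logSeq (sigmaExp r) (θ * sigmaExp r) * u ∈ monHInfty r := by
  have hr' : r ≠ ∞ := ne_top_of_le_ne_top (by simp) h2
  have hr1 := one_le_toReal hr'
  have hσ : 0 ≤ sigmaExp r := by
    rw [sigmaExp_of_le_two h2, sub_nonneg]
    exact div_le_one_of_le₀ hr1 (by linarith)
  have hlog := one_lt_log_add_three
  have hanti := antitone_log_add_three_rpow_neg hθ.le
  have hz := mul_mem_seqBall (fun k => norm_logSeq_le_one hσ (mul_nonneg hθ.le hσ) k) hu
  obtain ⟨u, -, rfl⟩ := hu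
  refine mem_monHInfty_of_rpow_weight hr' hz (v := fun k => ‖u k‖)
    (w := fun k => ((k : ℝ) + 1) ^ (-1 : ℝ) * Real.log ((k : ℝ) + 3) ^ (-θ))
    (fun k => norm_nonneg _) (fun k => ?_) (fun m n h => ?_) ?_ (fun k => le_of_eq ?_) ?_
  · exact mul_nonneg (by positivity) (Real.rpow_nonneg (by linarith [hlog k]) _)
  · exact mul_le_mul (Real.rpow_le_rpow_of_nonpos (by positivity) (by gcongr) (by norm_num))
      (hanti h) (Real.rpow_nonneg (by linarith [hlog n]) _) (by positivity)
  · refine (tendsto_log_add_three_rpow_neg hθ).congr fun k => ?_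
    rw [Real.rpow_neg_one]
    field_simp
  · have h3 : 0 ≤ Real.log ((k : ℝ) + 3) := by linarith [hlog k]
    rw [Pi.mul_apply, norm_mul, norm_logSeq, ← sigmaExp_of_le_two h2,
      Real.mul_rpow (by positivity) (Real.rpow_nonneg h3 _), ← Real.rpow_mul (by positivity),
      ← Real.rpow_mul h3]
    ring_nf
  · exact (lp.memℓp u).summable (by linarith)

/-- For `r ≤ 2` the condition `β > 1 / r` suffices; it is weaker than `β > 1 / (2 r) + 1 / 2`. -/
theorem smul_logSeq_mem_monHInfty_of_le_two (h2 : r ≤ 2) {β c : ℝ} (hβ : recip r < β) (hc : 0 < c)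
    (hz : (c : ℂ) • logSeq (recip r + sigmaExp r) β ∈ seqBall r) :
    (c : ℂ) • logSeq (recip r + sigmaExp r) β ∈ monHInfty r := by
  have hr' : r ≠ ∞ := ne_top_of_le_ne_top (by simp) h2
  have hr1 := one_le_toReal hr'
  have hp : recip r = 1 / r.toReal := by rw [recip_eq, one_div]
  have hp0 : 0 ≤ recip r := by rw [hp]; positivity
  have hσ := sigmaExp_of_le_two h2
  rw [← hp] at hσ
  -- half of the excess of `β` over `1 / r` goes to the weight, the rest keeps `v` in `ℓ_r`
  set θ : ℝ := (β - recip r) / 2 with hθ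
  have hθ0 : 0 < θ := by simp only [hθ]; linarith
  have hlog := one_lt_log_add_three
  have hanti := antitone_log_add_three_rpow_neg hθ0.le
  refine mem_monHInfty_of_rpow_weight hr' hz
    (v := fun k => c * (((k : ℝ) + 1) ^ (-recip r) *
      Real.log ((k : ℝ) + 3) ^ (-(β - θ * sigmaExp r))))
    (w := fun k => ((k : ℝ) + 1) ^ (-1 : ℝ) * Real.log ((k : ℝ) + 3) ^ (-θ))
    (fun k => ?_) (fun k => ?_) (fun m n h => ?_) ?_ (fun k => le_of_eq ?_) ?_
  · exact mul_nonneg hc.le (mul_nonneg (by positivity) (Real.rpow_nonneg (by linarith [hlog k]) _))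
  · exact mul_nonneg (by positivity) (Real.rpow_nonneg (by linarith [hlog k]) _)
  · exact mul_le_mul (Real.rpow_le_rpow_of_nonpos (by positivity) (by gcongr) (by norm_num))
      (hanti h) (Real.rpow_nonneg (by linarith [hlog n]) _) (by positivity)
  · refine (tendsto_log_add_three_rpow_neg hθ0).congr fun k => ?_
    rw [Real.rpow_neg_one]
    field_simp
  · have h3 : 0 < Real.log ((k : ℝ) + 3) := by linarith [hlog k]
    have hk : (0 : ℝ) < k + 1 := by positivity
    rw [Pi.smul_apply, norm_smul, norm_logSeq, Complex.norm_real, Real.norm_of_nonneg hc.le,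
      ← hp, ← hσ, Real.mul_rpow (by positivity) (Real.rpow_nonneg h3.le _),
      ← Real.rpow_mul hk.le, ← Real.rpow_mul h3.le,
      show -(recip r + sigmaExp r) = -1 * sigmaExp r + -recip r by ring, Real.rpow_add hk,
      show -β = -θ * sigmaExp r + -(β - θ * sigmaExp r) by ring, Real.rpow_add h3]
    ring
  · refine summable_weight_rpow hr' ?_ hc.le
    rw [hσ]
    nlinarith

theorem logSeq_mul_mem_monHInfty_of_two_le (h2 : 2 ≤ r) {θ : ℝ} (hθ : 0 < θ) {u : ℕ → ℂ}
    (hu : u ∈ seqBall r) : logSeq (sigmaExp r) θ * u ∈ monHInfty r := by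
  have hσ := sigmaExp_of_two_le h2
  have hlog := one_lt_log_add_three
  have hθ2 : 0 < θ / 2 := by positivity
  have hanti := antitone_log_add_three_rpow_neg hθ2.le
  have hσ0 : 0 ≤ sigmaExp r := by rw [hσ]; norm_num
  have hz := mul_mem_seqBall (fun k => norm_logSeq_le_one hσ0 hθ.le k) hu
  obtain ⟨u, hu1, rfl⟩ := hu
  have hL : ∀ k : ℕ, 0 ≤ Real.log ((k : ℝ) + 3) ^ (-(θ / 2)) := fun k =>
    Real.rpow_nonneg (by linarith [hlog k]) _
  refine mem_monHInfty_of_sqrt_weight hz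
    (v := fun k => Real.log ((k : ℝ) + 3) ^ (-(θ / 2)) * ‖u k‖)
    (κ := fun k => ((k : ℝ) + 1) ^ (-(1 / 2) : ℝ) * Real.log ((k : ℝ) + 3) ^ (-(θ / 2)))
    (fun k => mul_nonneg (hL k) (norm_nonneg _)) (fun k => mul_nonneg (by positivity) (hL k))
    ?_ (fun k => le_of_eq ?_) fun ε hε => ?_
  · refine (tendsto_log_add_three_rpow_neg hθ).congr fun k => ?_
    have h3 : 0 < Real.log ((k : ℝ) + 3) := by linarith [hlog k]
    have hk : (0 : ℝ) < k + 1 := by positivity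
    rw [mul_pow, ← Real.rpow_mul_natCast hk.le, ← Real.rpow_mul_natCast h3.le]
    norm_num
    rw [Real.rpow_neg_one]
    field_simp
  · have h3 : 0 < Real.log ((k : ℝ) + 3) := by linarith [hlog k]
    rw [Pi.mul_apply, norm_mul, norm_logSeq, hσ, show -θ = -(θ / 2) + -(θ / 2) by ring,
      Real.rpow_add h3]
    ring
  · filter_upwards [(tendsto_log_add_three_rpow_neg hθ2).eventually_lt_const hε] with n hn N
    calc _ ≤ Real.log ((n : ℝ) + 3) ^ (-(θ / 2)) * ‖emb r N u‖ := by
          refine norm_emb_real_smul_le (hL n) _ fun k => ?_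
          split_ifs with hk
          · rw [norm_zero]
            exact mul_nonneg (hL n) (norm_nonneg _)
          · rw [Complex.norm_real, Real.norm_of_nonneg (mul_nonneg (hL k) (norm_nonneg _))]
            exact mul_le_mul_of_nonneg_right (hanti (not_lt.mp hk)) (norm_nonneg _)
      _ ≤ ε * 1 := mul_le_mul hn.le ((norm_emb_le fun j _ => le_rfl).trans hu1.le)
          (norm_nonneg _) hε.le
      _ = ε := mul_one ε

theorem smul_logSeq_mem_monHInfty_of_two_le (h2 : 2 ≤ r) {β c : ℝ} (hβ : recip r < β) (hc : 0 < c)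
    (hz : (c : ℂ) • logSeq (recip r + sigmaExp r) β ∈ seqBall r) :
    (c : ℂ) • logSeq (recip r + sigmaExp r) β ∈ monHInfty r := by
  have hσ := sigmaExp_of_two_le h2
  -- half of the excess of `β` over `1 / r` goes to the weight, the rest keeps `v` in `ℓ_r`
  set θ : ℝ := (β - recip r) / 2 with hθ
  have hθ0 : 0 < θ := by simp only [hθ]; linarith
  have hlog := one_lt_log_add_three
  have hL : ∀ (t : ℝ) (k : ℕ), 0 ≤ Real.log ((k : ℝ) + 3) ^ t := fun t k =>
    Real.rpow_nonneg (by linarith [hlog k]) _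
  have hv0 : ∀ k : ℕ, 0 ≤ c * (((k : ℝ) + 1) ^ (-recip r) *
      Real.log ((k : ℝ) + 3) ^ (-(β - θ))) := fun k =>
    mul_nonneg hc.le (mul_nonneg (by positivity) (hL _ k))
  refine mem_monHInfty_of_sqrt_weight hz
    (v := fun k => c * (((k : ℝ) + 1) ^ (-recip r) * Real.log ((k : ℝ) + 3) ^ (-(β - θ))))
    (κ := fun k => ((k : ℝ) + 1) ^ (-(1 / 2) : ℝ) * Real.log ((k : ℝ) + 3) ^ (-θ))
    hv0 (fun k => mul_nonneg (by positivity) (hL _ k)) ?_ (fun k => le_of_eq ?_) fun ε hε => ?_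
  · refine (tendsto_log_add_three_rpow_neg (by positivity : 0 < θ * 2)).congr fun k => ?_
    have h3 : 0 < Real.log ((k : ℝ) + 3) := by linarith [hlog k]
    have hk : (0 : ℝ) < k + 1 := by positivity
    rw [mul_pow, ← Real.rpow_mul_natCast hk.le, ← Real.rpow_mul_natCast h3.le]
    norm_num
    rw [Real.rpow_neg_one]
    field_simp
  · have h3 : 0 < Real.log ((k : ℝ) + 3) := by linarith [hlog k]
    have hk : (0 : ℝ) < k + 1 := by positivity
    rw [Pi.smul_apply, norm_smul, norm_logSeq, Complex.norm_real, Real.norm_of_nonneg hc.le, hσ,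
      show -(recip r + 1 / 2) = -(1 / 2) + -recip r by ring, Real.rpow_add hk,
      show -β = -θ + -(β - θ) by ring, Real.rpow_add h3]
    ring
  · by_cases hr' : r = ∞
    · subst hr'
      have hp : recip ∞ = 0 := by simp [recip]
      have hb : 0 < β - θ := by
        rw [hp] at hβ hθ
        linarith
      have hanti := antitone_log_add_three_rpow_neg hb.le
      have ht := (tendsto_log_add_three_rpow_neg hb).const_mul c
      rw [mul_zero] at ht
      filter_upwards [ht.eventually_lt_const hε] with n hn N
      refine lp.norm_le_of_forall_le hε.le fun k => ?_
      rw [emb_apply]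
      split_ifs with h3 h4
      · simpa using hε.le
      · rw [Complex.norm_real, Real.norm_of_nonneg (hv0 k), hp, neg_zero, Real.rpow_zero, one_mul]
        exact (mul_le_mul_of_nonneg_left (hanti (not_lt.mp h4)) hc.le).trans hn.le
      · simpa using hε.le
    · exact eventually_norm_emb_tail_le hr' hv0
        (summable_weight_rpow hr' (by linarith) hc.le) hε

/-! ### Multilinear forms with random signs -/

/-- Among all choices of signs, one makes all the given finitely many sums small: the exponential
moments of a random signed sum are Gaussian. -/
lemma exists_signs_abs_sum_le {S τ : Type*} [Fintype S] [DecidableEq S] (T : Finset τ)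
    (a : τ → S → ℝ) (ha : ∀ t ∈ T, ∑ s, a t s ^ 2 ≤ 1) :
    ∃ ε : S → ℝ, (∀ s, |ε s| = 1) ∧
      ∀ t ∈ T, |∑ s, ε s * a t s| ≤ Real.log (2 * #T) + 1 := by
  set E : Finset (S → ℝ) := Fintype.piFinset fun _ => {1, -1} with hE
  have hEcard : (#E : ℝ) = 2 ^ Fintype.card S := by
    rw [hE, Fintype.card_piFinset]
    rw [Finset.prod_const, Finset.card_pair (by norm_num)]
    simp
  have hEne : E.Nonempty := ⟨fun _ => 1, by simp [hE]⟩
  have hmom : ∀ t ∈ T, ∀ b : ℝ, b ^ 2 = 1 →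
      ∑ ε ∈ E, Real.exp (b * ∑ s, ε s * a t s) ≤ #E * Real.exp (1 / 2) := by
    intro t ht b hb
    have h1 : ∀ ε : S → ℝ, Real.exp (b * ∑ s, ε s * a t s) =
        ∏ s, Real.exp (ε s * (b * a t s)) := fun ε => by
      rw [← Real.exp_sum, Finset.mul_sum]
      congr 1
      exact Finset.sum_congr rfl fun s _ => by ring
    simp_rw [h1]
    rw [hE, Finset.sum_prod_piFinset {1, -1} fun s x => Real.exp (x * (b * a t s)), ← hE, hEcard]
    calc ∏ s, ∑ x ∈ ({1, -1} : Finset ℝ), Real.exp (x * (b * a t s))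
        ≤ ∏ s, 2 * Real.exp ((a t s) ^ 2 / 2) := by
          refine Finset.prod_le_prod (fun s _ => Finset.sum_nonneg fun x _ => (Real.exp_pos _).le)
            fun s _ => ?_
          rw [Finset.sum_pair (by norm_num), one_mul, neg_one_mul]
          have := Real.cosh_le_exp_half_sq (b * a t s)
          rw [mul_pow, hb, one_mul, Real.cosh_eq] at this
          linarith
      _ = 2 ^ Fintype.card S * Real.exp ((∑ s, a t s ^ 2) / 2) := by
          rw [Finset.prod_mul_distrib, Finset.prod_const, ← Real.exp_sum, Finset.sum_div]
          rfl
      _ ≤ 2 ^ Fintype.card S * Real.exp (1 / 2) := by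
          have := ha t ht
          gcongr
  obtain ⟨ε, hε, hle⟩ := Finset.exists_le_of_sum_le hEne
    (f := fun ε => ∑ t ∈ T, (Real.exp (1 * ∑ s, ε s * a t s) + Real.exp (-1 * ∑ s, ε s * a t s)))
    (g := fun _ => 2 * #T * Real.exp (1 / 2)) (by
      rw [Finset.sum_comm]
      calc _ ≤ ∑ t ∈ T, (#E * Real.exp (1 / 2) + #E * Real.exp (1 / 2)) := by
            refine Finset.sum_le_sum fun t ht => ?_
            rw [Finset.sum_add_distrib]
            exact add_le_add (hmom t ht 1 (by norm_num)) (hmom t ht (-1) (by norm_num))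
        _ = _ := by
            simp only [Finset.sum_const, nsmul_eq_mul]
            ring)
  refine ⟨ε, fun s => ?_, fun t ht => ?_⟩
  · have h := Fintype.mem_piFinset.mp hε s
    rw [Finset.mem_insert, Finset.mem_singleton] at h
    rcases h with h | h <;> simp [h]
  · set x := ∑ s, ε s * a t s with hx
    have h1 : Real.exp |x| ≤ Real.exp (1 * x) + Real.exp (-1 * x) := by
      rw [one_mul, neg_one_mul]
      rcases abs_cases x with ⟨h, _⟩ | ⟨h, _⟩ <;> rw [h] <;>
        linarith [Real.exp_pos x, Real.exp_pos (-x)]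
    have h2 : Real.exp (1 * x) + Real.exp (-1 * x) ≤ 2 * #T * Real.exp (1 / 2) :=
      (Finset.single_le_sum (f := fun t => Real.exp (1 * ∑ s, ε s * a t s) +
        Real.exp (-1 * ∑ s, ε s * a t s)) (fun t _ => by positivity) ht).trans hle
    have hT : (0 : ℝ) < #T := by exact_mod_cast Finset.card_pos.mpr ⟨t, ht⟩
    have h3 := Real.log_le_log (Real.exp_pos _) (h1.trans h2)
    rw [Real.log_exp, Real.log_mul (by positivity) (Real.exp_pos _).ne', Real.log_exp] at h3
    linarith

/-- Rounding towards zero, so that rounding a vector does not increase its norm. -/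
lemma exists_int_div_near {x : ℝ} (L : ℕ) (hL : 0 < L) (hx : |x| ≤ 1) :
    ∃ k : ℤ, k ∈ Finset.Icc (-(L : ℤ)) L ∧ |(k : ℝ) / L| ≤ |x| ∧ |x - k / L| ≤ 1 / L := by
  have hL' : (0 : ℝ) < L := by exact_mod_cast hL
  wlog h : 0 ≤ x generalizing x
  · obtain ⟨k, h1, h2, h3⟩ := this (x := -x) (by rwa [abs_neg]) (by linarith)
    refine ⟨-k, ?_, ?_, ?_⟩
    · rw [Finset.mem_Icc] at h1 ⊢
      omega
    · push_cast
      rwa [neg_div, abs_neg, ← abs_neg x]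
    · push_cast
      rw [← abs_neg]
      convert h3 using 2
      ring
  · rw [abs_of_nonneg h] at hx ⊢
    have h0 : 0 ≤ ⌊x * L⌋ := Int.floor_nonneg.mpr (by positivity)
    have h0' : (0 : ℝ) ≤ ⌊x * L⌋ := by exact_mod_cast h0
    have h1 := Int.floor_le (x * L)
    have h2 := Int.lt_floor_add_one (x * L)
    refine ⟨⌊x * L⌋, ?_, ?_, ?_⟩
    · rw [Finset.mem_Icc]
      refine ⟨by omega, ?_⟩
      have : ((⌊x * L⌋ : ℤ) : ℝ) ≤ (L : ℤ) := by
        push_cast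
        nlinarith
      exact_mod_cast this
    · rw [abs_of_nonneg (by positivity), div_le_iff₀ hL']
      exact h1
    · rw [abs_le]
      constructor
      · have : (⌊x * L⌋ : ℝ) / L ≤ x := by rwa [div_le_iff₀ hL']
        have : (0 : ℝ) ≤ 1 / L := by positivity
        linarith
      · rw [sub_le_iff_le_add, ← add_div, le_div_iff₀ hL']
        linarith

lemma norm_prod_sub_prod_le {ι : Type*} (s : Finset ι) {f g : ι → ℂ} {δ : ℝ}
    (hf : ∀ i ∈ s, ‖f i‖ ≤ 1) (hg : ∀ i ∈ s, ‖g i‖ ≤ 1) (h : ∀ i ∈ s, ‖f i - g i‖ ≤ δ) :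
    ‖∏ i ∈ s, f i - ∏ i ∈ s, g i‖ ≤ #s * δ := by
  classical
  induction s using Finset.induction_on with
  | empty => simp
  | insert a s ha ih =>
    rw [Finset.prod_insert ha, Finset.prod_insert ha, Finset.card_insert_of_notMem ha]
    have h1 := ih (fun i hi => hf i (Finset.mem_insert_of_mem hi))
      (fun i hi => hg i (Finset.mem_insert_of_mem hi))
      (fun i hi => h i (Finset.mem_insert_of_mem hi))
    have h2 : ‖∏ i ∈ s, g i‖ ≤ 1 := by
      rw [norm_prod]
      exact Finset.prod_le_one (fun _ _ => norm_nonneg _)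
        fun i hi => hg i (Finset.mem_insert_of_mem hi)
    have h3 := hf a (Finset.mem_insert_self a s)
    have h4 := h a (Finset.mem_insert_self a s)
    calc ‖f a * ∏ i ∈ s, f i - g a * ∏ i ∈ s, g i‖
        = ‖f a * (∏ i ∈ s, f i - ∏ i ∈ s, g i) + (f a - g a) * ∏ i ∈ s, g i‖ := by
          congr 1
          ring
      _ ≤ ‖f a‖ * ‖∏ i ∈ s, f i - ∏ i ∈ s, g i‖ + ‖f a - g a‖ * ‖∏ i ∈ s, g i‖ := by
          refine (norm_add_le _ _).trans_eq ?_
          rw [norm_mul, norm_mul]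
      _ ≤ 1 * (#s * δ) + δ * 1 := by
          have := norm_nonneg (f a - g a)
          gcongr
          linarith
      _ = _ := by push_cast; ring

lemma exists_grid_near {z : ℂ} (L : ℕ) (hL : 0 < L) (hz : ‖z‖ ≤ 1) :
    ∃ k ∈ Finset.Icc (-(L : ℤ)) L ×ˢ Finset.Icc (-(L : ℤ)) L,
      ‖(⟨k.1 / L, k.2 / L⟩ : ℂ)‖ ≤ ‖z‖ ∧ ‖z - ⟨k.1 / L, k.2 / L⟩‖ ≤ 2 / L := by
  obtain ⟨a, ha, ha1, ha2⟩ := exists_int_div_near L hL ((Complex.abs_re_le_norm z).trans hz)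
  obtain ⟨b, hb, hb1, hb2⟩ := exists_int_div_near L hL ((Complex.abs_im_le_norm z).trans hz)
  refine ⟨(a, b), Finset.mem_product.mpr ⟨ha, hb⟩, ?_, ?_⟩
  · have h1 := sq_le_sq.mpr ha1
    have h2 := sq_le_sq.mpr hb1
    rw [Complex.norm_eq_sqrt_sq_add_sq, Complex.norm_eq_sqrt_sq_add_sq]
    exact Real.sqrt_le_sqrt (by linarith)
  · refine (Complex.norm_le_abs_re_add_abs_im _).trans ?_
    simp only [Complex.sub_re, Complex.sub_im]
    rw [show (2 : ℝ) / L = 1 / L + 1 / L by ring]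
    exact add_le_add ha2 hb2

/-- The logarithm of the number of points of the grid is polynomial in the number of variables. -/
lemma two_mul_log_add_le {m n : ℕ} (hm : 0 < m) (hn : n ≤ m * 4 ^ m) :
    2 * (Real.log (2 * (((2 * (2 * m * 4 ^ (m ^ 2)) + 1) ^ 2) ^ n * 2)) + 1) + 1 ≤
      (1000 : ℝ) ^ m := by
  have hm1 : (1 : ℝ) ≤ m := by exact_mod_cast hm
  have hm2 : (m : ℝ) ≤ 2 ^ m := by exact_mod_cast Nat.lt_two_pow_self.le
  have hlog2 : Real.log 2 ≤ 1 := (Real.log_two_lt_d9.trans (by norm_num)).le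
  have hlog2' : 0 ≤ Real.log 2 := Real.log_nonneg one_le_two
  have hbase : (2 * (2 * m * 4 ^ (m ^ 2)) + 1 : ℝ) ≤ 2 ^ (2 * m ^ 2 + m + 3) := by
    have h4 : (4 : ℝ) ^ (m ^ 2) = 2 ^ (2 * m ^ 2) := by rw [pow_mul]; norm_num
    have h1 : (1 : ℝ) ≤ 2 ^ (2 * m ^ 2) := one_le_pow₀ one_le_two
    rw [h4, pow_add, pow_add]
    nlinarith [mul_le_mul_of_nonneg_left hm2 (zero_le_one.trans h1),
      mul_le_mul h1 (hm1.trans hm2) zero_le_one (zero_le_one.trans h1)]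
  have hpos : (0 : ℝ) < 2 * (2 * m * 4 ^ (m ^ 2)) + 1 := by positivity
  have hlogb : Real.log (2 * (2 * m * 4 ^ (m ^ 2)) + 1) ≤ 6 * m ^ 2 := by
    refine (Real.log_le_log hpos hbase).trans ?_
    rw [Real.log_pow]
    push_cast
    nlinarith
  have hlog4 : Real.log (2 * 2) ≤ 2 := by
    rw [Real.log_mul (by norm_num) (by norm_num)]
    linarith
  have hn' : (n : ℝ) ≤ m * 4 ^ m := by exact_mod_cast hn
  have key : Real.log (2 * (((2 * (2 * m * 4 ^ (m ^ 2)) + 1) ^ 2) ^ n * 2)) ≤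
      2 + 12 * m ^ 3 * 4 ^ m := by
    rw [show (2 : ℝ) * (((2 * (2 * m * 4 ^ (m ^ 2)) + 1) ^ 2) ^ n * 2) =
      (2 * 2) * (2 * (2 * m * 4 ^ (m ^ 2)) + 1) ^ (2 * n) by rw [pow_mul]; ring,
      Real.log_mul (by norm_num) (by positivity), Real.log_pow]
    push_cast
    have h5 : (2 * n : ℝ) * Real.log (2 * (2 * m * 4 ^ (m ^ 2)) + 1) ≤
        (2 * (m * 4 ^ m)) * (6 * m ^ 2) := by
      refine mul_le_mul (by linarith) hlogb (Real.log_nonneg ?_) (by positivity)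
      have : (0 : ℝ) ≤ 2 * (2 * m * 4 ^ (m ^ 2)) := by positivity
      linarith
    have h6 : (2 * (m * 4 ^ m)) * (6 * m ^ 2) = (12 * m ^ 3 * 4 ^ m : ℝ) := by ring
    linarith
  have h8 : (m : ℝ) ^ 3 * 4 ^ m ≤ 32 ^ m := by
    calc (m : ℝ) ^ 3 * 4 ^ m ≤ (2 ^ m) ^ 3 * 4 ^ m := by gcongr
      _ = 32 ^ m := by rw [← pow_mul, mul_comm m 3, pow_mul, ← mul_pow]; norm_num
  have h32 : (1 : ℝ) ≤ 32 ^ m := one_le_pow₀ (by norm_num)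
  calc _ ≤ 31 * (32 : ℝ) ^ m := by linarith
    _ ≤ 31 ^ m * 32 ^ m := by
        gcongr
        exact le_self_pow₀ (by norm_num) hm.ne'
    _ = 992 ^ m := by rw [← mul_pow]; norm_num
    _ ≤ 1000 ^ m := by gcongr; norm_num

/-- The norm of a random tensor of order `m` on Euclidean spaces of dimension at most `4 ^ m` is
exponential in `m`: random signs are good on a fine grid in the product of the unit balls. -/
lemma exists_signs_norm_sum_prod_le {m : ℕ} {ι : Fin m → Type*} [∀ l, Fintype (ι l)]
    [∀ l, DecidableEq (ι l)] (hι : ∀ l, Fintype.card (ι l) ≤ 4 ^ m) :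
    ∃ ε : (∀ l, ι l) → ℝ, (∀ i, |ε i| = 1) ∧ ∀ u : ∀ l, ι l → ℂ,
      (∀ l, ∑ k, ‖u l k‖ ^ 2 ≤ 1) → ‖∑ i, (ε i : ℂ) * ∏ l, u l (i l)‖ ≤ 1000 ^ m := by
  classical
  rcases Nat.eq_zero_or_pos m with rfl | hm
  · refine ⟨fun _ => 1, fun _ => abs_one, fun u _ => ?_⟩
    simp
  set L : ℕ := 2 * m * 4 ^ (m ^ 2) with hLdef
  have hL : 0 < L := by positivity
  have hL' : (0 : ℝ) < L := by exact_mod_cast hL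
  -- with this mesh the error of rounding in all the `4 ^ (m ^ 2)` terms is at most `1`
  set grid : Finset (ℤ × ℤ) := Finset.Icc (-(L : ℤ)) L ×ˢ Finset.Icc (-(L : ℤ)) L with hgrid
  set v : ((Σ l, ι l) → ℤ × ℤ) → ∀ l, ι l → ℂ :=
    fun t l k => ⟨(t ⟨l, k⟩).1 / L, (t ⟨l, k⟩).2 / L⟩ with hv
  set T : Finset ((Σ l, ι l) → ℤ × ℤ) :=
    (Fintype.piFinset fun _ => grid).filter fun t => ∀ l, ∑ k, ‖v t l k‖ ^ 2 ≤ 1 with hT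
  have hprod : ∀ u : ∀ l, ι l → ℂ, (∀ l, ∑ k, ‖u l k‖ ^ 2 ≤ 1) →
      ∑ i : ∀ l, ι l, ‖∏ l, u l (i l)‖ ^ 2 ≤ 1 := fun u hu => by
    have h1 : ∑ i : ∀ l, ι l, ‖∏ l, u l (i l)‖ ^ 2 = ∏ l, ∑ k, ‖u l k‖ ^ 2 := by
      rw [Finset.prod_univ_sum, Fintype.piFinset_univ]
      refine Finset.sum_congr rfl fun i _ => ?_
      rw [norm_prod, Finset.prod_pow]
    rw [h1]
    exact Finset.prod_le_one (fun l _ => Finset.sum_nonneg fun _ _ => sq_nonneg _) fun l _ => hu l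
  set a : (((Σ l, ι l) → ℤ × ℤ) × Bool) → (∀ l, ι l) → ℝ := fun t i =>
    if t.2 then (∏ l, v t.1 l (i l)).re else (∏ l, v t.1 l (i l)).im with ha
  obtain ⟨ε, hε, hεT⟩ := exists_signs_abs_sum_le (T ×ˢ (Finset.univ : Finset Bool)) a (by
    intro t ht
    have h1 := (Finset.mem_filter.mp (Finset.mem_product.mp ht).1).2
    refine le_trans (Finset.sum_le_sum fun i _ => ?_) (hprod _ h1)
    simp only [ha]
    rw [← sq_abs]
    split_ifs
    · exact pow_le_pow_left₀ (abs_nonneg _) (Complex.abs_re_le_norm _) 2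
    · exact pow_le_pow_left₀ (abs_nonneg _) (Complex.abs_im_le_norm _) 2)
  refine ⟨ε, hε, fun u hu => ?_⟩
  have hu1 : ∀ l k, ‖u l k‖ ≤ 1 := fun l k => by
    have h1 := (Finset.single_le_sum (f := fun k => ‖u l k‖ ^ 2) (fun _ _ => sq_nonneg _)
      (Finset.mem_univ k)).trans (hu l)
    exact (sq_le_one_iff₀ (norm_nonneg _)).mp h1
  choose t ht1 ht2 ht3 using fun s : Σ l, ι l => exists_grid_near L hL (hu1 s.1 s.2)
  have htT : t ∈ T := by
    refine Finset.mem_filter.mpr ⟨Fintype.mem_piFinset.mpr ht1, fun l => ?_⟩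
    refine le_trans (Finset.sum_le_sum fun k _ => ?_) (hu l)
    exact pow_le_pow_left₀ (norm_nonneg _) (ht2 ⟨l, k⟩) 2
  have hv1 : ∀ l k, ‖v t l k‖ ≤ 1 := fun l k => (ht2 ⟨l, k⟩).trans (hu1 l k)
  have hcardS : (Fintype.card (Σ l, ι l)) ≤ m * 4 ^ m := by
    rw [Fintype.card_sigma]
    refine (Finset.sum_le_sum fun l _ => hι l).trans_eq ?_
    simp
  have hcardT : (#(T ×ˢ (Finset.univ : Finset Bool)) : ℝ) ≤
      ((2 * (2 * m * 4 ^ (m ^ 2)) + 1) ^ 2) ^ Fintype.card (Σ l, ι l) * 2 := by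
    rw [Finset.card_product]
    have h1 : #T ≤ ((2 * L + 1) ^ 2) ^ Fintype.card (Σ l, ι l) := by
      refine (Finset.card_filter_le _ _).trans_eq ?_
      rw [Fintype.card_piFinset, Finset.prod_const, hgrid, Finset.card_product, Int.card_Icc,
        Finset.card_univ, ← sq]
      congr 2
      omega
    have h2 : (#T : ℝ) ≤ ((2 * L + 1) ^ 2) ^ Fintype.card (Σ l, ι l) := by exact_mod_cast h1
    rw [hLdef] at h2
    push_cast at h2 ⊢
    simpa using h2
  have hval : ‖∑ i, (ε i : ℂ) * ∏ l, v t l (i l)‖ ≤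
      2 * (Real.log (2 * #(T ×ˢ (Finset.univ : Finset Bool))) + 1) := by
    refine (Complex.norm_le_abs_re_add_abs_im _).trans ?_
    have h1 := hεT (t, true) (Finset.mem_product.mpr ⟨htT, Finset.mem_univ _⟩)
    have h2 := hεT (t, false) (Finset.mem_product.mpr ⟨htT, Finset.mem_univ _⟩)
    simp only [ha, if_true, Bool.false_eq_true, if_false] at h1 h2
    rw [Complex.re_sum, Complex.im_sum]
    simp_rw [Complex.re_ofReal_mul, Complex.im_ofReal_mul]
    linarith
  have hdiff : ‖∑ i, (ε i : ℂ) * ∏ l, u l (i l) - ∑ i, (ε i : ℂ) * ∏ l, v t l (i l)‖ ≤ 1 := by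
    rw [← Finset.sum_sub_distrib]
    calc _ ≤ ∑ _i : ∀ l, ι l, (m * (2 / L) : ℝ) := by
          refine norm_sum_le_of_le _ fun i _ => ?_
          rw [← mul_sub, norm_mul, Complex.norm_real, Real.norm_eq_abs, hε, one_mul]
          have := norm_prod_sub_prod_le (Finset.univ : Finset (Fin m)) (f := fun l => u l (i l))
            (g := fun l => v t l (i l)) (fun l _ => hu1 l _) (fun l _ => hv1 l _)
            (fun l _ => ht3 ⟨l, i l⟩)
          simpa using this
      _ = Fintype.card (∀ l, ι l) * (m * (2 / L)) := by simp
      _ ≤ 4 ^ (m ^ 2) * (m * (2 / L)) := by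
          refine mul_le_mul_of_nonneg_right ?_ (by positivity)
          have h1 : Fintype.card (∀ l, ι l) ≤ 4 ^ (m ^ 2) := by
            rw [Fintype.card_pi]
            refine (Finset.prod_le_prod' fun l _ => hι l).trans_eq ?_
            rw [Finset.prod_const, Finset.card_univ, Fintype.card_fin, ← pow_mul, sq]
          exact_mod_cast h1
      _ = 1 := by
          have hm' : (m : ℝ) ≠ 0 := by exact_mod_cast hm.ne'
          rw [hLdef]
          push_cast
          field_simp
  calc ‖∑ i, (ε i : ℂ) * ∏ l, u l (i l)‖
      ≤ ‖∑ i, (ε i : ℂ) * ∏ l, v t l (i l)‖ +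
        ‖∑ i, (ε i : ℂ) * ∏ l, u l (i l) - ∑ i, (ε i : ℂ) * ∏ l, v t l (i l)‖ :=
        norm_le_insert' _ _
    _ ≤ 2 * (Real.log (2 * #(T ×ˢ (Finset.univ : Finset Bool))) + 1) + 1 := add_le_add hval hdiff
    _ ≤ 2 * (Real.log (2 * (((2 * (2 * m * 4 ^ (m ^ 2)) + 1) ^ 2) ^
          Fintype.card (Σ l, ι l) * 2)) + 1) + 1 := by
        have h0 : (0 : ℝ) < #(T ×ˢ (Finset.univ : Finset Bool)) := by
          exact_mod_cast Finset.card_pos.mpr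
            ⟨(t, true), Finset.mem_product.mpr ⟨htT, Finset.mem_univ _⟩⟩
        have := Real.log_le_log (by positivity) (mul_le_mul_of_nonneg_left hcardT zero_le_two)
        linarith
    _ ≤ 1000 ^ m := two_mul_log_add_le hm hcardS

/-- The homogeneous form of `exists_signs_norm_sum_prod_le`. -/
lemma exists_signs_norm_sum_prod_le_mul {m : ℕ} {ι : Fin m → Type*} [∀ l, Fintype (ι l)]
    [∀ l, DecidableEq (ι l)] (hι : ∀ l, Fintype.card (ι l) ≤ 4 ^ m) :
    ∃ ε : (∀ l, ι l) → ℝ, (∀ i, |ε i| = 1) ∧ ∀ u : ∀ l, ι l → ℂ,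
      ‖∑ i, (ε i : ℂ) * ∏ l, u l (i l)‖ ≤ 1000 ^ m * ∏ l, √(∑ k, ‖u l k‖ ^ 2) := by
  obtain ⟨ε, hε, h⟩ := exists_signs_norm_sum_prod_le hι
  refine ⟨ε, hε, fun u => ?_⟩
  set ρ : Fin m → ℝ := fun l => √(∑ k, ‖u l k‖ ^ 2) with hρ
  have hS : ∀ l, 0 ≤ ∑ k, ‖u l k‖ ^ 2 := fun l => Finset.sum_nonneg fun _ _ => sq_nonneg _
  have hρ0 : ∀ l, 0 ≤ ρ l := fun l => Real.sqrt_nonneg _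
  have hρ2 : ∀ l, ρ l ^ 2 = ∑ k, ‖u l k‖ ^ 2 := fun l => Real.sq_sqrt (hS l)
  -- where `ρ l = 0`, the vector `u l` vanishes and division by zero does no harm
  have hu : ∀ l k, u l k = ρ l * ((ρ l : ℂ)⁻¹ * u l k) := fun l k => by
    rcases eq_or_ne (ρ l) 0 with h0 | h0
    · have h1 : ∑ k, ‖u l k‖ ^ 2 = 0 := by rw [← hρ2, h0]; norm_num
      have h2 := (Finset.sum_eq_zero_iff_of_nonneg fun _ _ => sq_nonneg _).mp h1 k
        (Finset.mem_univ k)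
      rw [h0, Complex.ofReal_zero, zero_mul]
      simpa using h2
    · rw [← mul_assoc, mul_inv_cancel₀ (by exact_mod_cast h0), one_mul]
  have h1 := h (fun l k => (ρ l : ℂ)⁻¹ * u l k) fun l => by
    simp_rw [norm_mul, mul_pow]
    rw [← Finset.mul_sum, ← hρ2, norm_inv, Complex.norm_real, Real.norm_of_nonneg (hρ0 l),
      ← mul_pow]
    rcases eq_or_ne (ρ l) 0 with h0 | h0
    · simp [h0]
    · rw [inv_mul_cancel₀ h0, one_pow]
  have h2 : ∑ i, (ε i : ℂ) * ∏ l, u l (i l) =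
      (∏ l, (ρ l : ℂ)) * ∑ i, (ε i : ℂ) * ∏ l, ((ρ l : ℂ)⁻¹ * u l (i l)) := by
    rw [Finset.mul_sum]
    refine Finset.sum_congr rfl fun i _ => ?_
    rw [mul_left_comm, ← Finset.prod_mul_distrib]
    congr 1
    exact Finset.prod_congr rfl fun l _ => hu l _
  rw [h2, norm_mul, norm_prod, mul_comm]
  refine mul_le_mul h1 (le_of_eq ?_) (Finset.prod_nonneg fun _ _ => norm_nonneg _) (by positivity)
  exact Finset.prod_congr rfl fun l _ => by rw [Complex.norm_real, Real.norm_of_nonneg (hρ0 l)]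

/-! ### Random polynomials on dyadic blocks -/

/-- The `k`-th index of the dyadic block `[2 ^ (m + l), 2 ^ (m + l + 1))`. The blocks with `l < m`
carry the variables of the polynomial of degree `m`. -/
def blockIdx (m : ℕ) (l : Fin m) (k : Fin (2 ^ (m + l : ℕ))) : ℕ := 2 ^ (m + l : ℕ) + k

lemma log_blockIdx {m : ℕ} (l : Fin m) (k : Fin (2 ^ (m + l : ℕ))) :
    Nat.log 2 (blockIdx m l k) = m + l := by
  have hk := k.isLt
  refine Nat.log_eq_of_pow_le_of_lt_pow (by simp [blockIdx]) ?_
  rw [blockIdx, pow_succ]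
  omega

lemma blockIdx_lt {m : ℕ} (l : Fin m) (k : Fin (2 ^ (m + l : ℕ))) : blockIdx m l k < 4 ^ m := by
  have hk := k.isLt
  have hl := l.isLt
  have h1 : 2 ^ (m + l + 1 : ℕ) ≤ 2 ^ (2 * m) := Nat.pow_le_pow_right two_pos (by omega)
  rw [pow_mul, pow_succ] at h1
  rw [blockIdx]
  norm_num at h1
  omega

lemma blockIdx_inj {m : ℕ} {l l' : Fin m} {k : Fin (2 ^ (m + l : ℕ))}
    {k' : Fin (2 ^ (m + l' : ℕ))} (h : blockIdx m l k = blockIdx m l' k') :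
    (⟨l, k⟩ : Σ l : Fin m, Fin (2 ^ (m + l : ℕ))) = ⟨l', k'⟩ := by
  have hl : l = l' := by
    have := congrArg (Nat.log 2) h
    rw [log_blockIdx, log_blockIdx] at this
    exact Fin.ext (by omega)
  subst hl
  have hk : k = k' := Fin.ext (by simpa [blockIdx] using h)
  rw [hk]

/-- The multi-indices `i` of the polynomial of degree `m`: one variable is chosen in each of the
`m` blocks. -/
abbrev BlockChoice (m : ℕ) : Type := ∀ l : Fin m, Fin (2 ^ (m + l : ℕ))

/-- The polynomial of degree `m`, linear in the variables of each block, with coefficients `ε`. -/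
def blockPoly (m : ℕ) (ε : BlockChoice m → ℝ) (u : ℕ → ℂ) : ℂ :=
  ∑ i, (ε i : ℂ) * ∏ l, u (blockIdx m l (i l))

/-- The bound for the polynomial of degree `m` with suitable signs on the unit ball of `ℓ_r`. -/
def blockBound (r : ℝ≥0∞) (m : ℕ) : ℝ :=
  1000 ^ m * ((∏ l : Fin m, ((2 : ℝ) ^ (m + l : ℕ)) ^ (1 - recip r - sigmaExp r)) *
    (((m : ℝ) ^ m)⁻¹) ^ recip r)

lemma blockBound_pos (r : ℝ≥0∞) (m : ℕ) : 0 < blockBound r m := by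
  have : (0 : ℝ) < (m : ℝ) ^ m := by
    rcases Nat.eq_zero_or_pos m with rfl | h
    · norm_num
    · positivity
  unfold blockBound
  positivity

/-- Comparison of the norms of `ℓ_2` and `ℓ_r` in finite dimension. -/
lemma sqrt_sum_sq_le {ι : Type*} [Fintype ι] (hr' : r ≠ ∞) {v : ι → ℝ} (hv : ∀ k, 0 ≤ v k) :
    √(∑ k, v k ^ 2) ≤ (Fintype.card ι : ℝ) ^ (1 - recip r - sigmaExp r) *
      (∑ k, v k ^ r.toReal) ^ recip r := by
  have hr1 := one_le_toReal hr'
  have hr0 : 0 < r.toReal := by linarith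
  have hp : recip r = 1 / r.toReal := by rw [recip_eq, one_div]
  have hV : ∀ k, 0 ≤ v k ^ r.toReal := fun k => Real.rpow_nonneg (hv k) _
  have hS : 0 ≤ ∑ k, v k ^ r.toReal := Finset.sum_nonneg fun k _ => hV k
  rcases le_total r 2 with h2 | h2
  · have hr2 : r.toReal ≤ 2 := by simpa using ENNReal.toReal_mono (by simp) h2
    rw [sigmaExp_of_le_two h2, hp, show 1 - 1 / r.toReal - (1 - 1 / r.toReal) = 0 by ring,
      Real.rpow_zero, one_mul]
    set R : ℝ := (∑ k, v k ^ r.toReal) ^ (1 / r.toReal) with hR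
    have hR0 : 0 ≤ R := Real.rpow_nonneg hS _
    have hRr : R ^ r.toReal = ∑ k, v k ^ r.toReal := by
      rw [hR, ← Real.rpow_mul hS, one_div_mul_cancel hr0.ne', Real.rpow_one]
    have hvR : ∀ k, v k ≤ R := fun k => by
      rw [← Real.rpow_le_rpow_iff (hv k) hR0 hr0, hRr]
      exact Finset.single_le_sum (f := fun k => v k ^ r.toReal) (fun k _ => hV k)
        (Finset.mem_univ k)
    refine Real.sqrt_le_iff.mpr ⟨hR0, ?_⟩
    have hsplit : ∀ x : ℝ, 0 ≤ x → x ^ 2 = x ^ r.toReal * x ^ (2 - r.toReal) := fun x hx => by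
      rw [← Real.rpow_add_of_nonneg hx hr0.le (by linarith), add_sub_cancel, Real.rpow_two]
    calc ∑ k, v k ^ 2 ≤ ∑ k, v k ^ r.toReal * R ^ (2 - r.toReal) := by
          refine Finset.sum_le_sum fun k _ => ?_
          rw [hsplit _ (hv k)]
          exact mul_le_mul_of_nonneg_left
            (Real.rpow_le_rpow (hv k) (hvR k) (by linarith)) (hV k)
      _ = R ^ 2 := by rw [← Finset.sum_mul, ← hRr, ← hsplit _ hR0]
  · have hr2 : 2 ≤ r.toReal := by simpa using ENNReal.toReal_mono hr' h2
    have hA : 0 ≤ ∑ k, v k ^ 2 := Finset.sum_nonneg fun k _ => sq_nonneg _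
    have h1 := Real.rpow_sum_le_const_mul_sum_rpow_of_nonneg (Finset.univ : Finset ι)
      (f := fun k => v k ^ 2) (p := r.toReal / 2) (by linarith) fun k _ => sq_nonneg _
    have h3 : ∀ k, (v k ^ 2) ^ (r.toReal / 2) = v k ^ r.toReal := fun k => by
      rw [← Real.rpow_natCast, ← Real.rpow_mul (hv k)]
      congr 1
      push_cast
      ring
    simp_rw [h3] at h1
    rw [Finset.card_univ] at h1
    have h4 := Real.rpow_le_rpow (Real.rpow_nonneg hA _) h1 (by positivity : 0 ≤ 1 / r.toReal)
    rw [Real.mul_rpow (by positivity) hS, ← Real.rpow_mul hA, ← Real.rpow_mul (by positivity)] at h4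
    rw [Real.sqrt_eq_rpow, hp, sigmaExp_of_two_le h2]
    convert h4 using 2
    · field_simp
    · congr 1
      field_simp
      ring

/-- The inequality between the arithmetic and the geometric mean. -/
lemma prod_le_inv_pow {m : ℕ} {t : Fin m → ℝ} (ht : ∀ l, 0 ≤ t l) (hsum : ∑ l, t l ≤ 1) :
    ∏ l, t l ≤ ((m : ℝ) ^ m)⁻¹ := by
  rcases Nat.eq_zero_or_pos m with rfl | hm
  · simp
  have hm' : (0 : ℝ) < m := by exact_mod_cast hm
  rw [← one_div, le_div_iff₀ (by positivity)]
  calc (∏ l, t l) * (m : ℝ) ^ m = ∏ l, (m * t l) := by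
        rw [Finset.prod_mul_distrib, Finset.prod_const, Finset.card_univ, Fintype.card_fin,
          mul_comm]
    _ ≤ ∏ l, Real.exp (m * t l - 1) := by
        refine Finset.prod_le_prod (fun l _ => mul_nonneg hm'.le (ht l)) fun l _ => ?_
        linarith [Real.add_one_le_exp (m * t l - 1)]
    _ = Real.exp (m * ∑ l, t l - m) := by
        rw [← Real.exp_sum, Finset.sum_sub_distrib, ← Finset.mul_sum]
        simp
    _ ≤ 1 := by
        rw [Real.exp_le_one_iff]
        nlinarith

lemma prod_sqrt_sum_blockIdx_le {u : SeqSpace r} (hu : ‖u‖ ≤ 1) (m : ℕ) :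
    ∏ l : Fin m, √(∑ k, ‖u (blockIdx m l k)‖ ^ 2) ≤
      (∏ l : Fin m, ((2 : ℝ) ^ (m + l : ℕ)) ^ (1 - recip r - sigmaExp r)) *
        (((m : ℝ) ^ m)⁻¹) ^ recip r := by
  by_cases hr' : r = ∞
  · subst hr'
    have hp : recip ∞ = 0 := by simp [recip]
    rw [hp, Real.rpow_zero, mul_one, sigmaExp_of_two_le (by simp)]
    refine Finset.prod_le_prod (fun l _ => Real.sqrt_nonneg _) fun l _ => ?_
    rw [show (1 : ℝ) - 0 - 1 / 2 = 1 / 2 by norm_num, ← Real.sqrt_eq_rpow]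
    refine Real.sqrt_le_sqrt ?_
    calc ∑ k, ‖u (blockIdx m l k)‖ ^ 2 ≤ ∑ _k : Fin (2 ^ (m + l : ℕ)), (1 : ℝ) :=
          Finset.sum_le_sum fun k _ => pow_le_one₀ (norm_nonneg _)
            ((lp.norm_apply_le_norm (by simp) u _).trans hu)
      _ = 2 ^ (m + l : ℕ) := by simp
  · have hr1 := one_le_toReal hr'
    have hr0 : 0 < r.toReal := by linarith
    set t : Fin m → ℝ := fun l => ∑ k, ‖u (blockIdx m l k)‖ ^ r.toReal with ht
    have ht0 : ∀ l, 0 ≤ t l := fun l =>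
      Finset.sum_nonneg fun k _ => Real.rpow_nonneg (norm_nonneg _) _
    have hsum : ∑ l, t l ≤ 1 := by
      have hinj : Set.InjOn (fun y : Σ l : Fin m, Fin (2 ^ (m + l : ℕ)) => blockIdx m y.1 y.2)
          (Finset.univ : Finset (Σ l : Fin m, Fin (2 ^ (m + l : ℕ)))) :=
        fun y _ y' _ h => blockIdx_inj h
      calc ∑ l, t l = ∑ y : Σ l : Fin m, Fin (2 ^ (m + l : ℕ)),
            ‖u (blockIdx m y.1 y.2)‖ ^ r.toReal := by
            rw [← Finset.univ_sigma_univ, Finset.sum_sigma]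
        _ = ∑ j ∈ Finset.univ.image
              (fun y : Σ l : Fin m, Fin (2 ^ (m + l : ℕ)) => blockIdx m y.1 y.2),
              ‖u j‖ ^ r.toReal := (Finset.sum_image (f := fun j => ‖u j‖ ^ r.toReal) hinj).symm
        _ ≤ ‖u‖ ^ r.toReal := lp.sum_rpow_le_norm_rpow hr0 u _
        _ ≤ 1 := Real.rpow_le_one (norm_nonneg _) hu hr0.le
    have hp : 0 ≤ recip r := ENNReal.toReal_nonneg
    calc ∏ l : Fin m, √(∑ k, ‖u (blockIdx m l k)‖ ^ 2)
        ≤ ∏ l : Fin m, ((2 : ℝ) ^ (m + l : ℕ)) ^ (1 - recip r - sigmaExp r) * t l ^ recip r := by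
          refine Finset.prod_le_prod (fun l _ => Real.sqrt_nonneg _) fun l _ => ?_
          have := sqrt_sum_sq_le hr' fun k => norm_nonneg (u (blockIdx m l k))
          rw [Fintype.card_fin] at this
          exact_mod_cast this
      _ = (∏ l : Fin m, ((2 : ℝ) ^ (m + l : ℕ)) ^ (1 - recip r - sigmaExp r)) *
          (∏ l, t l) ^ recip r := by
          rw [Finset.prod_mul_distrib, Real.finsetProd_rpow _ _ fun l _ => ht0 l]
      _ ≤ _ := by
          refine mul_le_mul_of_nonneg_left ?_ (by positivity)
          exact Real.rpow_le_rpow (Finset.prod_nonneg fun l _ => ht0 l) (prod_le_inv_pow ht0 hsum) hp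

lemma exists_norm_blockPoly_le (r : ℝ≥0∞) [Fact (1 ≤ r)] (m : ℕ) :
    ∃ ε : BlockChoice m → ℝ, (∀ i, |ε i| = 1) ∧
      ∀ u : SeqSpace r, ‖u‖ ≤ 1 → ‖blockPoly m ε u‖ ≤ blockBound r m := by
  obtain ⟨ε, hε, h⟩ := exists_signs_norm_sum_prod_le_mul
    (ι := fun l : Fin m => Fin (2 ^ (m + l : ℕ))) fun l => by
      rw [Fintype.card_fin, show 4 = 2 ^ 2 by norm_num, ← pow_mul]
      exact Nat.pow_le_pow_right two_pos (by have := l.isLt; omega)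
  refine ⟨ε, hε, fun u hu => (h fun l k => u (blockIdx m l k)).trans ?_⟩
  exact mul_le_mul_of_nonneg_left (prod_sqrt_sum_blockIdx_le hu m) (by positivity)

lemma blockPoly_smul (m : ℕ) (ε : BlockChoice m → ℝ) (t : ℂ) (u : ℕ → ℂ) :
    blockPoly m ε (t • u) = t ^ m * blockPoly m ε u := by
  rw [blockPoly, blockPoly, Finset.mul_sum]
  refine Finset.sum_congr rfl fun i _ => ?_
  simp only [Pi.smul_apply, smul_eq_mul, Finset.prod_mul_distrib, Finset.prod_const,
    Finset.card_univ, Fintype.card_fin]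
  ring

lemma norm_blockPoly_le_two_pow_mul {m : ℕ} {ε : BlockChoice m → ℝ} {B : ℝ}
    (h : ∀ u : SeqSpace r, ‖u‖ ≤ 1 → ‖blockPoly m ε u‖ ≤ B) {u : SeqSpace r} (hu : ‖u‖ ≤ 2) :
    ‖blockPoly m ε u‖ ≤ 2 ^ m * B := by
  have h1 : (u : ℕ → ℂ) = (2 : ℂ) • (((1 / 2 : ℂ) • u : SeqSpace r) : ℕ → ℂ) := by
    rw [lp.coeFn_smul, smul_smul]
    norm_num
  rw [h1, blockPoly_smul, norm_mul, norm_pow, Complex.norm_ofNat]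
  refine mul_le_mul_of_nonneg_left (h _ ?_) (by positivity)
  rw [norm_smul]
  norm_num
  linarith

lemma differentiable_blockPoly (m : ℕ) (ε : BlockChoice m → ℝ) :
    Differentiable ℂ fun u : SeqSpace r => blockPoly m ε u := by
  unfold blockPoly
  have hcoord : ∀ j : ℕ, Differentiable ℂ fun u : SeqSpace r => u j := fun j =>
    (lp.evalCLM ℂ (fun _ : ℕ => ℂ) r j).differentiable
  exact Differentiable.fun_sum fun i _ => (differentiable_const _).mul fun u =>
    (HasFDerivAt.finsetProd (g := fun l (u : SeqSpace r) => u (blockIdx m l (i l)))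
      fun l _ => (hcoord _ u).hasFDerivAt).differentiableAt

/-- The multi-index of a monomial of the polynomial `blockPoly m`. -/
def blockExp (m : ℕ) (i : BlockChoice m) : ℕ →₀ ℕ := ∑ l, Finsupp.single (blockIdx m l (i l)) 1

lemma monom_blockExp {R : Type*} [CommMonoid R] (x : ℕ → R) (m : ℕ) (i : BlockChoice m) :
    monom x (blockExp m i) = ∏ l, x (blockIdx m l (i l)) := by
  rw [blockExp, monom, ← Finsupp.prod_finsetSum_index (by simp) (by simp [pow_add])]
  simp

lemma mem_support_blockExp {m : ℕ} {i : BlockChoice m} {j : ℕ} :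
    j ∈ (blockExp m i).support ↔ ∃ l, blockIdx m l (i l) = j := by
  rw [Finsupp.mem_support_iff, blockExp, Finsupp.finsetSum_apply, Ne, Finset.sum_eq_zero_iff]
  simp [Finsupp.single_apply]

lemma blockExp_injective :
    Function.Injective fun y : Σ m, BlockChoice m => blockExp y.1 y.2 := by
  rintro ⟨m, i⟩ ⟨m', i'⟩ h
  have hm : m = m' := by
    have := congrArg Finsupp.degree h
    simpa [blockExp] using this
  subst hm
  congr 1
  funext l
  have h1 : blockIdx m l (i l) ∈ (blockExp m i').support := by
    rw [← show blockExp m i = blockExp m i' from h]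
    exact mem_support_blockExp.mpr ⟨l, rfl⟩
  obtain ⟨l', hl'⟩ := mem_support_blockExp.mp h1
  obtain rfl : l' = l := congrArg Sigma.fst (blockIdx_inj hl')
  exact (eq_of_heq (Sigma.mk.inj (blockIdx_inj hl')).2).symm

lemma support_blockExp_subset (m : ℕ) (i : BlockChoice m) :
    (blockExp m i).support ⊆ range (4 ^ m) := fun j hj => by
  obtain ⟨l, rfl⟩ := mem_support_blockExp.mp hj
  exact Finset.mem_range.mpr (blockIdx_lt l _)

/-- The lacunary series of the polynomials `blockPoly m`, normalised so that its terms decay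
geometrically even on the ball of radius `2`, which controls the derivatives on the unit ball. -/
def blockSeries (r : ℝ≥0∞) (ε : ∀ m, BlockChoice m → ℝ) (u : ℕ → ℂ) : ℂ :=
  ∑' m, (((4 ^ m * blockBound r m)⁻¹ : ℝ) : ℂ) * blockPoly m (ε m) u

lemma norm_blockSeries_term_le {ε : ∀ m, BlockChoice m → ℝ}
    (hε : ∀ m, ∀ u : SeqSpace r, ‖u‖ ≤ 1 → ‖blockPoly m (ε m) u‖ ≤ blockBound r m)
    {u : SeqSpace r} (hu : ‖u‖ ≤ 2) (m : ℕ) :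
    ‖(((4 ^ m * blockBound r m)⁻¹ : ℝ) : ℂ) * blockPoly m (ε m) u‖ ≤ (1 / 2) ^ m := by
  have hB := blockBound_pos r m
  rw [norm_mul, Complex.norm_real, Real.norm_of_nonneg (by positivity)]
  calc _ ≤ (4 ^ m * blockBound r m)⁻¹ * (2 ^ m * blockBound r m) :=
        mul_le_mul_of_nonneg_left (norm_blockPoly_le_two_pow_mul (hε m) hu) (by positivity)
    _ = (1 / 2) ^ m := by
        rw [show (4 : ℝ) = 2 * 2 by norm_num, mul_pow, div_pow, one_pow]
        field_simp

lemma blockSeries_mem_HInfty {ε : ∀ m, BlockChoice m → ℝ}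
    (hε : ∀ m, ∀ u : SeqSpace r, ‖u‖ ≤ 1 → ‖blockPoly m (ε m) u‖ ≤ blockBound r m) :
    (fun u : SeqSpace r => blockSeries r ε u) ∈ HInfty r := by
  have hgeom : Summable fun m : ℕ => (1 / 2 : ℝ) ^ m := summable_geometric_two
  refine ⟨fun u hu => ?_, 2, fun u hu => ?_⟩
  · have hdiff : ∀ m, Differentiable ℂ fun u : SeqSpace r =>
        (((4 ^ m * blockBound r m)⁻¹ : ℝ) : ℂ) * blockPoly m (ε m) u := fun m =>
      (differentiable_blockPoly m (ε m)).const_mul _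
    refine (hasFDerivAt_tsum_of_isPreconnected hgeom Metric.isOpen_ball
      (convex_ball (0 : SeqSpace r) 1).isPreconnected
      (fun m x _ => (hdiff m x).hasFDerivAt) (fun m x hx => ?_) hu
      (.of_norm_bounded hgeom fun m => norm_blockSeries_term_le hε
        (by rw [mem_ball_zero_iff] at hu; linarith) m) hu).differentiableAt.differentiableWithinAt
    rw [mem_ball_zero_iff] at hx
    refine ContinuousLinearMap.opNorm_le_of_unit_norm (by positivity) fun y hy => ?_
    exact norm_fderiv_apply_le (R := 2) (hdiff m).differentiableOn
      (fun v hv => norm_blockSeries_term_le hε (mem_ball_zero_iff.mp hv).le m) (by linarith)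
  · rw [mem_ball_zero_iff] at hu
    exact tsum_of_norm_bounded hasSum_geometric_two fun m =>
      norm_blockSeries_term_le hε (by linarith) m

lemma blockPoly_emb_eq_zero {r : ℝ≥0∞} {N m : ℕ} (hm : N ≤ m) (hN : 0 < N) (ε : BlockChoice m → ℝ)
    (a : ℕ → ℂ) : blockPoly m ε (emb r N a) = 0 := by
  refine Finset.sum_eq_zero fun i _ => mul_eq_zero_of_right _ ?_
  refine Finset.prod_eq_zero (Finset.mem_univ (⟨0, by omega⟩ : Fin m)) ?_
  rw [emb_apply, if_neg]
  have h1 : m < 2 ^ m := Nat.lt_two_pow_self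
  simp only [blockIdx, add_zero, not_lt]
  omega

lemma coeff_blockSeries {ε : ∀ m, BlockChoice m → ℝ} {c : (ℕ →₀ ℕ) → ℂ}
    (hc : IsMonomialExpansion r (fun u => blockSeries r ε u) c) (m : ℕ) (i : BlockChoice m) :
    c (blockExp m i) = (((4 ^ m * blockBound r m)⁻¹ : ℝ) : ℂ) * ε m i := by
  have hN : 0 < 4 ^ m := by positivity
  have hmN : m < 4 ^ m := Nat.lt_pow_self (by norm_num)
  set N := 4 ^ m with hNdef
  obtain ⟨t, ht0, ht1⟩ : ∃ t : ℝ, 0 < t ∧ ‖emb r N fun _ => (t : ℂ)‖ < 1 := by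
    have h := norm_nonneg (emb r N fun _ => (1 : ℂ))
    refine ⟨(1 + ‖emb r N fun _ => (1 : ℂ)‖)⁻¹, by positivity, ?_⟩
    refine (norm_emb_real_smul_le (t := (1 + ‖emb r N fun _ => (1 : ℂ)‖)⁻¹) (by positivity)
      (fun _ => (1 : ℂ)) fun k => ?_).trans_lt ?_
    · rw [Complex.norm_real, Real.norm_of_nonneg (by positivity)]
      simp
    · rw [inv_mul_lt_iff₀ (by positivity)]
      linarith
  have h1 := fourierT_of_isMonomialExpansion hc ht1 (blockExp m i)
  rw [if_pos (support_blockExp_subset m i)] at h1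
  have h2 := fourierT_hasSum (ι := Σ m : Fin N, BlockChoice m)
    (e := fun y => blockExp y.1 y.2)
    (q := fun y => (((4 ^ (y.1 : ℕ) * blockBound r y.1)⁻¹ : ℝ) : ℂ) * ε y.1 y.2 *
      monom (emb r N fun _ => (t : ℂ)) (blockExp y.1 y.2))
    (g := fun θ => blockSeries r ε (emb r N fun j => (t : ℂ) * θ j)) (fun θ => by
      have h3 : blockSeries r ε (emb r N fun j => (t : ℂ) * θ j) =
          ∑ y : Σ m : Fin N, BlockChoice m,
            (((4 ^ (y.1 : ℕ) * blockBound r y.1)⁻¹ : ℝ) : ℂ) * ε y.1 y.2 *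
            monom (emb r N fun _ => (t : ℂ)) (blockExp y.1 y.2) * chr (blockExp y.1 y.2) θ := by
        rw [blockSeries, tsum_eq_sum (s := range N) fun m hm => by
          rw [blockPoly_emb_eq_zero (not_lt.mp (Finset.mem_range.not.mp hm)) hN, mul_zero],
          Finset.sum_range, ← Finset.univ_sigma_univ, Finset.sum_sigma]
        refine Finset.sum_congr rfl fun m _ => ?_
        rw [blockPoly, Finset.mul_sum]
        refine Finset.sum_congr rfl fun i _ => ?_
        rw [chr, mul_assoc _ (monom _ _), ← monom_mul, monom_blockExp, mul_assoc]
        congr 2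
        refine Finset.prod_congr rfl fun l _ => ?_
        rw [emb_apply, emb_apply]
        split_ifs <;> simp
      rw [h3]
      exact hasSum_fintype _) (blockExp m i)
  have h4 := h2.unique (hasSum_single (⟨⟨m, hmN⟩, i⟩ : Σ m : Fin N, BlockChoice m)
    fun y hy => if_neg fun h => hy ?_)
  · rw [if_pos rfl, h1] at h4
    have h5 : monom (emb r N fun _ => (t : ℂ)) (blockExp m i) =
        monom (fun _ => (t : ℂ)) (blockExp m i) := by
      refine monom_congr fun j hj => ?_
      rw [emb_apply, if_pos (Finset.mem_range.mp (support_blockExp_subset m i hj))]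
    rw [h5] at h4
    refine mul_right_cancel₀ ?_ h4
    rw [monom_const]
    exact pow_ne_zero _ (by exact_mod_cast ht0.ne')
  · obtain ⟨⟨k, hk⟩, i'⟩ := y
    have h5 : (⟨k, i'⟩ : Σ m, BlockChoice m) = ⟨m, i⟩ := blockExp_injective h
    obtain rfl : k = m := congrArg Sigma.fst h5
    rw [eq_of_heq (Sigma.mk.inj h5).2]

/-- At a point of monomial convergence, the polynomials `blockPoly m` with all signs removed grow
at most like the bounds for the polynomials with random signs, up to an exponential factor. -/
lemma exists_prod_sum_norm_le {z : ℕ → ℂ} (hz : z ∈ monHInfty r) :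
    ∃ S : ℝ, ∀ m, ∏ l : Fin m, ∑ k, ‖z (blockIdx m l k)‖ ≤ S * (4 ^ m * blockBound r m) := by
  choose ε hε hεB using exists_norm_blockPoly_le r
  obtain ⟨c, hc, hsum⟩ := hz.2 _ (blockSeries_mem_HInfty hεB)
  refine ⟨∑' α, ‖c α * seqMonomial z α‖, fun m => ?_⟩
  have hB := blockBound_pos r m
  have hpos : 0 < 4 ^ m * blockBound r m := by positivity
  have h1 : ∀ i : BlockChoice m, ‖c (blockExp m i) * seqMonomial z (blockExp m i)‖ =
      (4 ^ m * blockBound r m)⁻¹ * ∏ l, ‖z (blockIdx m l (i l))‖ := fun i => by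
    rw [norm_mul, coeff_blockSeries hc, norm_mul, Complex.norm_real, Complex.norm_real,
      Real.norm_of_nonneg (by positivity), Real.norm_eq_abs, hε, mul_one, seqMonomial_eq_monom,
      monom_blockExp, norm_prod]
  have hinj : Function.Injective (blockExp m) := fun i i' h =>
    eq_of_heq (Sigma.mk.inj (@blockExp_injective ⟨m, i⟩ ⟨m, i'⟩ h)).2
  have h2 : ∑ i : BlockChoice m, ‖c (blockExp m i) * seqMonomial z (blockExp m i)‖ ≤
      ∑' α, ‖c α * seqMonomial z α‖ := by
    rw [← Finset.sum_image (s := Finset.univ) (g := blockExp m)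
      (f := fun α => ‖c α * seqMonomial z α‖) fun i _ i' _ h => hinj h]
    exact hsum.sum_le_tsum _ fun _ _ => norm_nonneg _
  simp_rw [h1] at h2
  rw [← Finset.mul_sum, inv_mul_le_iff₀ hpos] at h2
  rw [Finset.prod_univ_sum, Fintype.piFinset_univ]
  linarith

/-- The logarithm is comparable to `m` on the blocks of the polynomial of degree `m`. -/
lemma rpow_neg_abs_mul_le_log_rpow (β : ℝ) {m : ℕ} (l : Fin m) (k : Fin (2 ^ (m + l : ℕ))) :
    4 ^ (-|β|) * (m : ℝ) ^ (-β) ≤ Real.log ((blockIdx m l k : ℝ) + 3) ^ (-β) := by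
  have hm : 0 < m := l.pos
  have hm' : (1 : ℝ) ≤ m := by exact_mod_cast hm
  have hl2 : 1 / 2 ≤ Real.log 2 := by linarith [Real.log_two_gt_d9]
  have hl2' : Real.log 2 ≤ 1 := by linarith [Real.log_two_lt_d9]
  set x := Real.log ((blockIdx m l k : ℝ) + 3) with hx
  have h1 : (m : ℝ) / 4 ≤ x := by
    have h2 : (2 : ℝ) ^ m ≤ (blockIdx m l k : ℝ) + 3 := by
      have : 2 ^ m ≤ blockIdx m l k + 3 := by
        have := Nat.pow_le_pow_right two_pos (Nat.le_add_right m l)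
        rw [blockIdx]
        omega
      exact_mod_cast this
    have h3 := Real.log_le_log (by positivity) h2
    rw [Real.log_pow] at h3
    nlinarith
  have h2 : x ≤ 4 * m := by
    have h3 : (blockIdx m l k : ℝ) + 3 ≤ 2 ^ (2 * m + 2) := by
      have h4 : blockIdx m l k + 3 ≤ 2 ^ (2 * m + 2) := by
        have h5 := blockIdx_lt l k
        rw [pow_add, pow_mul]
        norm_num
        have : 0 < 4 ^ m := by positivity
        omega
      exact_mod_cast h4
    have h4 := Real.log_le_log (by positivity) h3
    rw [Real.log_pow] at h4
    push_cast at h4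
    nlinarith
  have hx0 : 0 < x := by linarith
  have hm0 : (0 : ℝ) < m := by linarith
  rcases le_total 0 β with hβ | hβ
  · rw [abs_of_nonneg hβ, ← Real.mul_rpow (by norm_num) hm0.le]
    exact Real.rpow_le_rpow_of_nonpos hx0 h2 (by linarith)
  · rw [abs_of_nonpos hβ, neg_neg]
    have h3 : (4 : ℝ) ^ β = (1 / 4) ^ (-β) := by
      rw [one_div, Real.inv_rpow (by norm_num), Real.rpow_neg (by norm_num), inv_inv]
    rw [h3, ← Real.mul_rpow (by norm_num) hm0.le]
    exact Real.rpow_le_rpow (by positivity) (by linarith) (by linarith)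

lemma recip_add_sigmaExp_nonneg (r : ℝ≥0∞) [Fact (1 ≤ r)] : 0 ≤ recip r + sigmaExp r := by
  rcases le_total r 2 with h2 | h2
  · rw [sigmaExp_of_le_two h2, recip_eq]
    ring_nf
    norm_num
  · rw [sigmaExp_of_two_le h2]
    have : 0 ≤ recip r := ENNReal.toReal_nonneg
    linarith

/-- The sum of `c • x^(β)` over a dyadic block. -/
lemma mul_rpow_le_sum_norm_blockIdx {a β c : ℝ} (ha : 0 ≤ a) (hc : 0 < c) {m : ℕ} (l : Fin m) :
    c * 2 ^ (-a) * 4 ^ (-|β|) * (m : ℝ) ^ (-β) * ((2 : ℝ) ^ (m + l : ℕ)) ^ (1 - a) ≤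
      ∑ k, ‖((c : ℂ) • logSeq a β) (blockIdx m l k)‖ := by
  have hn : (1 : ℝ) ≤ (2 : ℝ) ^ (m + l : ℕ) := one_le_pow₀ one_le_two
  have hn0 : (0 : ℝ) < (2 : ℝ) ^ (m + l : ℕ) := by positivity
  calc _ = ∑ _k : Fin (2 ^ (m + l : ℕ)), c * ((2 * (2 : ℝ) ^ (m + l : ℕ)) ^ (-a) *
        (4 ^ (-|β|) * (m : ℝ) ^ (-β))) := by
        rw [Finset.sum_const, Finset.card_univ, Fintype.card_fin, nsmul_eq_mul,
          Real.mul_rpow zero_le_two hn0.le, sub_eq_add_neg, Real.rpow_add hn0, Real.rpow_one]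
        push_cast
        ring
    _ ≤ _ := by
        refine Finset.sum_le_sum fun k _ => ?_
        rw [Pi.smul_apply, norm_smul, norm_logSeq, Complex.norm_real, Real.norm_of_nonneg hc.le]
        refine mul_le_mul_of_nonneg_left (mul_le_mul ?_ (rpow_neg_abs_mul_le_log_rpow β l k)
          (by positivity) (by positivity)) hc.le
        refine Real.rpow_le_rpow_of_nonpos (by positivity) ?_ (by linarith)
        have h1 : blockIdx m l k + 1 ≤ 2 * 2 ^ (m + l : ℕ) := by
          have := k.isLt
          rw [blockIdx]
          omega
        exact_mod_cast h1

/-- A point `c x^(β)` of monomial convergence has `β ≥ 1 / r`: otherwise the sums over the blocks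
outgrow the bounds for the random polynomials. -/
theorem recip_le_of_smul_logSeq_mem {β c : ℝ} (hc : 0 < c)
    (hz : (c : ℂ) • logSeq (recip r + sigmaExp r) β ∈ monHInfty r) : recip r ≤ β := by
  by_contra! hβ
  obtain ⟨S, hS⟩ := exists_prod_sum_norm_le hz
  set κ : ℝ := c * 2 ^ (-(recip r + sigmaExp r)) * 4 ^ (-|β|) with hκ
  have hκ0 : 0 < κ := by positivity
  have hlim : Filter.Tendsto (fun m : ℕ => κ / 4000 * (m : ℝ) ^ (recip r - β)) Filter.atTop
      Filter.atTop :=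
    ((tendsto_rpow_atTop (by linarith)).comp tendsto_natCast_atTop_atTop).const_mul_atTop
      (by positivity)
  obtain ⟨m, hm1, hm2, hm3⟩ := ((hlim.eventually_ge_atTop 2).and
    ((Filter.eventually_gt_atTop 0).and
      (tendsto_natCast_atTop_atTop.eventually_ge_atTop S))).exists
  have hm' : (0 : ℝ) < m := by exact_mod_cast hm2
  -- the block sizes enter the lower bound for the sums and the bound for the norms in the same way
  set G : ℝ := ∏ l : Fin m, ((2 : ℝ) ^ (m + l : ℕ)) ^ (1 - recip r - sigmaExp r) with hG
  have hG0 : 0 < G := by positivity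
  have h1 : (κ * (m : ℝ) ^ (-β)) ^ m * G ≤ S * (4 ^ m * blockBound r m) := by
    refine le_trans ?_ (hS m)
    calc (κ * (m : ℝ) ^ (-β)) ^ m * G = ∏ l : Fin m, (κ * (m : ℝ) ^ (-β) *
          ((2 : ℝ) ^ (m + l : ℕ)) ^ (1 - recip r - sigmaExp r)) := by
          rw [Finset.prod_mul_distrib, Finset.prod_const, Finset.card_univ, Fintype.card_fin]
      _ ≤ _ := by
          refine Finset.prod_le_prod (fun l _ => by positivity) fun l _ => ?_
          have := mul_rpow_le_sum_norm_blockIdx (β := β) (recip_add_sigmaExp_nonneg r) hc l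
          rwa [← sub_sub] at this
  have h2 : S * (4 ^ m * blockBound r m) =
      S * (4000 ^ m * ((m : ℝ) ^ (-recip r)) ^ m) * G := by
    rw [blockBound, ← hG, Real.inv_rpow (by positivity), ← Real.rpow_neg (by positivity),
      ← Real.rpow_pow_comm hm'.le, show (4000 : ℝ) = 4 * 1000 by norm_num, mul_pow]
    ring
  rw [h2] at h1
  have h3 := le_of_mul_le_mul_right h1 hG0
  have h4 : (κ * (m : ℝ) ^ (-β)) ^ m = (κ / 4000 * (m : ℝ) ^ (recip r - β)) ^ m *
      (4000 ^ m * ((m : ℝ) ^ (-recip r)) ^ m) := by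
    rw [← mul_pow, ← mul_pow, sub_eq_add_neg, Real.rpow_add hm', Real.rpow_neg hm'.le (recip r)]
    congr 1
    have : (m : ℝ) ^ recip r ≠ 0 := (Real.rpow_pos_of_pos hm' _).ne'
    field_simp
  rw [h4] at h3
  have h5 := le_of_mul_le_mul_right h3 (by positivity)
  have h6 : (2 : ℝ) ^ m ≤ (κ / 4000 * (m : ℝ) ^ (recip r - β)) ^ m :=
    pow_le_pow_left₀ zero_le_two hm1 m
  have h7 : (m : ℝ) < 2 ^ m := by exact_mod_cast Nat.lt_two_pow_self
  linarith

end

end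

theorem theorem5p4 (r : ℝ≥0∞) [Fact (1 ≤ r)] :
    (r ≤ 2 →
      (∀ θ : ℝ, 1 / 2 < θ → ∀ u ∈ seqBall r,
        logSeq (sigmaExp r) (θ * sigmaExp r) * u ∈ monHInfty r) ∧
      (∀ β : ℝ, recip r / 2 + 1 / 2 < β → ∀ c : ℝ, 0 < c →
        (c : ℂ) • logSeq (recip r + sigmaExp r) β ∈ seqBall r →
        (c : ℂ) • logSeq (recip r + sigmaExp r) β ∈ monHInfty r)) ∧
    (2 ≤ r →
      (∀ θ : ℝ, 0 < θ → ∀ u ∈ seqBall r,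
        logSeq (sigmaExp r) θ * u ∈ monHInfty r) ∧
      (∀ β : ℝ, recip r < β → ∀ c : ℝ, 0 < c →
        (c : ℂ) • logSeq (recip r + sigmaExp r) β ∈ seqBall r →
        (c : ℂ) • logSeq (recip r + sigmaExp r) β ∈ monHInfty r)) ∧
    (∀ β c : ℝ, 0 < c →
      (c : ℂ) • logSeq (recip r + sigmaExp r) β ∈ monHInfty r → recip r ≤ β) := by
  refine ⟨fun h2 => ⟨fun θ hθ u hu => logSeq_mul_mem_monHInfty_of_le_two h2 (by linarith) hu,
    fun β hβ c hc hz => smul_logSeq_mem_monHInfty_of_le_two h2 ?_ hc hz⟩,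
    fun h2 => ⟨fun θ hθ u hu => logSeq_mul_mem_monHInfty_of_two_le h2 hθ hu,
    fun β hβ c hc hz => smul_logSeq_mem_monHInfty_of_two_le h2 hβ hc hz⟩,
    fun β c hc hz => recip_le_of_smul_logSeq_mem hc hz⟩
  have h1 : recip r ≤ 1 := by
    rw [recip_eq]
    exact inv_le_one_of_one_le₀ (one_le_toReal (ne_top_of_le_ne_top (by simp) h2))
  linarith
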